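/- Let $R$ be a commutative $\mathbb{Q}$-algebra (for example $\mathbb{C}$, $\mathbb{C}[\beta]$ or $\mathbb{C}[[\beta]]$). A formal power series $F\in R[[p_1,p_2,\dots]]$ is called a solution of the KP hierarchy if $\tau=e^{F-F(0)}$ satisfies Hirota's bilinear equations $$\sum_{j\ge0}h_j(p-p')\,[w^{j+1}]\Bigl(\tau(p_1-w,p_2-w^2,\dots)\,\tau(p'_1+w,p'_2+w^2,\dots)\Bigr)=0$$ identically in $p=(p_1,p_2,\dots)$ and $p'=(p'_1,p'_2,\dots)$, where $[w^m]$ denotes the coefficient of $w^m$ and $\sum_{j\ge0}h_j(u)v^j=\exp\bigl(\sum_{k\ge1}u_kv^k/k\bigr)$. Let $x(z)\in R[[z]]$ be an invertible series, that is, $x(0)=0$ and $x'(0)$ is a unit of $R$. Define $c^b_k\in R$ by $x(z)^b=\sum_{k\ge b}c^b_kz^k$, and consider the linear change of variables $p\to p(q)$ given by $p_b=\sum_{k\ge b}c^b_kq_k$, $b\ge1$. Then there is a (possibly infinite) quadratic form $Q(p)=\sum_{i,j\ge1}a_{ij}p_ip_j$ with $a_{ij}\in R$ such that the transformation $$\Phi(p_1,p_2,\dots)\;\longmapsto\;\Psi(q_1,q_2,\dots)=(\Phi+Q)\big|_{p\to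 p(q)}$$ is an automorphism of the KP hierarchy: it is a bijection from $R[[p_1,p_2,\dots]]$ to $R[[q_1,q_2,\dots]]$, and $\Phi$ is a solution of the KP hierarchy (in the variables $p$) if and only if $\Psi$ is a solution (in the variables $q$). Moreover, for every $\beta\in R$, in the case $x(z)=\frac{z}{1+\beta z}\,e^{-\frac{\beta z}{1+\beta z}}$ this holds for $Q=-H_{0,2}$, where $$H_{0,2}=\frac12\sum_{b_1,b_2\ge1}\frac{b_1^{b_1}\,b_2^{b_2}}{(b_1+b_2)\,b_1!\,b_2!}\,\beta^{b_1+b_2}\,p_{b_1}p_{b_2}.$$ -/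

import Mathlib

noncomputable section

namespace KP

variable {R : Type*} [CommRing R]

/-- The linear form `∑ₖ c k * pₖ` in infinitely many variables `p₁, p₂, …`
(a formal infinite sum). -/
def linForm (c : ℕ+ → R) : MvPowerSeries ℕ+ R := fun d =>
  ∑ k ∈ d.support, if d = Finsupp.single k 1 then c k else 0

/-- The quadratic form `∑_{i,j} a i j * pᵢ * pⱼ`, the sum being over all ordered pairs `(i, j)`
(a formal infinite sum). -/
def quadForm (a : ℕ+ → ℕ+ → R) : MvPowerSeries ℕ+ R := fun d =>
  ∑ ij ∈ d.support ×ˢ d.support,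
    if d = Finsupp.single ij.1 1 + Finsupp.single ij.2 1 then a ij.1 ij.2 else 0

theorem coeff_linForm (c : ℕ+ → R) (d : ℕ+ →₀ ℕ) : MvPowerSeries.coeff d (linForm c) =
    ∑ k ∈ d.support, if d = Finsupp.single k 1 then c k else 0 := rfl

theorem coeff_single_linForm (c : ℕ+ → R) (k : ℕ+) :
    MvPowerSeries.coeff (Finsupp.single k 1) (linForm c) = c k := by
  classical
  rw [coeff_linForm, Finset.sum_eq_single k] <;> simp +contextual [eq_comm]

/-- The linear change of variables `p_b = ∑ₖ c^b_k qₖ`, where `x(z)^b = ∑ₖ c^b_k z^k`. -/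
def linChange (x : PowerSeries R) (b : ℕ+) : MvPowerSeries ℕ+ R :=
  linForm fun k => PowerSeries.coeff (k : ℕ) (x ^ (b : ℕ))

/-- The change of variables can be substituted into every series. -/
theorem hasSubst_linChange {x : PowerSeries R} (hx : PowerSeries.constantCoeff x = 0) :
    MvPowerSeries.HasSubst (linChange x) where
  const_coeff b := by
    have : MvPowerSeries.constantCoeff (linChange x b) = 0 := by
      rw [← MvPowerSeries.coeff_zero_eq_constantCoeff_apply, linChange, coeff_linForm]
      simp
    rw [this]
    exact IsNilpotent.zero
  coeff_zero d := by
    have hfin : (⋃ k ∈ d.support, {b : ℕ+ | b ≤ k}).Finite :=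
      d.support.finite_toSet.biUnion fun k _ => Set.finite_Iic k
    refine hfin.subset fun b hb => ?_
    simp only [Set.mem_ofPred_eq, linChange, coeff_linForm] at hb
    obtain ⟨k, hk, hne⟩ := Finset.exists_ne_zero_of_sum_ne_zero hb
    refine Set.mem_biUnion hk ?_
    by_contra hlt
    apply hne
    rw [Set.mem_ofPred_eq, not_le] at hlt
    rw [PowerSeries.coeff_of_lt_order, ite_self]
    refine lt_of_lt_of_le ?_ (PowerSeries.le_order_pow_of_constantCoeff_eq_zero _ hx)
    exact_mod_cast hlt

/-- The transformation `Φ(p) ↦ Ψ(q) = (Φ + Q)|_{p → p(q)}`. -/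
def transform (x : PowerSeries R) (Q Φ : MvPowerSeries ℕ+ R) : MvPowerSeries ℕ+ R :=
  MvPowerSeries.subst (linChange x) (Φ + Q)

/-- The coefficient of `w^j` of a series in the variables `p₁, p₂, …, p'₁, p'₂, …` and `w`. -/
def wCoeff (j : ℕ) (f : MvPowerSeries ((ℕ+ ⊕ ℕ+) ⊕ Unit) R) : MvPowerSeries (ℕ+ ⊕ ℕ+) R :=
  fun d => MvPowerSeries.coeff (Finsupp.sumElim d (Finsupp.single () j)) f

/-- The shifted variables can be substituted into every series. -/
theorem hasSubst_shift (e : R) (f : ℕ+ → ℕ+ ⊕ ℕ+) (hf : Function.Injective f) :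
    MvPowerSeries.HasSubst (fun k : ℕ+ =>
      (MvPowerSeries.X (.inl (f k)) + MvPowerSeries.C e * MvPowerSeries.X (.inr ()) ^ (k : ℕ) :
        MvPowerSeries ((ℕ+ ⊕ ℕ+) ⊕ Unit) R)) where
  const_coeff k := by
    have : (k : ℕ) ≠ 0 := k.ne_zero
    simp [this]
  coeff_zero d := by
    classical
    have h1 : {k : ℕ+ | d = Finsupp.single (.inl (f k)) 1}.Finite := by
      refine Set.Subsingleton.finite fun a ha b hb => ?_
      have h := (Finsupp.single_left_inj (one_ne_zero)).1 (ha.symm.trans hb)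
      exact hf (Sum.inl_injective h)
    have h2 : {k : ℕ+ | d = Finsupp.single (.inr ()) (k : ℕ)}.Finite := by
      refine Set.Subsingleton.finite fun a ha b hb => ?_
      have h := Finsupp.single_injective _ (ha.symm.trans hb)
      exact PNat.coe_injective h
    refine (h1.union h2).subset fun k hk => ?_
    by_contra hcon
    rw [Set.mem_union, not_or] at hcon
    apply hk
    simp only [Set.mem_ofPred_eq] at hcon
    rw [map_add, MvPowerSeries.coeff_C_mul, MvPowerSeries.coeff_X, MvPowerSeries.coeff_X_pow,
      if_neg hcon.1, if_neg hcon.2]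
    simp

theorem hasSubst_shift_sub : MvPowerSeries.HasSubst (fun k : ℕ+ =>
    (MvPowerSeries.X (.inl (.inl k)) - MvPowerSeries.X (.inr ()) ^ (k : ℕ) :
      MvPowerSeries ((ℕ+ ⊕ ℕ+) ⊕ Unit) R)) := by
  simpa [sub_eq_add_neg] using hasSubst_shift (-1 : R) Sum.inl Sum.inl_injective

theorem hasSubst_shift_add : MvPowerSeries.HasSubst (fun k : ℕ+ =>
    (MvPowerSeries.X (.inl (.inr k)) + MvPowerSeries.X (.inr ()) ^ (k : ℕ) :
      MvPowerSeries ((ℕ+ ⊕ ℕ+) ⊕ Unit) R)) := by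
  simpa using hasSubst_shift (1 : R) Sum.inr Sum.inr_injective

/-- The series `τ(p₁ - w, p₂ - w², …) * τ(p'₁ + w, p'₂ + w², …)`. -/
def shiftedProduct (τ : MvPowerSeries ℕ+ R) : MvPowerSeries ((ℕ+ ⊕ ℕ+) ⊕ Unit) R :=
  MvPowerSeries.subst (fun k : ℕ+ =>
    (MvPowerSeries.X (.inl (.inl k)) - MvPowerSeries.X (.inr ()) ^ (k : ℕ) :
      MvPowerSeries ((ℕ+ ⊕ ℕ+) ⊕ Unit) R)) τ *
  MvPowerSeries.subst (fun k : ℕ+ =>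
    (MvPowerSeries.X (.inl (.inr k)) + MvPowerSeries.X (.inr ()) ^ (k : ℕ) :
      MvPowerSeries ((ℕ+ ⊕ ℕ+) ⊕ Unit) R)) τ

variable [Algebra ℚ R]

/-- The `j`-th elementary Schur polynomial `h_j` (complete symmetric function) evaluated at the
power sums `u₁, u₂, …`: `∑_j h_j(u) v^j = exp (∑_{k ≥ 1} u_k v^k / k)`. -/
def hSchur {A : Type*} [CommRing A] [Algebra ℚ A] (u : ℕ+ → A) (j : ℕ) : A :=
  PowerSeries.coeff j ((PowerSeries.exp A).subst
    (PowerSeries.mk fun k : ℕ => if h : 0 < k then (1 / k : ℚ) • u ⟨k, h⟩ else 0))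

/-- If `u k` only has terms of weight at least `k`, then `h_j(u)` only has terms of weight at least
`j`. -/
theorem coeff_hSchur_mul_eq_zero {σ : Type*} (wt : σ → ℕ) (u : ℕ+ → MvPowerSeries σ R)
    (hu : ∀ k : ℕ+, ((k : ℕ) : ℕ∞) ≤ (u k).weightedOrder wt) (f : MvPowerSeries σ R)
    (d : σ →₀ ℕ) (j : ℕ) (hj : Finsupp.weight wt d < j) :
    MvPowerSeries.coeff d (hSchur u j * f) = 0 := by
  set s : PowerSeries (MvPowerSeries σ R) :=
    PowerSeries.mk fun k : ℕ => if h : 0 < k then (1 / k : ℚ) • u ⟨k, h⟩ else 0 with hs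
  have hs0 : PowerSeries.constantCoeff s = 0 := by
    rw [← PowerSeries.coeff_zero_eq_constantCoeff_apply, hs, PowerSeries.coeff_mk]
    simp
  have hs1 (k : ℕ) : (k : ℕ∞) ≤ (PowerSeries.coeff k s).weightedOrder wt := by
    rw [hs, PowerSeries.coeff_mk]
    split_ifs with h
    · have h1 : (1 / k : ℚ) • u ⟨k, h⟩ = algebraMap ℚ R (1 / k) • u ⟨k, h⟩ := by
        rw [algebraMap_smul]
      rw [h1]
      exact (hu ⟨k, h⟩).trans (MvPowerSeries.le_weightedOrder_smul wt)
    · rw [MvPowerSeries.weightedOrder_zero]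
      exact le_top
  have hadd (n : ℕ) (a b : MvPowerSeries σ R) (ha : (n : ℕ∞) ≤ a.weightedOrder wt)
      (hb : (n : ℕ∞) ≤ b.weightedOrder wt) : (n : ℕ∞) ≤ (a + b).weightedOrder wt :=
    (le_min ha hb).trans (MvPowerSeries.min_weightedOrder_le_add wt)
  have hpow (m : ℕ) : ∀ k : ℕ, (k : ℕ∞) ≤ (PowerSeries.coeff k (s ^ m)).weightedOrder wt := by
    induction m with
    | zero =>
      intro k
      rw [pow_zero, PowerSeries.coeff_one]
      split_ifs with h
      · simp [h]
      · rw [MvPowerSeries.weightedOrder_zero]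
        exact le_top
    | succ m ih =>
      intro k
      rw [pow_succ, PowerSeries.coeff_mul]
      refine Finset.sum_induction _ (fun a : MvPowerSeries σ R => (k : ℕ∞) ≤ a.weightedOrder wt) (hadd k) ?_ ?_
      · rw [MvPowerSeries.weightedOrder_zero]
        exact le_top
      · intro p hp
        rw [← Finset.HasAntidiagonal.mem_antidiagonal.1 hp, Nat.cast_add]
        exact (add_le_add (ih p.1) (hs1 p.2)).trans (MvPowerSeries.le_weightedOrder_mul wt)
  have hord : (j : ℕ∞) ≤ (hSchur u j).weightedOrder wt := by
    rw [hSchur, PowerSeries.coeff_subst' (PowerSeries.HasSubst.of_constantCoeff_zero' hs0)]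
    refine finsum_induction (fun a : MvPowerSeries σ R => (j : ℕ∞) ≤ a.weightedOrder wt) ?_ (hadd j) fun m => ?_
    · rw [MvPowerSeries.weightedOrder_zero]
      exact le_top
    · rw [smul_eq_mul]
      exact (le_add_of_nonneg_of_le (zero_le) (hpow m j)).trans
        (MvPowerSeries.le_weightedOrder_mul wt)
  refine MvPowerSeries.coeff_eq_zero_of_lt_weightedOrder wt ?_
  refine lt_of_lt_of_le ?_ ((le_add_right hord).trans (MvPowerSeries.le_weightedOrder_mul wt))
  exact_mod_cast hj

/-- The Hirota bilinear equations of the KP hierarchy,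
`Res_{w = 0} exp (∑ₖ (pₖ - p'ₖ) w^{-k} / k) τ(pₖ - w^k) τ(p'ₖ + w^k) dw / w² = 0`
identically in `p, p'`. Since `exp (∑ₖ (pₖ - p'ₖ) w^{-k} / k) = ∑_j h_j(p - p') w^{-j}`, the residue
is `∑_j h_j(p - p') [w^{j+1}] (τ(pₖ - w^k) τ(p'ₖ + w^k))`; only finitely many `j` contribute to a
given monomial in `p, p'`, as `h_j(p - p')` has weight `j` for the grading
`deg pₖ = deg p'ₖ = k`. -/
def IsTauFunction (τ : MvPowerSeries ℕ+ R) : Prop :=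
  ∀ d : (ℕ+ ⊕ ℕ+) →₀ ℕ,
    ∑ᶠ j : ℕ, MvPowerSeries.coeff d
      (hSchur (fun k : ℕ+ => (MvPowerSeries.X (.inl k) - MvPowerSeries.X (.inr k) :
          MvPowerSeries (ℕ+ ⊕ ℕ+) R)) j * wCoeff (j + 1) (shiftedProduct τ)) = 0

/-- Only finitely many `j` contribute to each equation. -/
theorem coeff_hirota_eq_zero (f : MvPowerSeries (ℕ+ ⊕ ℕ+) R) (d : (ℕ+ ⊕ ℕ+) →₀ ℕ) (j : ℕ)
    (hj : Finsupp.weight (Sum.elim (fun k : ℕ+ => (k : ℕ)) (fun k : ℕ+ => (k : ℕ))) d < j) :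
    MvPowerSeries.coeff d
      (hSchur (fun k : ℕ+ => (MvPowerSeries.X (.inl k) - MvPowerSeries.X (.inr k) :
          MvPowerSeries (ℕ+ ⊕ ℕ+) R)) j * f) = 0 := by
  classical
  refine coeff_hSchur_mul_eq_zero _ _ (fun k => ?_) f d j hj
  refine MvPowerSeries.nat_le_weightedOrder _ fun e he => ?_
  rw [map_sub, MvPowerSeries.coeff_X, MvPowerSeries.coeff_X, if_neg, if_neg, sub_zero]
  · rintro rfl
    simp [Finsupp.weight_single] at he
  · rintro rfl
    simp [Finsupp.weight_single] at he

/-- The series `exp (F - F(0))`. -/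
def expNormalized (F : MvPowerSeries ℕ+ R) : MvPowerSeries ℕ+ R :=
  (PowerSeries.exp R).subst (F - MvPowerSeries.C (MvPowerSeries.constantCoeff F))

/-- `F` is a solution of the KP hierarchy: its exponent (normalized to have constant term `1`, which
is irrelevant because the equations involve only derivatives of `F`) is a `τ`-function. -/
def IsSolution (F : MvPowerSeries ℕ+ R) : Prop := IsTauFunction (expNormalized F)

/-- `T` is an automorphism of the KP hierarchy: an invertible transformation of the space of series
such that a series is a solution if and only if its image is. In particular `T` sends solutions to
solutions, and restricts to a bijection of the set of solutions. -/
def IsAutomorphism (T : MvPowerSeries ℕ+ R → MvPowerSeries ℕ+ R) : Prop :=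
  Function.Bijective T ∧ ∀ Φ, IsSolution Φ ↔ IsSolution (T Φ)

/-- The series `x(z) = z / (1 + β z) * exp (- β z / (1 + β z))`. -/
def xSeries (β : R) : PowerSeries R :=
  let g : PowerSeries R := PowerSeries.invOfUnit (1 + PowerSeries.C β * PowerSeries.X) 1
  PowerSeries.X * g * (PowerSeries.exp R).subst (-(PowerSeries.C β * PowerSeries.X * g))

/-- `H_{0,2} = 1/2 ∑_{i,j ≥ 1} i^i j^j / ((i + j) i! j!) pᵢ pⱼ β^{i+j}`. -/
def H02 (β : R) : MvPowerSeries ℕ+ R :=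
  quadForm fun i j =>
    ((1 / 2 : ℚ) * ((i : ℚ) ^ (i : ℕ) * (j : ℚ) ^ (j : ℕ) /
      (((i : ℚ) + j) * (Nat.factorial i : ℚ) * (Nat.factorial j : ℚ)))) • β ^ ((i : ℕ) + j)

end KP

end

/-!
Write the bilinear equations as the vanishing of the residue at `w = 0` of
`exp (∑ₖ (pₖ - p'ₖ) w⁻ᵏ / k) τ(pₖ - wᵏ) τ(p'ₖ + wᵏ) dw / w²`. In the variables `q` the linear change
`p_b = ∑ₖ c^b_k qₖ` turns the shift `qₖ ↦ qₖ - wᵏ` into `p_b ↦ p_b - x(w)ᵇ`. So the residue for the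
transformed series is the residue for the original one after the change of variable `w ↦ x(w)`,
provided that the exponential factors and the differentials match. All discrepancies are governed by
`log ((x(w) - x(z)) / (w - z)) = ∑ L_{kl} zᵏ wˡ`, which is symmetric in `z` and `w`:

* the two exponents `∑ₖ qₖ w⁻ᵏ / k` and `∑_b p_b x(w)⁻ᵇ / b` differ by
  `∑_{k ≥ 1, l ≥ 0} L_{kl} qₖ wˡ` (`sum_coeff_pow_smul`, `subst_dressedVar_linForm`);
* the quadratic form `1/2 ∑_{k, l ≥ 1} L_{kl} qₖ q_l`, shifted, produces the same terms with `l ≥ 1`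
  and the opposite sign, together with half of the diagonal restriction `∑_{k, l ≥ 1} L_{kl} w^(k+l)`
  (`subst_shiftVar_logQuadForm`); the two shifts together yield all of it;
* the exponential of that restriction is `x'(0) x' / v²` for `x = w v(w)` (`exp_subst_diagLog`), which
  turns `dw / w²` into `x'(0) dx / x²`.

What remains does not involve `w` and is an invertible factor. Hence a quadratic form `Q` that becomes
`1/2 ∑_{k, l ≥ 1} L_{kl} qₖ q_l` after the change of variables gives an automorphism
(`isAutomorphism_transform`). Such a `Q` is found with the compositional inverse of `x`.

To avoid Laurent series, the residue is expressed in the rescaled variables `Pₖ = w⁻ᵏ pₖ`: the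
exponent becomes `∑ₖ (Pₖ - P'ₖ) / k`, and the residue `scaledRes` collects the monomials `P^d w^n`
where `n - 1` is the weight of `d`. The change of variable in the residue (`scaledRes_subst`) then only uses substitutions
into power series, and rests on `[w^m] x' v^(-m-1) = 0` for `m ≥ 1`.

For `x = z / (1 + β z) exp (-β z / (1 + β z))` the Euler field `x ∂ₓ` is `z (1 + β z)² ∂_z`. The sum of
the Euler fields in both variables sends `∑_{k, l ≥ 1} L_{kl} zᵏ wˡ` to `-β² z w`
(`euler_offAxisLog`), and sends `2 H_{0,2}`, evaluated at `p_b p_{b'} = x(z)ᵇ x(w)ᵇ'`, to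
`(∑_{i ≥ 1} iⁱ / i! βⁱ x(z)ⁱ) (∑_{i ≥ 1} iⁱ / i! βⁱ x(w)ⁱ)`, which is `β² z w` by the tree function
identity (`coeff_sum_treeCoeff_mul_xSeries_pow`). Since this field annihilates only constants, the two
series are opposite.
-/

noncomputable section

namespace KP

section OneVariable

open PowerSeries
open Finset.HasAntidiagonal (antidiagonal)
open Finset (range sum_congr mul_sum)

/-! ### The divided difference and its logarithmic derivative -/

section Bivariate

variable {R : Type*} [CommRing R]

/-- Exchange of the two variables `z` (outer) and `w` (inner) of a series in `R⟦w⟧⟦z⟧`. -/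
def swap : R⟦X⟧⟦X⟧ →+* R⟦X⟧⟦X⟧ where
  toFun f := mk fun k => mk fun l => coeff k (coeff l f)
  map_one' := by
    ext k l
    simp only [coeff_mk, coeff_one]
    split_ifs <;> simp_all [coeff_one]
  map_zero' := by ext k l; simp
  map_add' f g := by ext k l; simp
  map_mul' f g := by
    ext k l
    simp only [coeff_mk, coeff_mul, map_sum]
    exact Finset.sum_comm

theorem coeff_coeff_swap (f : R⟦X⟧⟦X⟧) (k l : ℕ) :
    coeff l (coeff k (swap f)) = coeff k (coeff l f) := by
  simp [swap]

/-- Restriction of a series in `R⟦w⟧⟦z⟧` to the diagonal `z = w`. -/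
def diag : R⟦X⟧⟦X⟧ →+* R⟦X⟧ where
  toFun f := mk fun n => ∑ p ∈ antidiagonal n, coeff p.2 (coeff p.1 f)
  map_one' := by
    ext n
    simp only [coeff_mk, coeff_one]
    rw [Finset.sum_eq_single (0, n)]
    · simp [coeff_one]
    · rintro ⟨a, b⟩ hab hne
      rw [if_neg, map_zero]
      rintro (rfl : a = 0)
      simp_all
    · simp
  map_zero' := by ext k; simp
  map_add' f g := by ext k; simp [Finset.sum_add_distrib]
  map_mul' f g := by
    ext n
    simp only [coeff_mk, coeff_mul, map_sum, Finset.sum_mul_sum]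
    simp only [← Finset.sum_product', Finset.sum_sigma']
    refine Finset.sum_bij' (fun x _ => ⟨(x.2.1.1 + x.2.2.1, x.2.1.2 + x.2.2.2),
        (x.2.1.1, x.2.2.1), (x.2.1.2, x.2.2.2)⟩)
      (fun x _ => ⟨(x.2.1.1 + x.2.2.1, x.2.1.2 + x.2.2.2),
        (x.2.1.1, x.2.2.1), (x.2.1.2, x.2.2.2)⟩) ?_ ?_ ?_ ?_ ?_
    all_goals
      rintro ⟨⟨a, b⟩, ⟨c, d⟩, ⟨e, f⟩⟩ h
      simp only [Finset.mem_sigma, Finset.mem_product, Finset.HasAntidiagonal.mem_antidiagonal] at h ⊢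
    · obtain ⟨h1, h2, h3⟩ := h
      refine ⟨?_, by simp⟩
      omega
    · obtain ⟨h1, h2, h3⟩ := h
      refine ⟨?_, by simp⟩
      omega
    · obtain ⟨h1, h2, h3⟩ := h
      subst h2 h3
      rfl
    · obtain ⟨h1, h2, h3⟩ := h
      subst h2 h3
      rfl

theorem coeff_diag (f : R⟦X⟧⟦X⟧) (n : ℕ) :
    coeff n (diag f) = ∑ p ∈ antidiagonal n, coeff p.2 (coeff p.1 f) := by
  simp [diag]

/-- The divided difference `(x(w) - x(z)) / (w - z)`. -/
def divDiff (x : R⟦X⟧) : R⟦X⟧⟦X⟧ := mk fun k => mk fun l => coeff (k + l + 1) x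

theorem sub_mul_divDiff (x : R⟦X⟧) :
    (C X - X) * divDiff x = C x - map (C : R →+* R⟦X⟧) x := by
  ext k l
  rw [sub_mul]
  simp only [map_sub, coeff_C_mul, coeff_map, divDiff]
  rcases k with _ | k <;> rcases l with _ | l <;>
    simp [coeff_C, coeff_succ_X_mul, add_assoc, add_comm, add_left_comm]

theorem swap_divDiff (x : R⟦X⟧) : swap (divDiff x) = divDiff x := by
  ext k l
  simp [coeff_coeff_swap, divDiff, add_comm]

/-- The series `x(z) / z`. -/
def shift (x : R⟦X⟧) : R⟦X⟧ := mk fun n => coeff (n + 1) x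

theorem X_mul_shift {x : R⟦X⟧} (hx : constantCoeff x = 0) : X * shift x = x := by
  ext n
  rcases n with _ | n <;> simp [shift, hx, coeff_succ_X_mul]

theorem constantCoeff_shift (x : R⟦X⟧) : constantCoeff (shift x) = coeff 1 x := by
  rw [← coeff_zero_eq_constantCoeff_apply, shift, coeff_mk]

theorem isUnit_shift {x : R⟦X⟧} (hu : IsUnit (coeff 1 x)) : IsUnit (shift x) := by
  rw [isUnit_iff_constantCoeff, constantCoeff_shift]
  exact hu

theorem constantCoeff_divDiff (x : R⟦X⟧) : constantCoeff (divDiff x) = shift x := by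
  rw [← coeff_zero_eq_constantCoeff_apply, divDiff, coeff_mk, shift]
  simp

theorem isUnit_divDiff {x : R⟦X⟧} (hu : IsUnit (coeff 1 x)) : IsUnit (divDiff x) := by
  rw [isUnit_iff_constantCoeff, constantCoeff_divDiff]
  exact isUnit_shift hu

/-- The logarithmic derivative of `(x(w) - x(z)) / (w - z)` with respect to `z`. -/
def logDiff (x : R⟦X⟧) : R⟦X⟧⟦X⟧ :=
  derivative R⟦X⟧ (divDiff x) * Ring.inverse (divDiff x)

theorem logDiff_mul_divDiff {x : R⟦X⟧} (hu : IsUnit (coeff 1 x)) :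
    logDiff x * divDiff x = derivative R⟦X⟧ (divDiff x) := by
  rw [logDiff, mul_assoc, Ring.inverse_mul_cancel _ (isUnit_divDiff hu), mul_one]

theorem swap_inverse_divDiff {x : R⟦X⟧} (hu : IsUnit (coeff 1 x)) :
    swap (Ring.inverse (divDiff x)) = Ring.inverse (divDiff x) := by
  have h := isUnit_divDiff hu
  have h1 : divDiff x * swap (Ring.inverse (divDiff x)) = 1 := by
    conv_lhs => rw [← swap_divDiff x, ← map_mul]
    rw [swap_divDiff, Ring.mul_inverse_cancel _ h, map_one]
  calc swap (Ring.inverse (divDiff x))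
      = Ring.inverse (divDiff x) * divDiff x * swap (Ring.inverse (divDiff x)) := by
        rw [Ring.inverse_mul_cancel _ h, one_mul]
    _ = _ := by rw [mul_assoc, h1, mul_one]

theorem derivative_mul {A : Type*} [CommRing A] (f g : A⟦X⟧) :
    derivative A (f * g) = derivative A f * g + f * derivative A g := by
  rw [Derivation.leibniz, smul_eq_mul, smul_eq_mul]
  ring

theorem derivative_add {A : Type*} [CommRing A] (f g : A⟦X⟧) :
    derivative A (f + g) = derivative A f + derivative A g :=
  map_add _ _ _

theorem derivative_sub {A : Type*} [CommRing A] (f g : A⟦X⟧) :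
    derivative A (f - g) = derivative A f - derivative A g :=
  map_sub _ _ _

theorem coeff_derivative' {A : Type*} [CommRing A] (f : A⟦X⟧) (n : ℕ) :
    coeff n (derivative A f) = ((n + 1 : ℕ) : A) * coeff (n + 1) f := by
  rw [coeff_derivative, mul_comm, Nat.cast_succ]

theorem coeff_natCast_mul {A : Type*} [CommRing A] (m : ℕ) (f : A⟦X⟧) (n : ℕ) :
    coeff n ((m : A⟦X⟧) * f) = (m : A) * coeff n f := by
  rw [← map_natCast (C : A →+* A⟦X⟧), coeff_C_mul]

theorem derivative_inverse {A : Type*} [CommRing A] {f : A⟦X⟧} (hf : IsUnit f) :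
    derivative A (Ring.inverse f) = -(Ring.inverse f ^ 2 * derivative A f) := by
  have h := congrArg (derivative A) (Ring.mul_inverse_cancel f hf)
  rw [derivative_mul, derivative_one] at h
  have h1 := Ring.mul_inverse_cancel f hf
  linear_combination Ring.inverse f * h - (derivative A (Ring.inverse f)) * h1

theorem derivative_swap_derivative_divDiff (x : R⟦X⟧) :
    swap (derivative R⟦X⟧ (swap (derivative R⟦X⟧ (divDiff x)))) =
      derivative R⟦X⟧ (swap (derivative R⟦X⟧ (divDiff x))) := by
  have key (k l : ℕ) : coeff l (coeff k (derivative R⟦X⟧ (swap (derivative R⟦X⟧ (divDiff x))))) =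
      coeff (l + k + 3) x * (l + 1) * (k + 1) := by
    rw [coeff_derivative', coeff_natCast_mul, coeff_coeff_swap, coeff_derivative',
      coeff_natCast_mul, divDiff, coeff_mk, coeff_mk]
    push_cast
    ring_nf
  ext k l
  rw [coeff_coeff_swap, key, key, add_comm k l]
  ring

/-- The mixed second logarithmic derivative of the symmetric series `divDiff x` is symmetric. -/
theorem swap_derivative_swap_logDiff {x : R⟦X⟧} (hu : IsUnit (coeff 1 x)) :
    swap (derivative R⟦X⟧ (swap (logDiff x))) = derivative R⟦X⟧ (swap (logDiff x)) := by
  have hd := derivative_inverse (A := R⟦X⟧) (f := divDiff x) (isUnit_divDiff hu)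
  have h : derivative R⟦X⟧ (swap (logDiff x)) =
      derivative R⟦X⟧ (swap (derivative R⟦X⟧ (divDiff x))) * Ring.inverse (divDiff x) -
        Ring.inverse (divDiff x) ^ 2 *
          (swap (derivative R⟦X⟧ (divDiff x)) * derivative R⟦X⟧ (divDiff x)) := by
    rw [logDiff, map_mul, swap_inverse_divDiff hu, derivative_mul, hd]
    ring
  have hss (f : R⟦X⟧⟦X⟧) : swap (swap f) = f := by
    ext k l
    simp [coeff_coeff_swap]
  rw [h, (swap (R := R)).map_sub, (swap (R := R)).map_mul, (swap (R := R)).map_mul,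
    (swap (R := R)).map_mul, (swap (R := R)).map_pow, swap_inverse_divDiff hu,
    derivative_swap_derivative_divDiff, hss]
  ring

end Bivariate

/-! ### Coefficients of the logarithm of the divided difference -/

section LogCoeff

variable {R : Type*} [CommRing R] [Algebra ℚ R]

theorem eq_of_natCast_mul_eq {n : ℕ} (hn : n ≠ 0) {a b : R} (h : (n : R) * a = n * b) : a = b := by
  have := IsAddTorsionFree.of_module_rat R
  exact nsmul_right_injective hn (by simpa [nsmul_eq_mul] using h)

theorem inv_smul_natCast_mul {A : Type*} [CommRing A] [Algebra ℚ A] {n : ℕ} (hn : n ≠ 0) (a : A) :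
    (1 / n : ℚ) • ((n : A) * a) = a := by
  rw [← nsmul_eq_mul, ← Nat.cast_smul_eq_nsmul ℚ, smul_smul,
    one_div_mul_cancel (by exact_mod_cast hn), one_smul]

theorem natCast_mul_inv_smul {A : Type*} [CommRing A] [Algebra ℚ A] {n : ℕ} (hn : n ≠ 0) (a : A) :
    (n : A) * ((1 / n : ℚ) • a) = a := by
  rw [mul_smul_comm, inv_smul_natCast_mul hn]

/-- The coefficients, for `k ≥ 1`, of `z ^ k * w ^ l` in the logarithm of
`(x(w) - x(z)) / (w - z)`, obtained from its derivative in `z`. For `k = 0`, where the logarithm would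
involve `log x'(0)`, the value is `0`. -/
def logCoeff (x : R⟦X⟧) (k l : ℕ) : R :=
  (1 / k : ℚ) • coeff l (coeff (k - 1) (logDiff x))

theorem natCast_mul_logCoeff (x : R⟦X⟧) (k l : ℕ) :
    ((k + 1 : ℕ) : R) * logCoeff x (k + 1) l = coeff l (coeff k (logDiff x)) := by
  rw [logCoeff, natCast_mul_inv_smul (Nat.succ_ne_zero k), Nat.add_sub_cancel]

theorem logCoeff_comm {x : R⟦X⟧} (hu : IsUnit (coeff 1 x)) {k l : ℕ} (hk : k ≠ 0) (hl : l ≠ 0) :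
    logCoeff x k l = logCoeff x l k := by
  obtain ⟨k, rfl⟩ := Nat.exists_eq_succ_of_ne_zero hk
  obtain ⟨l, rfl⟩ := Nat.exists_eq_succ_of_ne_zero hl
  have key (k l : ℕ) : coeff k (coeff l (derivative R⟦X⟧ (swap (logDiff x)))) =
      ((l + 1 : ℕ) : R) * (((k + 1 : ℕ) : R) * logCoeff x (k + 1) (l + 1)) := by
    rw [coeff_derivative', coeff_natCast_mul, coeff_coeff_swap, natCast_mul_logCoeff]
  have h := congrArg (fun f => coeff k (coeff l f)) (swap_derivative_swap_logDiff hu)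
  simp only [coeff_coeff_swap] at h
  rw [key, key] at h
  refine eq_of_natCast_mul_eq (Nat.succ_ne_zero k) (eq_of_natCast_mul_eq (Nat.succ_ne_zero l) ?_)
  rw [Nat.succ_eq_add_one, Nat.succ_eq_add_one]
  linear_combination -h

theorem X_mul_cancel {A : Type*} [CommRing A] {f g : A⟦X⟧} (h : X * f = X * g) : f = g := by
  ext n
  simpa [coeff_succ_X_mul] using congrArg (coeff (n + 1)) h

theorem derivative_rescale {A : Type*} [CommRing A] (a : A) (f : A⟦X⟧) :
    derivative A (rescale a f) = C a * rescale a (derivative A f) := by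
  ext n
  simp only [coeff_derivative, coeff_rescale, coeff_C_mul]
  ring

/-- The negative powers of `x(w)` in `-log (1 - x(z) / x(w))`, in terms of
`-log (1 - z / w)` and the logarithm of `(x(w) - x(z)) / (w - z)`. Here `x(w) = w v(w)`, and the
identity of the coefficients of `z ^ k` is multiplied by `w ^ k` to clear the negative powers
of `w`. -/
theorem sum_coeff_pow_smul {x : R⟦X⟧} (hx : constantCoeff x = 0) (hu : IsUnit (coeff 1 x))
    {k : ℕ} (hk : k ≠ 0) :
    ∑ b ∈ range k, (1 / (b + 1 : ℕ) : ℚ) •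
        (C (coeff k (x ^ (b + 1))) * (X ^ (k - (b + 1)) * Ring.inverse (shift x) ^ (b + 1))) =
      (1 / k : ℚ) • 1 - X ^ k * mk (logCoeff x k) := by
  obtain ⟨k, rfl⟩ := Nat.exists_eq_succ_of_ne_zero hk
  set v := shift x with hv
  set vi := Ring.inverse v with hvi
  have hvvi : v * vi = 1 := Ring.mul_inverse_cancel _ (isUnit_shift hu)
  set D := divDiff x with hD
  set ρ : R⟦X⟧⟦X⟧ →+* R⟦X⟧⟦X⟧ := rescale (X : R⟦X⟧) with hρ
  set V := ρ (map C v) with hV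
  set Y : R⟦X⟧⟦X⟧ := X * V * C vi with hY
  have hρC (f : R⟦X⟧) : ρ (C f) = C f := by
    ext n
    simp only [hρ, coeff_rescale, coeff_C]
    split_ifs with h <;> simp [h]
  have hρX : ρ X = C X * X := rescale_X _
  -- the divided difference after the substitution `z → z w`
  have h1 : (1 - X) * ρ D = C v * (1 - Y) := by
    have h := congrArg ρ (sub_mul_divDiff x)
    rw [map_mul, map_sub, map_sub, hρC, hρC, hρX] at h
    have hxx : C x = (C X * C v : R⟦X⟧⟦X⟧) := by rw [← map_mul, hv, X_mul_shift hx]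
    have hxm : ρ (map C x) = C X * X * V := by
      rw [hV, ← hρX, ← map_mul, hv]
      conv_lhs => rw [← X_mul_shift hx]
      rw [map_mul (map C), map_X]
    rw [hxx, hxm] at h
    have hc : (C X : R⟦X⟧⟦X⟧) * ((1 - X) * ρ D) = C X * (C v - X * V) := by
      linear_combination h
    have hcan {f g : R⟦X⟧⟦X⟧} (h : C X * f = C X * g) : f = g := by
      ext n : 1
      refine X_mul_cancel ?_
      simpa using congrArg (coeff n) h
    rw [hcan hc, hY]
    have : (C v * C vi : R⟦X⟧⟦X⟧) = 1 := by rw [← map_mul, hvvi, map_one]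
    linear_combination X * V * this
  have hYpow (b : ℕ) (hb : b ≤ k + 1) : coeff (k + 1) (Y ^ b) =
      C (coeff (k + 1) (x ^ b)) * (X ^ (k + 1 - b) * vi ^ b) := by
    obtain ⟨m, hm⟩ := Nat.exists_eq_add_of_le hb
    have e1 : Y ^ b = X ^ b * (ρ (map C (v ^ b)) * C (vi ^ b)) := by
      rw [hY, mul_pow, mul_pow, hV, map_pow, map_pow, map_pow, mul_assoc]
    have e2 : x ^ b = X ^ b * v ^ b := by rw [← mul_pow, hv, X_mul_shift hx]
    rw [e1, e2, hm, add_comm b m, coeff_X_pow_mul, coeff_X_pow_mul, Nat.add_sub_cancel,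
      coeff_mul_C, hρ, coeff_rescale, coeff_map]
    ring
  have hder : (1 - X) * derivative _ (ρ D) - ρ D = - (C v * derivative _ Y) := by
    have h := congrArg (derivative R⟦X⟧) h1
    rw [derivative_mul, derivative_mul, derivative_sub, derivative_sub, derivative_one, derivative_X,
      derivative_C] at h
    linear_combination h
  set Di := ρ (Ring.inverse D) with hDi
  have hDDi : ρ D * Di = 1 := by
    rw [hDi, ← map_mul, Ring.mul_inverse_cancel _ (isUnit_divDiff hu), map_one]
  set g : R⟦X⟧⟦X⟧ := mk 1 with hg
  have hg1 : (1 - X) * g = 1 := by rw [mul_comm, hg, mk_one_mul_one_sub_eq_one]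
  have hS : (1 - Y) * ∑ b ∈ range (k + 1), Y ^ b = 1 - Y ^ (k + 1) := by
    rw [mul_comm, geom_sum_mul_neg]
  have hYS : derivative _ Y * ∑ b ∈ range (k + 1), Y ^ b =
      (1 - Y ^ (k + 1)) * (g - derivative _ (ρ D) * Di) := by
    have e1 : C v * (1 - Y) * g * Di = 1 := by
      rw [← h1]
      linear_combination ρ D * Di * hg1 + hDDi
    have e2 : C v * derivative _ Y * g * Di = g - derivative _ (ρ D) * Di := by
      linear_combination (g * Di) * hder + g * hDDi - derivative _ (ρ D) * Di * hg1
    rw [← e2, ← hS]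
    linear_combination (-(derivative _ Y * ∑ b ∈ range (k + 1), Y ^ b)) * e1
  have hcoef : coeff k (derivative _ Y * ∑ b ∈ range (k + 1), Y ^ b) =
      1 - X ^ (k + 1) * coeff k (logDiff x) := by
    have e0 : derivative _ (ρ D) * Di = C X * ρ (logDiff x) := by
      rw [hρ, derivative_rescale, logDiff, map_mul, mul_assoc]
    have e1 : Y ^ (k + 1) = X ^ (k + 1) * (V * C vi) ^ (k + 1) := by
      rw [hY]
      ring
    rw [hYS, sub_mul, one_mul, map_sub, e1, mul_assoc, coeff_X_pow_mul', if_neg (by omega), sub_zero,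
      e0, map_sub, coeff_C_mul, hρ, coeff_rescale, hg, coeff_mk, Pi.one_apply]
    ring
  have hterm (b : ℕ) : (1 / (b + 1 : ℕ) : ℚ) • (((k + 1 : ℕ) : R⟦X⟧) * coeff (k + 1) (Y ^ (b + 1))) =
      coeff k (derivative _ Y * Y ^ b) := by
    rw [← coeff_derivative', derivative_pow, mul_assoc,
      ← map_natCast (C : R⟦X⟧ →+* R⟦X⟧⟦X⟧), coeff_C_mul, inv_smul_natCast_mul (Nat.succ_ne_zero b),
      Nat.add_sub_cancel, mul_comm]
  have hfin : ((k + 1 : ℕ) : R⟦X⟧) * ∑ b ∈ range (k + 1), (1 / (b + 1 : ℕ) : ℚ) •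
        (C (coeff (k + 1) (x ^ (b + 1))) * (X ^ (k + 1 - (b + 1)) * vi ^ (b + 1))) =
      1 - X ^ (k + 1) * coeff k (logDiff x) := by
    rw [← hcoef, mul_sum, mul_sum, map_sum]
    refine sum_congr rfl fun b hb => ?_
    rw [← hterm, hYpow _ (by simpa [Nat.succ_le_iff] using hb), mul_smul_comm]
  refine eq_of_natCast_mul_eq (Nat.succ_ne_zero k) ?_
  rw [Nat.succ_eq_add_one, hfin, mul_sub, natCast_mul_inv_smul (Nat.succ_ne_zero k)]
  congr 1
  have : coeff k (logDiff x) = ((k + 1 : ℕ) : R⟦X⟧) * mk (logCoeff x (k + 1)) := by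
    ext l
    rw [← natCast_mul_logCoeff, coeff_natCast_mul, coeff_mk]
  rw [this]
  ring

end LogCoeff

/-! ### Residues and the restriction to the diagonal -/

section Residue

variable {R : Type*} [CommRing R]

theorem derivative_eq_shift {x : R⟦X⟧} (hx : constantCoeff x = 0) :
    derivative R x = shift x + X * derivative R (shift x) := by
  conv_lhs => rw [← X_mul_shift hx]
  rw [derivative_mul, derivative_X, one_mul]

theorem constantCoeff_derivative (x : R⟦X⟧) : constantCoeff (derivative R x) = coeff 1 x := by
  rw [← coeff_zero_eq_constantCoeff_apply, coeff_derivative']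
  simp

theorem diag_divDiff (x : R⟦X⟧) : diag (divDiff x) = derivative R x := by
  ext n
  rw [coeff_diag, coeff_derivative']
  have h : ∀ p ∈ antidiagonal n, coeff p.2 (coeff p.1 (divDiff x)) = coeff (n + 1) x := by
    intro p hp
    rw [divDiff, coeff_mk, coeff_mk, Finset.HasAntidiagonal.mem_antidiagonal.1 hp]
  rw [Finset.sum_congr rfl h, Finset.sum_const, Finset.Nat.card_antidiagonal, nsmul_eq_mul]

theorem map_constantCoeff_divDiff (x : R⟦X⟧) :
    map (constantCoeff (R := R)) (divDiff x) = shift x := by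
  ext n
  rw [coeff_map, ← coeff_zero_eq_constantCoeff_apply, divDiff, coeff_mk, coeff_mk, shift, coeff_mk]

theorem derivative_map {A B : Type*} [CommRing A] [CommRing B] (g : A →+* B) (f : A⟦X⟧) :
    derivative B (map g f) = map g (derivative A f) := by
  ext n
  rw [coeff_map, coeff_derivative', coeff_derivative', map_mul, map_natCast, coeff_map]

theorem two_mul_diag_derivative_divDiff (x : R⟦X⟧) :
    2 * diag (derivative R⟦X⟧ (divDiff x)) = derivative R (derivative R x) := by
  ext n
  have h : ∑ p ∈ antidiagonal n, ((p.1 + 1 : ℕ) : R) = ∑ p ∈ antidiagonal n, ((p.2 + 1 : ℕ) : R) := by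
    rw [← Finset.Nat.sum_antidiagonal_swap]
    rfl
  have h2 : ∑ p ∈ antidiagonal n, ((p.1 + 1 : ℕ) : R) + ∑ p ∈ antidiagonal n, ((p.1 + 1 : ℕ) : R) =
      ((n + 1 : ℕ) : R) * ((n + 1 + 1 : ℕ) : R) := by
    nth_rw 2 [h]
    rw [← Finset.sum_add_distrib]
    have h4 : ∀ p ∈ antidiagonal n, ((p.1 + 1 : ℕ) : R) + ((p.2 + 1 : ℕ) : R) =
        ((n + 1 + 1 : ℕ) : R) := by
      intro p hp
      rw [← Finset.HasAntidiagonal.mem_antidiagonal.1 hp]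
      push_cast
      ring
    rw [Finset.sum_congr rfl h4, Finset.sum_const, Finset.Nat.card_antidiagonal, nsmul_eq_mul]
  have h3 : ∀ p ∈ antidiagonal n, coeff p.2 (coeff p.1 (derivative R⟦X⟧ (divDiff x))) =
      ((p.1 + 1 : ℕ) : R) * coeff (n + 1 + 1) x := by
    intro p hp
    rw [coeff_derivative', coeff_natCast_mul, divDiff, coeff_mk, coeff_mk, add_right_comm p.1,
      Finset.HasAntidiagonal.mem_antidiagonal.1 hp]
  rw [two_mul, map_add, coeff_diag, coeff_derivative', coeff_derivative', Finset.sum_congr rfl h3,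
    ← Finset.sum_mul, ← add_mul, h2, mul_assoc]

theorem map_constantCoeff_logDiff_mul {x : R⟦X⟧} (hu : IsUnit (coeff 1 x)) :
    map (constantCoeff (R := R)) (logDiff x) * shift x = derivative R (shift x) := by
  rw [← map_constantCoeff_divDiff, ← map_mul, logDiff_mul_divDiff hu, derivative_map]

variable [Algebra ℚ R]

/-- The residue of `x ^ (-m) dx` vanishes for `m > 1` and is `1` for `m = 1`, where
`x = z v(z)`. -/
theorem coeff_derivative_mul_inverse_pow {x : R⟦X⟧} (hx : constantCoeff x = 0)
    (hu : IsUnit (coeff 1 x)) (m : ℕ) :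
    coeff m (derivative R x * Ring.inverse (shift x) ^ (m + 1)) = if m = 0 then 1 else 0 := by
  have hv := Ring.mul_inverse_cancel _ (isUnit_shift hu)
  set v := shift x with hv'
  set vi := Ring.inverse v
  rcases m with _ | n
  · have h := congrArg constantCoeff hv
    rw [map_mul, map_one, hv', constantCoeff_shift] at h
    rw [zero_add, pow_one, coeff_zero_eq_constantCoeff_apply, map_mul, constantCoeff_derivative,
      if_pos rfl, h]
  · rw [if_neg (Nat.succ_ne_zero n)]
    refine eq_of_natCast_mul_eq (Nat.succ_ne_zero n) ?_
    have h1 : derivative R (vi ^ (n + 1)) = ((n + 1 : ℕ) : R⟦X⟧) * -(vi ^ (n + 2) * derivative R v) := by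
      rw [derivative_pow, derivative_inverse (isUnit_shift hu), Nat.add_sub_cancel]
      ring
    have h2 : derivative R x * vi ^ (n + 1 + 1) = vi ^ (n + 1) + X * (vi ^ (n + 2) * derivative R v) := by
      rw [derivative_eq_shift hx]
      linear_combination vi ^ (n + 1) * hv
    have h3 := congrArg (coeff n) h1
    rw [coeff_derivative', coeff_natCast_mul, map_neg] at h3
    rw [h2, map_add, coeff_succ_X_mul, mul_zero, mul_add, Nat.succ_eq_add_one, h3]
    ring

/-- The change of variables `w → x(w)` in the residue of `x ^ (i - N - 2) dx`. -/
theorem coeff_inverse_pow_mul_pow {x : R⟦X⟧} (hx : constantCoeff x = 0)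
    (hu : IsUnit (coeff 1 x)) (N i : ℕ) :
    coeff (N + 1) (derivative R x * Ring.inverse (shift x) ^ 2 *
      (Ring.inverse (shift x) ^ N * x ^ i)) = if i = N + 1 then 1 else 0 := by
  have hv := Ring.mul_inverse_cancel _ (isUnit_shift hu)
  have hx' : x ^ i = X ^ i * shift x ^ i := by rw [← mul_pow, X_mul_shift hx]
  set v := shift x with hv'
  set vi := Ring.inverse v
  have h1 : derivative R x * vi ^ 2 * (vi ^ N * x ^ i) =
      X ^ i * (derivative R x * (vi ^ (N + 2) * v ^ i)) := by
    rw [hx']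
    ring
  rw [h1, coeff_X_pow_mul']
  split_ifs with h2 h3 h3
  · subst h3
    have h4 : vi ^ (N + 2) * v ^ (N + 1) = vi ^ (0 + 1) := by
      calc vi ^ (N + 2) * v ^ (N + 1) = (v * vi) ^ (N + 1) * vi := by ring
        _ = _ := by rw [hv]; ring
    rw [Nat.sub_self, h4, coeff_derivative_mul_inverse_pow hx hu, if_pos rfl]
  · obtain ⟨m, hm⟩ := Nat.exists_eq_add_of_le h2
    have h4 : vi ^ (N + 2) * v ^ i = vi ^ (m + 1) := by
      calc vi ^ (N + 2) * v ^ i = vi ^ (i + m + 1) * v ^ i := by rw [← hm]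
        _ = (v * vi) ^ i * vi ^ (m + 1) := by ring
        _ = _ := by rw [hv]; ring
    rw [h4, hm, Nat.add_sub_cancel_left, coeff_derivative_mul_inverse_pow hx hu, if_neg (by omega)]
  · omega
  · rfl

/-- The off-axis part of the coefficient of `z ^ k * w ^ l` in the logarithm of
`(x(w) - x(z)) / (w - z)`. -/
def offAxisLogCoeff (x : R⟦X⟧) (k l : ℕ) : R :=
  if k ≠ 0 ∧ l ≠ 0 then logCoeff x k l else 0

theorem offAxisLogCoeff_comm {x : R⟦X⟧} (hu : IsUnit (coeff 1 x)) (k l : ℕ) :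
    offAxisLogCoeff x k l = offAxisLogCoeff x l k := by
  by_cases hk : k = 0
  · simp [offAxisLogCoeff, hk]
  by_cases hl : l = 0
  · simp [offAxisLogCoeff, hl]
  rw [offAxisLogCoeff, offAxisLogCoeff, if_pos ⟨hk, hl⟩, if_pos ⟨hl, hk⟩, logCoeff_comm hu hk hl]

/-- The sum of `L k l * w ^ (k + l)` over `k, l ≥ 1`, where `L k l` are the coefficients of the
logarithm of `(x(w) - x(z)) / (w - z)`. -/
def diagLog (x : R⟦X⟧) : R⟦X⟧ := mk fun n => ∑ p ∈ antidiagonal n, offAxisLogCoeff x p.1 p.2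

theorem constantCoeff_diagLog (x : R⟦X⟧) : constantCoeff (diagLog x) = 0 := by
  rw [← coeff_zero_eq_constantCoeff_apply, diagLog, coeff_mk]
  simp [offAxisLogCoeff]

theorem natCast_mul_offAxisLogCoeff (x : R⟦X⟧) (k l : ℕ) :
    ((k + 1 : ℕ) : R) * offAxisLogCoeff x (k + 1) l = coeff l (coeff k (logDiff x)) -
      if l = 0 then coeff 0 (coeff k (logDiff x)) else 0 := by
  by_cases hl : l = 0
  · subst hl
    simp [offAxisLogCoeff]
  · rw [if_neg hl, sub_zero, offAxisLogCoeff, if_pos ⟨Nat.succ_ne_zero k, hl⟩,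
      natCast_mul_logCoeff]

/-- On the diagonal both partial derivatives of a symmetric series agree, whence the factor `2`. -/
theorem derivative_diagLog {x : R⟦X⟧} (hu : IsUnit (coeff 1 x)) :
    derivative R (diagLog x) =
      2 * (diag (logDiff x) - map (constantCoeff (R := R)) (logDiff x)) := by
  ext n
  have h1 : ((n + 1 : ℕ) : R) * ∑ p ∈ antidiagonal (n + 1), offAxisLogCoeff x p.1 p.2 =
      2 * ∑ p ∈ antidiagonal (n + 1), (p.1 : R) * offAxisLogCoeff x p.1 p.2 := by
    have h2 : ∑ p ∈ antidiagonal (n + 1), (p.1 : R) * offAxisLogCoeff x p.1 p.2 =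
        ∑ p ∈ antidiagonal (n + 1), (p.2 : R) * offAxisLogCoeff x p.1 p.2 := by
      rw [← Finset.Nat.sum_antidiagonal_swap]
      exact sum_congr rfl fun p _ => by
        rw [Prod.fst_swap, Prod.snd_swap, offAxisLogCoeff_comm hu]
    rw [two_mul]
    nth_rw 2 [h2]
    rw [← Finset.sum_add_distrib, mul_sum]
    refine sum_congr rfl fun p hp => ?_
    rw [← Finset.HasAntidiagonal.mem_antidiagonal.1 hp]
    push_cast
    ring
  have h3 : ∑ p ∈ antidiagonal n, (if p.2 = 0 then coeff 0 (coeff p.1 (logDiff x)) else 0) =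
      coeff 0 (coeff n (logDiff x)) := by
    rw [Finset.sum_eq_single (n, 0)]
    · simp
    · rintro ⟨a, b⟩ hab hne
      rw [if_neg]
      rintro (rfl : b = 0)
      simp_all
    · simp
  rw [coeff_derivative', diagLog, coeff_mk, h1, Finset.Nat.antidiagonal_succ, Finset.sum_cons,
    Finset.sum_map]
  simp only [Nat.cast_zero, zero_mul, zero_add, Function.Embedding.coe_prodMap, Prod.map_fst,
    Prod.map_snd, Function.Embedding.coeFn_mk, Function.Embedding.refl_apply, Nat.succ_eq_add_one,
    natCast_mul_offAxisLogCoeff]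
  rw [Finset.sum_sub_distrib, h3, two_mul, two_mul, map_add, map_sub, coeff_diag, coeff_map,
    coeff_zero_eq_constantCoeff_apply]

/-- The restriction of `log ((x(w) - x(z)) / (w - z))` to the diagonal: with `x = w v(w)`, its
part off the axes exponentiates to `x'(0) x' / v ^ 2`. -/
theorem exp_subst_diagLog {x : R⟦X⟧} (hu : IsUnit (coeff 1 x)) :
    (exp R).subst (diagLog x) =
      C (coeff 1 x) * (derivative R x * Ring.inverse (shift x) ^ 2) := by
  have := IsAddTorsionFree.of_module_rat R
  have hsub : HasSubst (diagLog x) := HasSubst.of_constantCoeff_zero' (constantCoeff_diagLog x)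
  have hxu : IsUnit (derivative R x) := by
    rw [isUnit_iff_constantCoeff, constantCoeff_derivative]
    exact hu
  have hv := Ring.mul_inverse_cancel _ (isUnit_shift hu)
  have hxi := Ring.mul_inverse_cancel _ hxu
  set F := (exp R).subst (diagLog x) with hF
  have hFd : derivative R F = F * derivative R (diagLog x) := by
    rw [hF, derivative_subst hsub, derivative_exp]
  have hK : derivative R (diagLog x) * (derivative R x * shift x) =
      derivative R (derivative R x) * shift x - 2 * (derivative R (shift x) * derivative R x) := by
    have h1 := congrArg diag (logDiff_mul_divDiff hu)
    rw [map_mul, diag_divDiff] at h1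
    rw [derivative_diagLog hu, ← two_mul_diag_derivative_divDiff, ← h1,
      ← map_constantCoeff_logDiff_mul hu]
    ring
  -- the quotient of the two sides has derivative zero
  have key : F * (shift x ^ 2 * Ring.inverse (derivative R x)) = C (coeff 1 x) := by
    refine derivative.ext ?_ ?_
    · rw [derivative_C, derivative_mul, derivative_mul, hFd, derivative_pow, derivative_inverse hxu]
      set xi := Ring.inverse (derivative R x)
      push_cast
      linear_combination (F * shift x * xi ^ 2) * hK -
        (F * derivative R (diagLog x) * shift x ^ 2 * xi + 2 * F * shift x * derivative R (shift x) * xi) * hxi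
    · have h1 := congrArg constantCoeff hxi
      rw [map_mul, map_one, constantCoeff_derivative] at h1
      have h2 : constantCoeff F = 1 := by
        rw [hF, ← coeff_zero_eq_constantCoeff_apply, coeff_subst' hsub, finsum_eq_single _ 0]
        · simp
        · intro n hn
          simp [constantCoeff_diagLog, hn]
      rw [map_mul, map_mul, map_pow, h2, constantCoeff_shift, constantCoeff_C]
      linear_combination coeff 1 x * h1
  rw [← key]
  linear_combination (-F * (shift x * Ring.inverse (shift x) + 1)) * hv -
    F * shift x ^ 2 * Ring.inverse (shift x) ^ 2 * hxi

end Residue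

/-! ### The tree function -/

section Tree

variable {R : Type*} [CommRing R]

/-- The series `z / (1 + β z)`. -/
def mobius (β : R) : R⟦X⟧ := X * invOfUnit (1 + C β * X) 1

theorem one_add_mul_invOfUnit (β : R) :
    (1 + C β * X) * invOfUnit (1 + C β * X) 1 = 1 := mul_invOfUnit _ _ (by simp)

theorem one_add_mul_mobius (β : R) : (1 + C β * X) * mobius β = X := by
  rw [mobius]
  linear_combination X * one_add_mul_invOfUnit β

theorem one_sub_mobius_mul (β : R) : (1 - C β * mobius β) * (1 + C β * X) = 1 := by
  linear_combination (-C β) * one_add_mul_mobius β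

theorem constantCoeff_mobius (β : R) : constantCoeff (mobius β) = 0 := by
  simp [mobius]

theorem hasSubst_mobius (β : R) : HasSubst (mobius β) :=
  HasSubst.of_constantCoeff_zero' (constantCoeff_mobius β)

theorem derivative_mobius (β : R) : (1 + C β * X) ^ 2 * derivative R (mobius β) = 1 := by
  have h := congrArg (derivative R) (one_add_mul_mobius β)
  rw [derivative_mul, map_add, derivative_one, derivative_mul, derivative_C, derivative_X] at h
  linear_combination (1 + C β * X) * h - C β * one_add_mul_mobius β

variable [Algebra ℚ R]

/-- The coefficients `i ^ i / i! * β ^ i` of `1 / (1 - T(β y))`, where `T` is the tree function, the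
solution of `T(y) * exp (-T(y)) = y`. -/
def treeCoeff (β : R) (i : ℕ) : R := ((i : ℚ) ^ i / (Nat.factorial i : ℚ)) • β ^ i

theorem sum_neg_one_pow_mul_choose_mul_pow (m : ℕ) :
    ∑ i ∈ range (m + 1), ((-1 : ℚ) ^ (m - i) * m.choose i * (i : ℚ) ^ m) = m.factorial := by
  have h := fwdDiff_iter_eq_sum_shift (1 : ℚ) (fun y : ℚ => y ^ m) m 0
  rw [fwdDiff_iter_eq_factorial] at h
  rw [Pi.natCast_apply] at h
  rw [h]
  refine sum_congr rfl fun i _ => ?_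
  simp

/-- The expansion `∑ i ^ i / i! * (β y) ^ i = 1 / (1 - β U)` for `y = U exp (-β U)`, truncated. The
coefficient of `U ^ m` is, up to the factor `m!`, the `m`-th finite difference of `t ^ m`. -/
theorem coeff_sum_treeCoeff_mul_pow (β : R) {n m : ℕ} (hm : m ≤ n) :
    coeff m (∑ i ∈ range (n + 1), C (treeCoeff β i) * (X * rescale (-β) (exp R)) ^ i) = β ^ m := by
  have h1 (i : ℕ) : coeff m (C (treeCoeff β i) * (X * rescale (-β) (exp R)) ^ i) =
      if i ≤ m then ((1 / (m.factorial : ℚ)) * ((-1 : ℚ) ^ (m - i) * m.choose i * (i : ℚ) ^ m)) • β ^ m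
        else 0 := by
    rw [coeff_C_mul, mul_pow, coeff_X_pow_mul']
    split_ifs with h
    · rw [← map_pow, exp_pow_eq_rescale_exp, coeff_rescale, coeff_rescale, coeff_exp, treeCoeff,
        Algebra.smul_def, Algebra.smul_def]
      have h2 : (-β) ^ (m - i) = algebraMap ℚ R ((-1) ^ (m - i)) * β ^ (m - i) := by
        rw [neg_pow]
        simp
      have h3 : (i : R) ^ (m - i) = algebraMap ℚ R ((i : ℚ) ^ (m - i)) := by simp
      have h4 : β ^ m = β ^ i * β ^ (m - i) := by rw [← pow_add, Nat.add_sub_cancel' h]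
      have h5 : (1 / (m.factorial : ℚ)) * ((-1 : ℚ) ^ (m - i) * m.choose i * (i : ℚ) ^ m) =
          (i : ℚ) ^ i / (i.factorial : ℚ) * ((-1) ^ (m - i) * ((i : ℚ) ^ (m - i) *
            (1 / ((m - i).factorial : ℚ)))) := by
        have : (i : ℚ) ^ m = (i : ℚ) ^ i * (i : ℚ) ^ (m - i) := by
          rw [← pow_add, Nat.add_sub_cancel' h]
        rw [Nat.cast_choose ℚ h, this]
        have := Nat.cast_ne_zero (R := ℚ).2 (Nat.factorial_ne_zero m)
        field_simp
      rw [h2, h3, h4, h5]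
      simp only [map_mul]
      ring
    · rw [mul_zero]
  rw [map_sum, sum_congr rfl fun i _ => h1 i, ← Finset.sum_filter]
  have h2 : (range (n + 1)).filter (· ≤ m) = range (m + 1) := by
    ext i
    simp only [Finset.mem_filter, Finset.mem_range]
    omega
  rw [h2, ← Finset.sum_smul, ← mul_sum, sum_neg_one_pow_mul_choose_mul_pow, one_div_mul_cancel,
    one_smul]
  exact Nat.cast_ne_zero.2 (Nat.factorial_ne_zero m)

theorem xSeries_eq (β : R) : xSeries β = (X * rescale (-β) (exp R)).subst (mobius β) := by
  have hs : HasSubst (C (-β) * X : R⟦X⟧) := HasSubst.of_constantCoeff_zero' (by simp)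
  have h1 : (rescale (-β) (exp R)).subst (mobius β) =
      (exp R).subst (-(C β * X * invOfUnit (1 + C β * X) 1)) := by
    rw [rescale_eq_subst, subst_comp_subst_apply (HasSubst.smul_X' (-β)) (hasSubst_mobius β)]
    congr 1
    rw [subst_smul (hasSubst_mobius β), subst_X (hasSubst_mobius β), mobius, smul_eq_C_mul]
    simp [mul_assoc]
  rw [subst_mul (hasSubst_mobius β), subst_X (hasSubst_mobius β), h1, xSeries, mobius]

/-- The factor `exp (-β z / (1 + β z))` of `x`. -/
def xExp (β : R) : R⟦X⟧ := (rescale (-β) (exp R)).subst (mobius β)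

theorem xSeries_eq_mul (β : R) : xSeries β = mobius β * xExp β := by
  rw [xSeries_eq, subst_mul (hasSubst_mobius β), subst_X (hasSubst_mobius β), xExp]

theorem constantCoeff_xSeries (β : R) : constantCoeff (xSeries β) = 0 := by
  rw [xSeries_eq_mul, map_mul, constantCoeff_mobius, zero_mul]

theorem derivative_xExp (β : R) :
    derivative R (xExp β) = -(C β * derivative R (mobius β) * xExp β) := by
  have h : derivative R (rescale (-β) (exp R)) = -(C β * rescale (-β) (exp R)) := by
    rw [derivative_rescale, derivative_exp]
    simp
  have h0 : (C β : R⟦X⟧).subst (mobius β) = C β := by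
    have := (substAlgHom (hasSubst_mobius β)).commutes β
    rw [coe_substAlgHom] at this
    exact this
  rw [xExp, derivative_subst (hasSubst_mobius β), h, ← coe_substAlgHom (hasSubst_mobius β), map_neg,
    map_mul, coe_substAlgHom, h0]
  ring

/-- The series `z (1 + β z) ^ 2`, the coefficient of the Euler field `x ∂ₓ` in the coordinate `z`. -/
def eulerCoeff (β : R) : R⟦X⟧ := X * (1 + C β * X) ^ 2

theorem eulerCoeff_mul_derivative_xSeries (β : R) :
    eulerCoeff β * derivative R (xSeries β) = xSeries β := by
  rw [xSeries_eq_mul, derivative_mul, derivative_xExp, eulerCoeff]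
  linear_combination (X * xExp β * (1 - C β * mobius β)) * derivative_mobius β -
    (1 - C β * mobius β) * xExp β * one_add_mul_mobius β + mobius β * xExp β * one_sub_mobius_mul β

theorem coeff_one_xSeries (β : R) : coeff 1 (xSeries β) = 1 := by
  have h1 : constantCoeff (invOfUnit (1 + C β * X : R⟦X⟧) 1) = 1 := by
    simp
  have h2 : constantCoeff (xExp β) = 1 := by
    rw [xExp, ← coeff_zero_eq_constantCoeff_apply, coeff_subst' (hasSubst_mobius β),
      finsum_eq_single _ 0]
    · simp
    · intro n hn
      simp [constantCoeff_mobius, hn]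
  rw [xSeries_eq_mul, mobius, mul_assoc, ← zero_add 1, coeff_succ_X_mul,
    coeff_zero_eq_constantCoeff_apply, map_mul, h1, h2, one_mul]

/-- The tree function identity `∑ i ^ i / i! * (β x) ^ i = 1 + β z`, truncated. -/
theorem coeff_sum_treeCoeff_mul_xSeries_pow (β : R) {n m : ℕ} (hm : m ≤ n) :
    coeff m (∑ i ∈ range (n + 1), C (treeCoeff β i) * xSeries β ^ i) = coeff m (1 + C β * X) := by
  set S : R⟦X⟧ := ∑ i ∈ range (n + 1), C (treeCoeff β i) * (X * rescale (-β) (exp R)) ^ i with hS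
  have h1 : X ^ (n + 1) ∣ (1 - C β * X) * S - 1 := by
    rw [X_pow_dvd_iff]
    intro m hm
    rw [sub_mul, one_mul, map_sub, map_sub, mul_assoc, coeff_C_mul,
      coeff_sum_treeCoeff_mul_pow β (Nat.lt_succ_iff.1 hm), coeff_one]
    rcases m with _ | m
    · simp
    · rw [coeff_succ_X_mul, coeff_sum_treeCoeff_mul_pow β (by omega), if_neg (Nat.succ_ne_zero m)]
      ring
  obtain ⟨r, hr⟩ := h1
  have h2 := congrArg (substAlgHom (hasSubst_mobius β)) hr
  have hC (b : R) : substAlgHom (hasSubst_mobius β) (C b : R⟦X⟧) = C b :=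
    (substAlgHom (hasSubst_mobius β)).commutes b
  have h3 : substAlgHom (hasSubst_mobius β) S =
      ∑ i ∈ range (n + 1), C (treeCoeff β i) * xSeries β ^ i := by
    rw [hS, map_sum]
    refine sum_congr rfl fun i _ => ?_
    rw [map_mul, map_pow, hC, xSeries_eq, coe_substAlgHom]
  rw [map_sub, map_mul, map_sub, map_mul, map_one, hC, substAlgHom_X, h3, map_mul, map_pow,
    substAlgHom_X] at h2
  set T : R⟦X⟧ := ∑ i ∈ range (n + 1), C (treeCoeff β i) * xSeries β ^ i
  have h4 : T = (1 + C β * X) + X ^ (n + 1) * (invOfUnit (1 + C β * X) 1 ^ (n + 1) *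
      substAlgHom (hasSubst_mobius β) r * (1 + C β * X)) := by
    have h5 : X ^ (n + 1) * invOfUnit (1 + C β * X) 1 ^ (n + 1) = mobius β ^ (n + 1) := by
      rw [← mul_pow, mobius]
    have h6 := one_sub_mobius_mul β
    linear_combination (1 + C β * X) * h2 - T * h6 -
      (substAlgHom (hasSubst_mobius β) r * (1 + C β * X)) * h5
  rw [h4, map_add, coeff_X_pow_mul', if_neg (by omega), add_zero]

end Tree

/-! ### The Euler field in two variables -/

section Euler

variable {R : Type*} [CommRing R]

theorem swap_swap (f : R⟦X⟧⟦X⟧) : swap (swap f) = f := by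
  ext k l
  simp [coeff_coeff_swap]

theorem swap_C (f : R⟦X⟧) : swap (C f) = map C f := by
  ext k l
  simp only [coeff_coeff_swap, coeff_map, coeff_C]
  split_ifs <;> simp_all

theorem swap_map_C (f : R⟦X⟧) : swap (map C f) = C f := by
  rw [← swap_C, swap_swap]

theorem coeff_coeff_map_mul_C (f g : R⟦X⟧) (k l : ℕ) :
    coeff l (coeff k (map C f * C g)) = coeff k f * coeff l g := by
  rw [coeff_mul_C, coeff_map, coeff_C_mul]

/-- The vector field `e(z) ∂_z + e(w) ∂_w` on series in two variables. -/
def euler (e : R⟦X⟧) (f : R⟦X⟧⟦X⟧) : R⟦X⟧⟦X⟧ :=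
  map C e * derivative R⟦X⟧ f + swap (map C e * derivative R⟦X⟧ (swap f))

theorem euler_mul (e : R⟦X⟧) (f g : R⟦X⟧⟦X⟧) :
    euler e (f * g) = euler e f * g + f * euler e g := by
  rw [euler, (swap (R := R)).map_mul f g, derivative_mul, derivative_mul, euler, euler]
  simp only [map_mul swap, map_add swap, swap_swap]
  ring

theorem euler_add (e : R⟦X⟧) (f g : R⟦X⟧⟦X⟧) : euler e (f + g) = euler e f + euler e g := by
  rw [euler, (swap (R := R)).map_add, derivative_add, derivative_add, mul_add, mul_add,
    (swap (R := R)).map_add, euler, euler]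
  ring

theorem euler_sub (e : R⟦X⟧) (f g : R⟦X⟧⟦X⟧) : euler e (f - g) = euler e f - euler e g := by
  rw [euler, (swap (R := R)).map_sub, derivative_sub, derivative_sub, mul_sub, mul_sub,
    (swap (R := R)).map_sub, euler, euler]
  ring

theorem euler_sum {ι : Type*} (e : R⟦X⟧) (s : Finset ι) (f : ι → R⟦X⟧⟦X⟧) :
    euler e (∑ i ∈ s, f i) = ∑ i ∈ s, euler e (f i) := by
  have h0 : euler e 0 = 0 := by simpa using euler_sub e 0 0
  classical
  induction s using Finset.induction_on with
  | empty => rw [Finset.sum_empty, Finset.sum_empty, h0]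
  | insert a s ha ih => rw [Finset.sum_insert ha, Finset.sum_insert ha, euler_add, ih]

theorem euler_map_C (e f : R⟦X⟧) : euler e (map C f) = map C (e * derivative R f) := by
  rw [euler, swap_map_C, derivative_C, mul_zero, map_zero, add_zero, derivative_map,
    map_mul (map C)]

theorem euler_C (e f : R⟦X⟧) : euler e (C f) = C (e * derivative R f) := by
  rw [euler, swap_C, derivative_C, mul_zero, zero_add, derivative_map, ← map_mul (map C),
    swap_map_C]

theorem swap_sub_mul_cancel {f g : R⟦X⟧⟦X⟧} (h : (C X - X) * f = (C X - X) * g) : f = g := by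
  have key (f : R⟦X⟧⟦X⟧) (h : (C X - X) * f = 0) (k : ℕ) : coeff k f = 0 := by
    have h' (n : ℕ) := congrArg (coeff n) h
    simp only [sub_mul, map_sub, coeff_C_mul, map_zero] at h'
    induction k with
    | zero =>
      have := h' 0
      rw [coeff_zero_X_mul, sub_zero] at this
      exact X_mul_cancel (by rw [this, mul_zero])
    | succ k ih =>
      have := h' (k + 1)
      rw [coeff_succ_X_mul, ih, sub_zero] at this
      exact X_mul_cancel (by rw [this, mul_zero])
  rw [← sub_eq_zero]
  ext1 k
  rw [key _ (by rw [mul_sub, h, sub_self]), map_zero]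

theorem coeff_X_mul_mul_derivative {r g : R⟦X⟧} (hr : constantCoeff r = 1) {k : ℕ}
    (hg : ∀ j < k, coeff j g = 0) : coeff k (X * r * derivative R g) = k * coeff k g := by
  rcases k with _ | k
  · simp [mul_assoc]
  · rw [mul_assoc, coeff_succ_X_mul, coeff_mul, Finset.sum_eq_single (0, k)]
    · rw [coeff_zero_eq_constantCoeff_apply, hr, one_mul, coeff_derivative']
    · rintro ⟨a, b⟩ hab hne
      rw [Finset.HasAntidiagonal.mem_antidiagonal] at hab
      have hb : b + 1 < k + 1 := by
        by_contra hb
        dsimp only at hab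
        exact hne (by ext <;> dsimp only <;> omega)
      rw [coeff_derivative', hg _ hb, mul_zero, mul_zero]
    · simp

theorem coeff_coeff_map_mul_derivative (e : R⟦X⟧) (f : R⟦X⟧⟦X⟧) (k l : ℕ) :
    coeff l (coeff k (map C e * derivative R⟦X⟧ f)) =
      coeff k (e * derivative R (coeff l (swap f))) := by
  rw [← coeff_coeff_swap, map_mul swap, swap_map_C, coeff_C_mul]
  congr 2
  ext n
  rw [coeff_coeff_swap, coeff_derivative', coeff_derivative', coeff_natCast_mul, coeff_coeff_swap]

variable [Algebra ℚ R]

/-- The Euler field acts on the lowest order terms of a series by their degree, so that it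
annihilates only constants. -/
theorem eq_zero_of_euler_eq_zero {r : R⟦X⟧} (hr : constantCoeff r = 1) {f : R⟦X⟧⟦X⟧} (n : ℕ)
    (h0 : coeff 0 (coeff 0 f) = 0)
    (h : ∀ k ≤ n, ∀ l ≤ n, coeff l (coeff k (euler (X * r) f)) = 0) :
    ∀ k ≤ n, ∀ l ≤ n, coeff l (coeff k f) = 0 := by
  suffices H : ∀ m k l : ℕ, k + l = m → k ≤ n → l ≤ n → coeff l (coeff k f) = 0 from
    fun k hk l hl => H _ k l rfl hk hl
  intro m
  induction m using Nat.strong_induction_on with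
  | _ m ih =>
    intro k l hm hk hl
    by_cases hkl : k + l = 0
    · obtain ⟨rfl, rfl⟩ : k = 0 ∧ l = 0 := by omega
      exact h0
    have h1 := h k hk l hl
    rw [euler, map_add, map_add, coeff_coeff_map_mul_derivative, coeff_coeff_swap,
      coeff_coeff_map_mul_derivative, swap_swap, coeff_X_mul_mul_derivative hr,
      coeff_X_mul_mul_derivative hr, coeff_coeff_swap, ← add_mul] at h1
    · refine eq_of_natCast_mul_eq hkl ?_
      rw [Nat.cast_add, h1, mul_zero]
    · intro j hj
      exact ih _ (by omega) k j rfl hk (by omega)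
    · intro j hj
      rw [coeff_coeff_swap]
      exact ih _ (by omega) j l rfl (by omega) hl

end Euler

/-! ### The quadratic form of the tree function -/

section TreeQuadratic

variable {R : Type*} [CommRing R] [Algebra ℚ R]

theorem euler_divDiff (β : R) : euler (eulerCoeff β) (divDiff (xSeries β)) =
    -(divDiff (xSeries β) * (2 * C (C β) * (X + C X) +
      C (C β) ^ 2 * (X ^ 2 + X * C X + C X ^ 2))) := by
  set D := divDiff (xSeries β) with hD
  have hX : (X : R⟦X⟧⟦X⟧) = map C X := (map_X _).symm
  have h := congrArg (euler (eulerCoeff β)) (sub_mul_divDiff (xSeries β))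
  have hmC (b : R) : map (C : R →+* R⟦X⟧) (C b) = C (C b) := by rw [map_C]
  rw [euler_mul, euler_sub, euler_sub, euler_C, euler_C, euler_map_C,
    eulerCoeff_mul_derivative_xSeries, ← sub_mul_divDiff, derivative_X, mul_one] at h
  have h2 : euler (eulerCoeff β) (X : R⟦X⟧⟦X⟧) = map C (eulerCoeff β) := by
    rw [hX, euler_map_C, derivative_X, mul_one]
  rw [h2, ← hD] at h
  have he : eulerCoeff β = X * (1 + C β * X) ^ 2 := rfl
  set ED := euler (eulerCoeff β) D
  rw [he] at h
  simp only [map_mul, map_pow, map_add, map_one, hmC, map_X] at h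
  apply swap_sub_mul_cancel
  linear_combination h

/-- The off-axis part of the logarithm of `(x(w) - x(z)) / (w - z)`. -/
def offAxisLog (x : R⟦X⟧) : R⟦X⟧⟦X⟧ := mk fun k => mk fun l => offAxisLogCoeff x k l

theorem swap_offAxisLog {x : R⟦X⟧} (hu : IsUnit (coeff 1 x)) :
    swap (offAxisLog x) = offAxisLog x := by
  ext k l
  rw [coeff_coeff_swap, offAxisLog, coeff_mk, coeff_mk, coeff_mk, coeff_mk,
    offAxisLogCoeff_comm hu]

theorem derivative_offAxisLog (x : R⟦X⟧) : derivative R⟦X⟧ (offAxisLog x) =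
    logDiff x - map C (map (constantCoeff (R := R)) (logDiff x)) := by
  ext k l
  rw [coeff_derivative', coeff_natCast_mul, offAxisLog, coeff_mk, coeff_mk,
    natCast_mul_offAxisLogCoeff, map_sub, map_sub, coeff_map, coeff_map, coeff_C,
    coeff_zero_eq_constantCoeff_apply]

theorem eulerCoeff_mul_derivative_shift (β : R) :
    eulerCoeff β * derivative R (shift (xSeries β)) =
      -((2 * C β * X + C β ^ 2 * X ^ 2) * shift (xSeries β)) := by
  have h1 := eulerCoeff_mul_derivative_xSeries β
  rw [derivative_eq_shift (constantCoeff_xSeries β)] at h1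
  nth_rw 3 [← X_mul_shift (constantCoeff_xSeries β)] at h1
  apply X_mul_cancel
  rw [eulerCoeff] at *
  linear_combination h1

theorem euler_offAxisLog (β : R) : euler (eulerCoeff β) (offAxisLog (xSeries β)) =
    -(C (C β) ^ 2 * X * C X) := by
  have hu : IsUnit (coeff 1 (xSeries β)) := by
    rw [coeff_one_xSeries]
    exact isUnit_one
  have hmC (b : R) : map (C : R →+* R⟦X⟧) (C b) = C (C b) := by rw [map_C]
  have hD := Ring.mul_inverse_cancel _ (isUnit_divDiff hu)
  have hv := Ring.mul_inverse_cancel _ (isUnit_shift hu)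
  set D := divDiff (xSeries β)
  set Di := Ring.inverse D
  set ℓ := map (constantCoeff (R := R)) (logDiff (xSeries β))
  have hℓ : eulerCoeff β * ℓ = -(2 * C β * X + C β ^ 2 * X ^ 2) := by
    have h1 : ℓ * shift (xSeries β) = _ := map_constantCoeff_logDiff_mul hu
    have h2 := eulerCoeff_mul_derivative_shift β
    rw [← h1] at h2
    linear_combination Ring.inverse (shift (xSeries β)) * h2 -
      (eulerCoeff β * ℓ + (2 * C β * X + C β ^ 2 * X ^ 2)) * hv
  have hℓm : map C (eulerCoeff β) * map C ℓ = -(2 * C (C β) * X + C (C β) ^ 2 * X ^ 2) := by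
    rw [← map_mul, hℓ]
    simp only [map_neg (map C), map_mul (map C), map_pow (map C), map_add (map C),
      map_ofNat (map C), hmC, map_X]
  have hswap : swap (2 * C (C β) * X + C (C β) ^ 2 * X ^ 2 : R⟦X⟧⟦X⟧) =
      2 * C (C β) * C X + C (C β) ^ 2 * C X ^ 2 := by
    have hX : swap (X : R⟦X⟧⟦X⟧) = C X := by rw [← map_X C, swap_map_C]
    simp only [map_mul, map_pow, map_add, map_ofNat, swap_C, hX, hmC]
  have hE := euler_divDiff β
  have hsD : swap D = D := swap_divDiff _
  have hsDi : swap Di = Di := swap_inverse_divDiff hu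
  rw [euler, hsD] at hE
  have hlog : logDiff (xSeries β) = derivative R⟦X⟧ D * Di := rfl
  rw [euler, swap_offAxisLog hu, derivative_offAxisLog, mul_sub, hℓm, map_sub swap, map_neg swap,
    hswap, hlog]
  have h3 : swap (map C (eulerCoeff β) * (derivative R⟦X⟧ D * Di)) =
      swap (map C (eulerCoeff β) * derivative R⟦X⟧ D) * Di := by
    rw [← mul_assoc, map_mul swap, hsDi]
  rw [h3]
  linear_combination Di * hE - (2 * C (C β) * (X + C X) +
      C (C β) ^ 2 * (X ^ 2 + X * C X + C X ^ 2)) * hD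

/-- The coefficients of the quadratic form `H_{0,2}`. -/
def treeQuadCoeff (β : R) (i j : ℕ) : R :=
  ((1 / 2 : ℚ) * ((i : ℚ) ^ i * (j : ℚ) ^ j /
    (((i : ℚ) + j) * (Nat.factorial i : ℚ) * (Nat.factorial j : ℚ)))) • β ^ (i + j)

theorem natCast_mul_two_mul_treeQuadCoeff (β : R) {i : ℕ} (hi : i ≠ 0) (j : ℕ) :
    ((i + j : ℕ) : R) * (2 * treeQuadCoeff β i j) = treeCoeff β i * treeCoeff β j := by
  have h1 : ((i + j : ℕ) : R) = algebraMap ℚ R ((i : ℚ) + j) := by simp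
  have h2 : (2 : R) = algebraMap ℚ R 2 := (map_ofNat (algebraMap ℚ R) 2).symm
  rw [treeQuadCoeff, treeCoeff, treeCoeff, h1, h2, Algebra.smul_def, Algebra.smul_def,
    Algebra.smul_def, pow_add]
  have h3 : (i : ℚ) + j ≠ 0 := by positivity
  have h4 : ((i : ℚ) + j) * (2 * ((1 / 2 : ℚ) * ((i : ℚ) ^ i * (j : ℚ) ^ j /
      (((i : ℚ) + j) * (Nat.factorial i : ℚ) * (Nat.factorial j : ℚ))))) =
      (i : ℚ) ^ i / (Nat.factorial i : ℚ) * ((j : ℚ) ^ j / (Nat.factorial j : ℚ)) := by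
    field_simp
  calc _ = algebraMap ℚ R (((i : ℚ) + j) * (2 * ((1 / 2 : ℚ) * ((i : ℚ) ^ i * (j : ℚ) ^ j /
      (((i : ℚ) + j) * (Nat.factorial i : ℚ) * (Nat.factorial j : ℚ)))))) * (β ^ i * β ^ j) := by
        simp only [map_mul]
        ring
    _ = _ := by
        rw [h4, map_mul]
        ring

/-- The off-axis part of the logarithm of `(x(w) - x(z)) / (w - z)` is `-2 H_{0,2}`, evaluated at
`p_i p_j = x(z) ^ i * x(w) ^ j`. The sums are truncated; the omitted terms do not contribute to the
coefficients at hand. -/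
theorem two_mul_sum_treeQuadCoeff (β : R) {n k l : ℕ} (hk : k ≤ n) (hl : l ≤ n) :
    2 * ∑ i ∈ range n, ∑ j ∈ range n, treeQuadCoeff β (i + 1) (j + 1) *
        (coeff k (xSeries β ^ (i + 1)) * coeff l (xSeries β ^ (j + 1))) =
      -offAxisLogCoeff (xSeries β) k l := by
  set x := xSeries β with hx
  set N : R⟦X⟧⟦X⟧ := ∑ i ∈ range n, ∑ j ∈ range n,
    C (C (2 * treeQuadCoeff β (i + 1) (j + 1))) * (map C (x ^ (i + 1)) * C (x ^ (j + 1))) with hN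
  have hNc (k l : ℕ) : coeff l (coeff k N) =
      2 * ∑ i ∈ range n, ∑ j ∈ range n, treeQuadCoeff β (i + 1) (j + 1) *
        (coeff k (x ^ (i + 1)) * coeff l (x ^ (j + 1))) := by
    rw [hN, map_sum, map_sum, mul_sum]
    refine sum_congr rfl fun i _ => ?_
    rw [map_sum, map_sum, mul_sum]
    refine sum_congr rfl fun j _ => ?_
    rw [coeff_C_mul, coeff_C_mul, coeff_coeff_map_mul_C, mul_assoc]
  have hpow (i : ℕ) : eulerCoeff β * derivative R (x ^ i) = (i : R⟦X⟧) * x ^ i := by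
    rcases i with _ | i
    · simp
    · rw [derivative_pow, Nat.add_sub_cancel, pow_succ]
      linear_combination ((i + 1 : ℕ) : R⟦X⟧) * x ^ i * eulerCoeff_mul_derivative_xSeries β
  set t : R⟦X⟧ := ∑ i ∈ range n, C (treeCoeff β (i + 1)) * x ^ (i + 1) with ht
  have ht1 (m : ℕ) (hm : m ≤ n) : coeff m t = coeff m (C β * X) := by
    have h := coeff_sum_treeCoeff_mul_xSeries_pow β hm
    rw [Finset.sum_range_succ', map_add, map_add, pow_zero, mul_one] at h
    have h0 : (C (treeCoeff β 0) : R⟦X⟧) = 1 := by simp [treeCoeff]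
    rw [h0] at h
    linear_combination h
  -- the factor `i + j` produced by the Euler fields cancels the denominator of `H_{0,2}`
  have hEN : euler (eulerCoeff β) N = map C t * C t := by
    rw [hN, euler_sum, ht, map_sum, map_sum, Finset.sum_mul_sum]
    refine sum_congr rfl fun i _ => ?_
    rw [euler_sum]
    refine sum_congr rfl fun j _ => ?_
    rw [euler_mul, euler_mul, euler_C, euler_C, euler_map_C, derivative_C, hpow, hpow]
    simp only [map_mul, map_natCast, map_C, mul_zero, map_zero, zero_mul, zero_add]
    have h := natCast_mul_two_mul_treeQuadCoeff β (Nat.succ_ne_zero i) (j + 1)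
    have h' := congrArg (fun a : R => (C (C a) : R⟦X⟧⟦X⟧)) h
    simp only [map_mul, map_natCast, Nat.succ_eq_add_one] at h'
    push_cast at h' ⊢
    linear_combination map C (x ^ (i + 1)) * C (x ^ (j + 1)) * h'
  have key := eq_zero_of_euler_eq_zero (r := (1 + C β * X) ^ 2) (by simp) (f := N + offAxisLog x) n
    ?_ ?_ k hk l hl
  · rw [map_add, map_add, hNc, offAxisLog, coeff_mk, coeff_mk] at key
    linear_combination key
  · have hx0 : constantCoeff x = 0 := constantCoeff_xSeries β
    rw [map_add, map_add, hNc, offAxisLog, coeff_mk, coeff_mk]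
    simp [offAxisLogCoeff, hx0]
  · intro k hk l hl
    have he : X * (1 + C β * X) ^ 2 = eulerCoeff β := rfl
    have hb : (C (C β) ^ 2 * X * C X : R⟦X⟧⟦X⟧) = map C (C β * X) * C (C β * X) := by
      simp only [map_mul, map_C, map_X]
      ring
    rw [he, euler_add, hEN, euler_offAxisLog, hb, map_add, map_add, map_neg, map_neg,
      coeff_coeff_map_mul_C, coeff_coeff_map_mul_C, ht1 k hk, ht1 l hl, add_neg_cancel]

end TreeQuadratic

end OneVariable

section ManyVariables

open MvPowerSeries
open scoped PowerSeries MvPowerSeries.WithPiTopology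
open Finset.HasAntidiagonal (antidiagonal)

/-! ### Exponents with an additional variable -/

section JoinExp

variable {σ : Type*}

/-- The exponent of the monomial `X ^ d * w ^ n`, where `w` is an additional variable. -/
def joinExp (d : σ →₀ ℕ) (n : ℕ) : σ ⊕ Unit →₀ ℕ := Finsupp.sumElim d (Finsupp.single () n)

@[simp]
theorem joinExp_inl (d : σ →₀ ℕ) (n : ℕ) (s : σ) : joinExp d n (.inl s) = d s := rfl

@[simp]
theorem joinExp_inr (d : σ →₀ ℕ) (n : ℕ) (u : Unit) : joinExp d n (.inr u) = n := by
  simp [joinExp, Finsupp.sumElim_inr]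

theorem joinExp_inj {d e : σ →₀ ℕ} {m n : ℕ} : joinExp d m = joinExp e n ↔ d = e ∧ m = n := by
  refine ⟨fun h => ⟨?_, ?_⟩, fun ⟨h1, h2⟩ => by rw [h1, h2]⟩
  · ext s
    simpa using DFunLike.congr_fun h (.inl s)
  · simpa using DFunLike.congr_fun h (.inr ())

theorem joinExp_le_joinExp {d e : σ →₀ ℕ} {m n : ℕ} :
    joinExp d m ≤ joinExp e n ↔ d ≤ e ∧ m ≤ n := by
  refine ⟨fun h => ⟨fun s => ?_, ?_⟩, fun h => ?_⟩
  · simpa using h (.inl s)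
  · simpa using h (.inr ())
  · rintro (s | u)
    · simpa using h.1 s
    · simpa using h.2

theorem joinExp_sub_joinExp (d e : σ →₀ ℕ) (m n : ℕ) :
    joinExp d m - joinExp e n = joinExp (d - e) (m - n) := by
  ext (s | u) <;> simp

theorem joinExp_add_joinExp (d e : σ →₀ ℕ) (m n : ℕ) :
    joinExp d m + joinExp e n = joinExp (d + e) (m + n) := by
  ext (s | u) <;> simp

theorem exists_eq_joinExp (E : σ ⊕ Unit →₀ ℕ) : ∃ d n, E = joinExp d n := by
  refine ⟨(Finsupp.sumFinsuppEquivProdFinsupp E).1, E (.inr ()), ?_⟩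
  ext (s | u) <;> simp

theorem joinExp_zero_right (s : σ) (m : ℕ) :
    joinExp (Finsupp.single s m) 0 = Finsupp.single (.inl s) m := by
  classical
  ext (t | u) <;> simp [Finsupp.single_apply]

theorem joinExp_zero_left (n : ℕ) :
    joinExp (0 : σ →₀ ℕ) n = Finsupp.single (.inr ()) n := by
  classical
  ext (t | u) <;> simp

end JoinExp

/-! ### Substitution as an infinite sum -/

section Sums

variable {σ τ : Type*} {R : Type*} [CommRing R] [UniformSpace R]

/-- A sum over the divisors of the monomial `X ^ d`. -/
theorem hasSum_ite_le (F : (σ →₀ ℕ) → (σ →₀ ℕ) → R) (d : σ →₀ ℕ) [DecidableEq σ]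
    [DecidablePred (· ≤ d)] :
    HasSum (fun e => if e ≤ d then F e (d - e) else 0) (∑ p ∈ antidiagonal d, F p.1 p.2) := by
  have h : ∑ p ∈ antidiagonal d, F p.1 p.2 =
      ∑ e ∈ (antidiagonal d).image Prod.fst, if e ≤ d then F e (d - e) else 0 := by
    rw [Finset.sum_image]
    · refine Finset.sum_congr rfl fun p hp => ?_
      rw [Finset.HasAntidiagonal.mem_antidiagonal] at hp
      have hle : p.1 ≤ d := le_iff_exists_add.2 ⟨p.2, hp.symm⟩
      have hsub : d - p.1 = p.2 := tsub_eq_of_eq_add_rev hp.symm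
      rw [if_pos hle, hsub]
    · rintro ⟨p, q⟩ hp ⟨p', q'⟩ hq (rfl : p = p')
      simp only [Finset.mem_coe, Finset.HasAntidiagonal.mem_antidiagonal] at hp hq
      rw [add_left_cancel (hp.trans hq.symm)]
  rw [h]
  refine hasSum_sum_of_ne_finset_zero fun e he => if_neg fun hle => he ?_
  rw [Finset.mem_image]
  exact ⟨(e, d - e), by simp [add_tsub_cancel_of_le hle], rfl⟩

variable [DiscreteUniformity R]

/-- The expansion of `h * f(a)` along the monomials of `f`. -/
theorem hasSum_mul_subst {a : σ → MvPowerSeries τ R} (ha : HasSubst a) (h : MvPowerSeries τ R)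
    (f : MvPowerSeries σ R) (D : τ →₀ ℕ) :
    HasSum (fun e => coeff e f * coeff D (h * e.prod fun s n => a s ^ n))
      (coeff D (h * subst a f)) := by
  have h1 := ((hasSum_aeval ha.hasEval f).mul_left h).map (coeff D) (WithPiTopology.continuous_coeff R D)
  rw [← substAlgHom_eq_aeval ha, coe_substAlgHom] at h1
  refine h1.congr_fun fun e => ?_
  simp

theorem hasSum_coeff_subst {a : σ → MvPowerSeries τ R} (ha : HasSubst a)
    (f : MvPowerSeries σ R) (D : τ →₀ ℕ) :
    HasSum (fun e => coeff e f * coeff D (e.prod fun s n => a s ^ n)) (coeff D (subst a f)) := by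
  simpa using hasSum_mul_subst ha 1 f D

end Sums

/-! ### Rescaled variables and the residue -/

section Scale

theorem prod_single_add {σ A : Type*} [CommMonoid A] (f : σ → A) (s : σ) (n : ℕ) (e : σ →₀ ℕ) :
    ((Finsupp.single s n + e).prod fun s n => f s ^ n) =
      f s ^ n * e.prod fun s n => f s ^ n := by
  classical
  rw [Finsupp.prod_add_index' (fun _ => pow_zero _) (fun _ _ _ => pow_add _ _ _),
    Finsupp.prod_single_index (h := fun s n => f s ^ n) (pow_zero _)]

variable {σ : Type*} {R : Type*} [CommRing R]

/-- The substitution `X s ↦ X s * w ^ wt s`, where `w` is an additional variable. -/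
def scaledVar (wt : σ → ℕ) (s : σ) : MvPowerSeries (σ ⊕ Unit) R :=
  X (.inl s) * X (.inr ()) ^ wt s

theorem scaledVar_eq (wt : σ → ℕ) (s : σ) : (scaledVar wt s : MvPowerSeries (σ ⊕ Unit) R) =
    monomial (joinExp (Finsupp.single s 1) (wt s)) 1 := by
  rw [scaledVar, X_def, X_pow_eq, monomial_mul_monomial, mul_one, ← joinExp_zero_right,
    ← joinExp_zero_left, joinExp_add_joinExp, add_zero, zero_add]

theorem hasSubst_scaledVar (wt : σ → ℕ) :
    HasSubst (scaledVar wt : σ → MvPowerSeries (σ ⊕ Unit) R) where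
  const_coeff s := by simp [scaledVar]
  coeff_zero D := by
    classical
    refine Set.Subsingleton.finite fun s hs t ht => ?_
    simp only [scaledVar_eq, coeff_monomial, Set.mem_ofPred_eq, ne_eq, ite_eq_right_iff,
      not_forall] at hs ht
    obtain ⟨h1, -⟩ := hs
    obtain ⟨h2, -⟩ := ht
    exact (Finsupp.single_left_inj one_ne_zero).1 (joinExp_inj.1 (h1.symm.trans h2)).1

theorem constantCoeff_subst_scaledVar (wt : σ → ℕ) {f : MvPowerSeries σ R}
    (hf : constantCoeff f = 0) :
    constantCoeff (subst (scaledVar wt : σ → MvPowerSeries (σ ⊕ Unit) R) f) = 0 :=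
  constantCoeff_subst_eq_zero (hasSubst_scaledVar wt) (fun s => by simp [scaledVar]) hf

theorem prod_scaledVar_pow (wt : σ → ℕ) (e : σ →₀ ℕ) :
    (e.prod fun s n => (scaledVar wt s : MvPowerSeries (σ ⊕ Unit) R) ^ n) =
      monomial (joinExp e (Finsupp.weight wt e)) 1 := by
  classical
  induction e using Finsupp.induction with
  | zero =>
    rw [Finsupp.prod_zero_index, map_zero, joinExp_zero_left, Finsupp.single_zero, monomial_zero_one]
  | single_add s n e hs hn ih =>
    rw [prod_single_add, ih, scaledVar_eq, monomial_pow, one_pow,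
      monomial_mul_monomial, mul_one, map_add, Finsupp.weight_single, ← joinExp_add_joinExp]
    congr 3
    ext (t | u)
    · simp [Finsupp.single_apply]
    · simp

/-- A series in `w` alone. -/
def ofW (σ : Type*) (g : R⟦X⟧) : MvPowerSeries (σ ⊕ Unit) R := g.subst (X (.inr ()))

theorem coeff_ofW (g : R⟦X⟧) (d : σ →₀ ℕ) (n : ℕ) [Decidable (d = 0)] :
    coeff (joinExp d n) (ofW σ g) = if d = 0 then PowerSeries.coeff n g else 0 := by
  classical
  rw [ofW, PowerSeries.coeff_subst_single, joinExp_inr, ← joinExp_zero_left]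
  split_ifs <;> simp_all [joinExp_inj]

theorem constantCoeff_ofW {g : R⟦X⟧} (hg : PowerSeries.constantCoeff g = 0) :
    constantCoeff (ofW σ g) = 0 := by
  classical
  rw [← coeff_zero_eq_constantCoeff_apply, ← Finsupp.single_zero (.inr ()), ← joinExp_zero_left,
    coeff_ofW, if_pos rfl, PowerSeries.coeff_zero_eq_constantCoeff_apply, hg]

theorem ofW_mul (f g : R⟦X⟧) : ofW σ (f * g) = ofW σ f * ofW σ g :=
  PowerSeries.subst_mul (PowerSeries.HasSubst.X _) f g

theorem ofW_pow (f : R⟦X⟧) (n : ℕ) : ofW σ (f ^ n) = ofW σ f ^ n :=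
  PowerSeries.subst_pow (PowerSeries.HasSubst.X _) f n

theorem ofW_X : ofW σ (PowerSeries.X : R⟦X⟧) = X (.inr ()) :=
  PowerSeries.subst_X (PowerSeries.HasSubst.X _)

variable (wt : σ → ℕ)

theorem coeff_ofW_mul_subst_scaledVar (g : R⟦X⟧) (M : MvPowerSeries σ R) (d : σ →₀ ℕ) (n : ℕ) :
    coeff (joinExp d (n + Finsupp.weight wt d)) (ofW σ g * subst (scaledVar wt) M) =
      PowerSeries.coeff n g * coeff d M := by
  classical
  let : UniformSpace R := ⊥
  refine (hasSum_mul_subst (hasSubst_scaledVar wt) _ M _).unique ?_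
  have h (e : σ →₀ ℕ) : coeff e M * coeff (joinExp d (n + Finsupp.weight wt d))
      (ofW σ g * e.prod fun s n => scaledVar wt s ^ n) =
      if e = d then PowerSeries.coeff n g * coeff d M else 0 := by
    rw [prod_scaledVar_pow, coeff_mul_monomial]
    split_ifs with h1 h2 h2
    · subst h2
      rw [joinExp_sub_joinExp, Nat.add_sub_cancel, tsub_self, coeff_ofW, if_pos rfl]
      ring
    · rw [joinExp_sub_joinExp, coeff_ofW, if_neg, zero_mul, mul_zero]
      exact fun h0 => h2 (le_antisymm (joinExp_le_joinExp.1 h1).1 (tsub_eq_zero_iff_le.1 h0))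
    · subst h2
      exact absurd (joinExp_le_joinExp.2 ⟨le_rfl, Nat.le_add_left _ _⟩) h1
    · rw [mul_zero]
  simp_rw [h]
  exact hasSum_ite_eq d _

/-- For a series `G` in the scaled variables `X s = w ^ (-wt s) * x s` and `w`, the coefficient of
`w` in its expansion in the variables `x s` and `w`. -/
def scaledRes (G : MvPowerSeries (σ ⊕ Unit) R) : MvPowerSeries σ R :=
  fun d => coeff (joinExp d (Finsupp.weight wt d + 1)) G

theorem coeff_scaledRes (G : MvPowerSeries (σ ⊕ Unit) R) (d : σ →₀ ℕ) :
    coeff d (scaledRes wt G) = coeff (joinExp d (Finsupp.weight wt d + 1)) G := rfl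

theorem weight_sub {d e : σ →₀ ℕ} (h : e ≤ d) :
    Finsupp.weight wt d = Finsupp.weight wt e + Finsupp.weight wt (d - e) := by
  rw [← map_add, add_tsub_cancel_of_le h]

/-- The residue is linear over the series that do not involve `w`. -/
theorem scaledRes_subst_mul (U : MvPowerSeries σ R) (G : MvPowerSeries (σ ⊕ Unit) R) :
    scaledRes wt (G * subst (scaledVar wt) U) = U * scaledRes wt G := by
  classical
  let : UniformSpace R := ⊥
  ext d
  rw [coeff_scaledRes, coeff_mul (φ := U)]
  refine (hasSum_mul_subst (hasSubst_scaledVar wt) _ U _).unique ?_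
  refine (hasSum_ite_le (fun e f => coeff e U * coeff f (scaledRes wt G)) d).congr_fun fun e => ?_
  rw [prod_scaledVar_pow, coeff_mul_monomial]
  by_cases h : e ≤ d
  · have hw := weight_sub wt h
    have hw' : Finsupp.weight wt d + 1 - Finsupp.weight wt e = Finsupp.weight wt (d - e) + 1 := by
      omega
    rw [if_pos h, if_pos (joinExp_le_joinExp.2 ⟨h, by omega⟩), joinExp_sub_joinExp, mul_one,
      coeff_scaledRes, hw']
  · rw [if_neg h, if_neg fun h' => h (joinExp_le_joinExp.1 h').1, mul_zero]

/-- The passage from the variables `x s` to the scaled variables, fixing `w`. -/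
def scaledVarW : σ ⊕ Unit → MvPowerSeries (σ ⊕ Unit) R :=
  Sum.elim (scaledVar wt) fun _ => X (.inr ())

theorem hasSubst_sumElim_const {υ : Type*} {a : σ → MvPowerSeries υ R} (ha : HasSubst a)
    {b : MvPowerSeries υ R} (hb : IsNilpotent (constantCoeff b)) :
    HasSubst (Sum.elim a fun _ : Unit => b) where
  const_coeff := by
    rintro (s | u)
    · exact ha.const_coeff s
    · exact hb
  coeff_zero D := by
    refine (((ha.coeff_zero D).image Sum.inl).union (Set.finite_singleton (.inr ()))).subset ?_
    rintro (s | u) h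
    · exact .inl ⟨s, h, rfl⟩
    · exact .inr rfl

theorem hasSubst_scaledVarW : HasSubst (scaledVarW wt : _ → MvPowerSeries (σ ⊕ Unit) R) :=
  hasSubst_sumElim_const (hasSubst_scaledVar wt) (by simp)

theorem prod_joinExp {A : Type*} [CommMonoid A] (a : σ ⊕ Unit → A) (e : σ →₀ ℕ) (i : ℕ) :
    ((joinExp e i).prod fun s n => a s ^ n) =
      (e.prod fun s n => a (.inl s) ^ n) * a (.inr ()) ^ i := by
  rw [joinExp, Finsupp.prod_sumElim, Finsupp.prod_single_index]
  · rfl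
  · exact pow_zero _

/-- The residue of a product of a series `u` of weight zero, written in the scaled variables,
with a series `f` in the original variables. -/
theorem coeff_scaledRes_mul_subst_scaledVarW [DecidableEq σ] (u : MvPowerSeries σ R)
    (f : MvPowerSeries (σ ⊕ Unit) R) (d : σ →₀ ℕ) :
    coeff d (scaledRes wt (subst (scaledVar fun _ => 0) u * subst (scaledVarW wt) f)) =
      ∑ p ∈ antidiagonal d, coeff (joinExp p.1 (Finsupp.weight wt p.2 + 1)) f * coeff p.2 u := by
  let : UniformSpace R := ⊥
  rw [coeff_scaledRes]
  refine (hasSum_mul_subst (hasSubst_scaledVarW wt) _ f _).unique ?_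
  have hu (d : σ →₀ ℕ) (n : ℕ) : coeff (joinExp d n) (subst (scaledVar fun _ => 0) u) =
      if n = 0 then coeff d u else 0 := by
    have h := coeff_ofW_mul_subst_scaledVar (fun _ => 0) 1 u d n
    have h0 : Finsupp.weight (fun _ : σ => 0) d = 0 := by simp [Finsupp.weight_apply, Finsupp.sum]
    have h1 : ofW σ (1 : R⟦X⟧) = 1 := by
      have := ofW_pow (σ := σ) (0 : R⟦X⟧) 0
      rwa [pow_zero, pow_zero] at this
    rw [h0, add_zero, h1, one_mul, PowerSeries.coeff_one] at h
    rw [h]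
    split_ifs <;> simp
  -- the factor of weight zero allows only one power of `w` for each divisor of the monomial
  have hinj : Function.Injective fun e : σ →₀ ℕ => joinExp e (Finsupp.weight wt (d - e) + 1) :=
    fun e e' h => (joinExp_inj.1 h).1
  refine (hinj.hasSum_iff ?_).1 ?_
  · intro E hE
    obtain ⟨e, i, rfl⟩ := exists_eq_joinExp E
    rw [prod_joinExp]
    simp only [scaledVarW, Sum.elim_inl, Sum.elim_inr]
    rw [prod_scaledVar_pow, X_pow_eq, ← joinExp_zero_left, monomial_mul_monomial,
      joinExp_add_joinExp, add_zero, coeff_mul_monomial]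
    split_ifs with h
    · obtain ⟨h1, h2⟩ := joinExp_le_joinExp.1 h
      have hw := weight_sub wt h1
      rw [joinExp_sub_joinExp, hu, if_neg, zero_mul, mul_zero]
      intro h3
      refine hE ⟨e, joinExp_inj.2 ⟨rfl, ?_⟩⟩
      omega
    · rw [mul_zero]
  · refine (hasSum_ite_le (fun e e' => coeff (joinExp e (Finsupp.weight wt e' + 1)) f * coeff e' u)
      d).congr_fun fun e => ?_
    rw [Function.comp_apply, prod_joinExp]
    simp only [scaledVarW, Sum.elim_inl, Sum.elim_inr]
    rw [prod_scaledVar_pow, X_pow_eq, ← joinExp_zero_left, monomial_mul_monomial,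
      joinExp_add_joinExp, add_zero, coeff_mul_monomial]
    by_cases h : e ≤ d
    · have hw := weight_sub wt h
      rw [if_pos h, if_pos (joinExp_le_joinExp.2 ⟨h, by omega⟩), joinExp_sub_joinExp, hu, if_pos]
      · ring
      · omega
    · rw [if_neg h, if_neg fun h' => h (joinExp_le_joinExp.1 h').1, mul_zero]

/-- Change of variables in the residue: the additional variable is replaced by `x(w)`, and the
original variables by the series `ℓ s`. In the scaled variables this is a substitution of
series `T s` with `w ^ wt s * T s = v ^ (-wt s) * ℓ s`, where `x(w) = w v(w)`. -/
theorem scaledRes_subst [Algebra ℚ R] {x : R⟦X⟧} (hx : PowerSeries.constantCoeff x = 0)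
    (hu : IsUnit (PowerSeries.coeff 1 x)) {ℓ : σ → MvPowerSeries σ R} (hℓ : HasSubst ℓ)
    {T : σ → MvPowerSeries (σ ⊕ Unit) R} (hT : HasSubst T)
    (hTℓ : ∀ s, X (.inr ()) ^ wt s * T s =
      ofW σ (Ring.inverse (shift x) ^ wt s) * subst (scaledVar wt) (ℓ s))
    (G : MvPowerSeries (σ ⊕ Unit) R) :
    scaledRes wt (ofW σ (PowerSeries.derivative R x * Ring.inverse (shift x) ^ 2) *
      subst (Sum.elim T fun _ => ofW σ x) G) = subst ℓ (scaledRes wt G) := by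
  classical
  let : UniformSpace R := ⊥
  have hprod (e : σ →₀ ℕ) : X (.inr ()) ^ Finsupp.weight wt e * (e.prod fun s n => T s ^ n) =
      ofW σ (Ring.inverse (shift x) ^ Finsupp.weight wt e) *
        subst (scaledVar wt) (e.prod fun s n => ℓ s ^ n) := by
    induction e using Finsupp.induction with
    | zero =>
      simp only [Finsupp.prod_zero_index, map_zero, pow_zero]
      rw [← coe_substAlgHom (hasSubst_scaledVar wt), map_one, ofW,
        ← PowerSeries.coe_substAlgHom (PowerSeries.HasSubst.X _), map_one]
    | single_add s n e hs hn ih =>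
      rw [prod_single_add, prod_single_add, map_add,
        Finsupp.weight_single, smul_eq_mul, pow_add, pow_add, ofW_mul,
        subst_mul (hasSubst_scaledVar wt), subst_pow (hasSubst_scaledVar wt), mul_comm n, pow_mul,
        pow_mul, ofW_pow _ n]
      have := congrArg (· ^ n) (hTℓ s)
      simp only [mul_pow] at this
      linear_combination (X (.inr ()) ^ Finsupp.weight wt e * (e.prod fun s n => T s ^ n)) * this +
        (ofW σ (Ring.inverse (shift x) ^ wt s) ^ n * subst (scaledVar wt) (ℓ s) ^ n) * ih
  ext d
  rw [coeff_scaledRes]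
  refine (hasSum_mul_subst (hasSubst_sumElim_const hT (by rw [constantCoeff_ofW hx]; exact IsNilpotent.zero)) _ G _).unique ?_
  have hterm (e : σ →₀ ℕ) (i : ℕ) : coeff (joinExp d (Finsupp.weight wt d + 1))
      (ofW σ (PowerSeries.derivative R x * Ring.inverse (shift x) ^ 2) *
        ((e.prod fun s n => T s ^ n) * ofW σ x ^ i)) =
      if i = Finsupp.weight wt e + 1 then coeff d (e.prod fun s n => ℓ s ^ n) else 0 := by
    -- multiplication by a power of `w` brings `T s` into the form of the hypothesis
    rw [← one_mul (coeff _ _), ← coeff_add_monomial_mul (joinExp 0 (Finsupp.weight wt e)),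
      joinExp_add_joinExp, zero_add, joinExp_zero_left, ← X_pow_eq]
    have h1 : X (.inr ()) ^ Finsupp.weight wt e *
        (ofW σ (PowerSeries.derivative R x * Ring.inverse (shift x) ^ 2) *
        ((e.prod fun s n => T s ^ n) * ofW σ x ^ i)) =
        ofW σ (PowerSeries.derivative R x * Ring.inverse (shift x) ^ 2 *
          (Ring.inverse (shift x) ^ Finsupp.weight wt e * x ^ i)) *
          subst (scaledVar wt) (e.prod fun s n => ℓ s ^ n) := by
      rw [ofW_mul (_ * _) (_ * _), ofW_mul (_ ^ _) (x ^ i), ofW_pow x]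
      linear_combination (ofW σ (PowerSeries.derivative R x * Ring.inverse (shift x) ^ 2) *
        ofW σ x ^ i) * hprod e
    have h2 : Finsupp.weight wt e + (Finsupp.weight wt d + 1) =
        (Finsupp.weight wt e + 1) + Finsupp.weight wt d := by ring
    rw [h1, h2, coeff_ofW_mul_subst_scaledVar, coeff_inverse_pow_mul_pow hx hu]
    split_ifs <;> simp
  have hinj : Function.Injective fun e : σ →₀ ℕ => joinExp e (Finsupp.weight wt e + 1) :=
    fun e e' h => (joinExp_inj.1 h).1
  refine (hinj.hasSum_iff ?_).1 ?_
  · intro E hE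
    obtain ⟨e, i, rfl⟩ := exists_eq_joinExp E
    rw [prod_joinExp, Sum.elim_inr]
    simp only [Sum.elim_inl]
    rw [hterm, if_neg, mul_zero]
    rintro rfl
    exact hE ⟨e, rfl⟩
  · refine (hasSum_coeff_subst hℓ (scaledRes wt G) d).congr_fun fun e => ?_
    rw [Function.comp_apply, prod_joinExp, Sum.elim_inr]
    simp only [Sum.elim_inl]
    rw [hterm, if_pos rfl, coeff_scaledRes]

end Scale

/-! ### Linear and quadratic forms as infinite sums -/

section Forms

variable {R : Type*} [CommRing R]

theorem coeff_quadForm (a : ℕ+ → ℕ+ → R) (d : ℕ+ →₀ ℕ) : coeff d (quadForm a) =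
    ∑ ij ∈ d.support ×ˢ d.support,
      if d = Finsupp.single ij.1 1 + Finsupp.single ij.2 1 then a ij.1 ij.2 else 0 := rfl

theorem constantCoeff_linForm (c : ℕ+ → R) : constantCoeff (linForm c) = 0 := by
  rw [← coeff_zero_eq_constantCoeff_apply, coeff_linForm]
  simp

theorem constantCoeff_quadForm (a : ℕ+ → ℕ+ → R) : constantCoeff (quadForm a) = 0 := by
  rw [← coeff_zero_eq_constantCoeff_apply, coeff_quadForm]
  simp

variable {σ τ : Type*}

theorem subst_C' {a : σ → MvPowerSeries τ R} (r : R) : subst a (C r : MvPowerSeries σ R) = C r :=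
  subst_C r

variable [UniformSpace R]

theorem hasSum_linForm (c : ℕ+ → R) : HasSum (fun k => C (c k) * X k) (linForm c) := by
  classical
  rw [WithPiTopology.hasSum_iff_hasSum_coeff]
  intro d
  rw [coeff_linForm]
  have h (k : ℕ+) : coeff d (C (c k) * X k) = if d = Finsupp.single k 1 then c k else 0 := by
    rw [coeff_C_mul, coeff_X]
    split_ifs <;> simp
  simp_rw [h]
  refine hasSum_sum_of_ne_finset_zero fun k hk => if_neg ?_
  rintro rfl
  exact hk (by simp)

theorem hasSum_quadForm (a : ℕ+ → ℕ+ → R) :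
    HasSum (fun p : ℕ+ × ℕ+ => C (a p.1 p.2) * (X p.1 * X p.2)) (quadForm a) := by
  classical
  rw [WithPiTopology.hasSum_iff_hasSum_coeff]
  intro d
  rw [coeff_quadForm]
  have h (p : ℕ+ × ℕ+) : coeff d (C (a p.1 p.2) * (X p.1 * X p.2)) =
      if d = Finsupp.single p.1 1 + Finsupp.single p.2 1 then a p.1 p.2 else 0 := by
    rw [coeff_C_mul, X_def, X_def, monomial_mul_monomial, coeff_monomial]
    split_ifs <;> simp
  simp_rw [h]
  refine hasSum_sum_of_ne_finset_zero fun p hp => if_neg ?_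
  rintro rfl
  exact hp (by simp [Finset.mem_product, Finsupp.single_apply])

theorem hasSum_linForm_of_forall {ι : Type*} {A : ι → ℕ+ → R} {c : ℕ+ → R}
    [IsTopologicalRing R] (h : ∀ k, HasSum (fun i => A i k) (c k)) :
    HasSum (fun i => linForm (A i)) (linForm c) := by
  rw [WithPiTopology.hasSum_iff_hasSum_coeff]
  intro d
  simp_rw [coeff_linForm]
  refine hasSum_sum fun k _ => ?_
  split_ifs
  · exact h k
  · exact hasSum_zero

theorem hasSum_quadForm_of_forall {ι : Type*} {A : ι → ℕ+ → ℕ+ → R} {a : ℕ+ → ℕ+ → R}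
    [IsTopologicalRing R] (h : ∀ k l, HasSum (fun i => A i k l) (a k l)) :
    HasSum (fun i => quadForm (A i)) (quadForm a) := by
  rw [WithPiTopology.hasSum_iff_hasSum_coeff]
  intro d
  simp_rw [coeff_quadForm]
  refine hasSum_sum fun p _ => ?_
  split_ifs
  · exact h _ _
  · exact hasSum_zero

variable [DiscreteUniformity R]

theorem hasSum_subst {ι : Type*} {f : ι → MvPowerSeries σ R} {g : MvPowerSeries σ R}
    (h : HasSum f g) {a : σ → MvPowerSeries τ R} (ha : HasSubst a) :
    HasSum (fun i => subst a (f i)) (subst a g) := by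
  have h1 := h.map (substAlgHom (R := R) ha) (by
    rw [coe_substAlgHom]
    exact continuous_subst ha)
  rwa [coe_substAlgHom] at h1

theorem hasSum_subst_linForm (c : ℕ+ → R) {a : ℕ+ → MvPowerSeries τ R} (ha : HasSubst a) :
    HasSum (fun k => C (c k) * a k) (subst a (linForm c)) := by
  refine (hasSum_subst (hasSum_linForm c) ha).congr_fun fun k => ?_
  rw [subst_mul ha, subst_C', subst_X ha]

theorem hasSum_subst_quadForm (q : ℕ+ → ℕ+ → R) {a : ℕ+ → MvPowerSeries τ R} (ha : HasSubst a) :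
    HasSum (fun p : ℕ+ × ℕ+ => C (q p.1 p.2) * (a p.1 * a p.2)) (subst a (quadForm q)) := by
  refine (hasSum_subst (hasSum_quadForm q) ha).congr_fun fun k => ?_
  rw [subst_mul ha, subst_C', subst_mul ha, subst_X ha, subst_X ha]

end Forms

/-! ### The linear change of variables -/

section Change

variable {R : Type*} [CommRing R]

theorem linForm_mul_linForm (c c' : ℕ+ → R) :
    linForm c * linForm c' = quadForm fun k l => c k * c' l := by
  let : UniformSpace R := ⊥
  refine ((hasSum_linForm c).mul_right (linForm c')).unique ?_
  refine (hasSum_quadForm fun k l => c k * c' l).prod_fiberwise fun k => ?_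
  refine ((hasSum_linForm c').mul_left (C (c k) * X k)).congr_fun fun l => ?_
  rw [map_mul C]
  ring

theorem C_mul_linForm (r : R) (c : ℕ+ → R) : C r * linForm c = linForm fun k => r * c k := by
  ext d
  rw [coeff_C_mul, coeff_linForm, coeff_linForm, Finset.mul_sum]
  exact Finset.sum_congr rfl fun k _ => by rw [mul_ite, mul_zero]

theorem C_mul_quadForm (r : R) (a : ℕ+ → ℕ+ → R) :
    C r * quadForm a = quadForm fun k l => r * a k l := by
  ext d
  rw [coeff_C_mul, coeff_quadForm, coeff_quadForm, Finset.mul_sum]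
  exact Finset.sum_congr rfl fun k _ => by rw [mul_ite, mul_zero]

theorem neg_quadForm (a : ℕ+ → ℕ+ → R) : -quadForm a = quadForm fun k l => -a k l := by
  ext d
  rw [map_neg, coeff_quadForm, coeff_quadForm, ← Finset.sum_neg_distrib]
  exact Finset.sum_congr rfl fun k _ => by rw [apply_ite Neg.neg, neg_zero]

theorem coeff_pow_eq_zero {x : R⟦X⟧} (hx : PowerSeries.constantCoeff x = 0) {b k : ℕ}
    (h : k < b) : PowerSeries.coeff k (x ^ b) = 0 := by
  refine PowerSeries.coeff_of_lt_order _ (lt_of_lt_of_le ?_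
    (PowerSeries.le_order_pow_of_constantCoeff_eq_zero _ hx))
  exact_mod_cast h

theorem hasSum_coeff_subst_pnat [UniformSpace R] [DiscreteUniformity R] {x : R⟦X⟧}
    (hx : PowerSeries.constantCoeff x = 0) {y : R⟦X⟧} (hy : PowerSeries.constantCoeff y = 0)
    (k : ℕ) : HasSum (fun b : ℕ+ => PowerSeries.coeff b y * PowerSeries.coeff k (x ^ (b : ℕ)))
      (PowerSeries.coeff k (y.subst x)) := by
  have hs := PowerSeries.HasSubst.of_constantCoeff_zero' hx
  have h : HasSum (fun b : ℕ => PowerSeries.coeff b y * PowerSeries.coeff k (x ^ b))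
      (PowerSeries.coeff k (y.subst x)) := by
    have hfin := PowerSeries.coeff_subst_finite' hs y k
    rw [PowerSeries.coeff_subst' hs, finsum_eq_sum _ hfin]
    refine hasSum_sum_of_ne_finset_zero fun b hb => ?_
    simpa using hb
  refine (PNat.coe_injective.hasSum_iff ?_).2 h
  intro b hb
  obtain rfl : b = 0 := by
    by_contra hb0
    exact hb ⟨⟨b, Nat.pos_of_ne_zero hb0⟩, rfl⟩
  rw [PowerSeries.coeff_zero_eq_constantCoeff_apply, hy, zero_mul]

/-- The linear changes of variables compose like the series that define them. -/
theorem subst_linChange_linChange {x : R⟦X⟧} (hx : PowerSeries.constantCoeff x = 0)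
    {y : R⟦X⟧} (hy : PowerSeries.constantCoeff y = 0) (b : ℕ+) :
    subst (linChange x) (linChange y b) = linChange (y.subst x) b := by
  let : UniformSpace R := ⊥
  refine (hasSum_subst_linForm _ (hasSubst_linChange hx)).unique ?_
  have hs := PowerSeries.HasSubst.of_constantCoeff_zero' hx
  rw [linChange]
  refine HasSum.congr_fun (hasSum_linForm_of_forall fun k => ?_) fun i => C_mul_linForm _ _
  rw [← PowerSeries.subst_pow hs]
  exact hasSum_coeff_subst_pnat hx (by rw [map_pow, hy, zero_pow b.ne_zero]) k

theorem linChange_X (b : ℕ+) : linChange (PowerSeries.X : R⟦X⟧) b = X b := by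
  let : UniformSpace R := ⊥
  refine (hasSum_linForm _).unique ?_
  refine HasSum.congr_fun (hasSum_ite_eq b (X b)) fun k => ?_
  rw [PowerSeries.coeff_X_pow]
  by_cases h : k = b
  · simp [h]
  · simp [h]

/-- The matrix of a quadratic form after the linear change of variables. -/
theorem subst_linChange_quadForm {x : R⟦X⟧} (hx : PowerSeries.constantCoeff x = 0)
    (a : ℕ+ → ℕ+ → R) : subst (linChange x) (quadForm a) = quadForm fun k l =>
      ∑ p ∈ Finset.Iic k ×ˢ Finset.Iic l, a p.1 p.2 *
        (PowerSeries.coeff (k : ℕ) (x ^ (p.1 : ℕ)) * PowerSeries.coeff (l : ℕ) (x ^ (p.2 : ℕ))) := by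
  let : UniformSpace R := ⊥
  refine (hasSum_subst_quadForm _ (hasSubst_linChange hx)).unique ?_
  refine HasSum.congr_fun (hasSum_quadForm_of_forall fun k l => ?_) fun p => by
    rw [linChange, linChange, linForm_mul_linForm, C_mul_quadForm]
  refine hasSum_sum_of_ne_finset_zero fun p hp => ?_
  rw [Finset.mem_product, Finset.mem_Iic, Finset.mem_Iic, not_and_or, not_le, not_le] at hp
  rcases hp with hp | hp
  · rw [coeff_pow_eq_zero hx (b := p.1) (by exact_mod_cast hp), zero_mul, mul_zero]
  · rw [coeff_pow_eq_zero hx (b := p.2) (by exact_mod_cast hp), mul_zero, mul_zero]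

/-- The transformation defined by `x` is inverted by the compositional inverse of `x`. -/
theorem subst_linChange_subst_linChange {x : R⟦X⟧} (hx : PowerSeries.constantCoeff x = 0)
    {y : R⟦X⟧} (hy : PowerSeries.constantCoeff y = 0) (h : y.subst x = PowerSeries.X)
    (f : MvPowerSeries ℕ+ R) : subst (linChange x) (subst (linChange y) f) = f := by
  rw [subst_comp_subst_apply (hasSubst_linChange hy) (hasSubst_linChange hx)]
  simp_rw [subst_linChange_linChange hx hy, h, linChange_X]
  exact congrFun subst_self f

theorem bijective_transform {x : R⟦X⟧} (hx : PowerSeries.constantCoeff x = 0)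
    (hu : IsUnit (PowerSeries.coeff 1 x)) (Q : MvPowerSeries ℕ+ R) :
    Function.Bijective (transform x Q) := by
  have hy := PowerSeries.constantCoeff_substInvOfIsUnit x hu
  refine Function.bijective_iff_has_inverse.2
    ⟨fun f => subst (linChange (x.substInvOfIsUnit hu)) f - Q, fun f => ?_, fun f => ?_⟩
  · dsimp only
    rw [transform, subst_linChange_subst_linChange hy hx
      (PowerSeries.subst_substInvOfIsUnit_right x hx hu), add_sub_cancel_right]
  · rw [transform, sub_add_cancel, subst_linChange_subst_linChange hx hy
      (PowerSeries.subst_substInvOfIsUnit_left x hx hu)]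

end Change

/-! ### Exponentials of multivariate series -/

section Exp

variable {R : Type*} [CommRing R] [Algebra ℚ R] {σ τ : Type*}

theorem exp_subst_subst {a : σ → MvPowerSeries τ R} (ha : HasSubst a) {f : MvPowerSeries σ R}
    (hf : constantCoeff f = 0) :
    subst a ((PowerSeries.exp R).subst f) = (PowerSeries.exp R).subst (subst a f) := by
  rw [PowerSeries.subst, PowerSeries.subst, subst_comp_subst_apply
    (PowerSeries.HasSubst.of_constantCoeff_zero hf).const ha]

theorem exp_subst_X_add_X :
    (PowerSeries.exp R).subst (X 0 + X 1 : MvPowerSeries (Fin 2) R) =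
      (PowerSeries.exp R).subst (X 0 : MvPowerSeries (Fin 2) R) *
        (PowerSeries.exp R).subst (X 1 : MvPowerSeries (Fin 2) R) := by
  ext e
  rw [PowerSeries.coeff_subst_X_zero_add_X_one, PowerSeries.coeff_subst_X_zero_subst_mul_X_one,
    PowerSeries.coeff_exp, PowerSeries.coeff_exp, PowerSeries.coeff_exp, ← map_mul,
    ← map_natCast (algebraMap ℚ R), ← map_mul]
  congr 1
  rw [Nat.cast_add_choose]
  have h1 := Nat.cast_ne_zero (R := ℚ).2 (Nat.factorial_ne_zero (e 0 + e 1))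
  have h2 := Nat.cast_ne_zero (R := ℚ).2 (Nat.factorial_ne_zero (e 0))
  have h3 := Nat.cast_ne_zero (R := ℚ).2 (Nat.factorial_ne_zero (e 1))
  field_simp

theorem exp_subst_add {f g : MvPowerSeries σ R} (hf : constantCoeff f = 0)
    (hg : constantCoeff g = 0) : (PowerSeries.exp R).subst (f + g) =
      (PowerSeries.exp R).subst f * (PowerSeries.exp R).subst g := by
  have ha : HasSubst ![f, g] := hasSubst_of_constantCoeff_zero fun i => by
    fin_cases i
    · exact hf
    · exact hg
  have h := congrArg (subst ![f, g]) (exp_subst_X_add_X (R := R))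
  rw [subst_mul ha, exp_subst_subst ha (by simp), exp_subst_subst ha (by simp),
    exp_subst_subst ha (by simp), subst_add ha, subst_X ha, subst_X ha] at h
  exact h

theorem exp_subst_zero : (PowerSeries.exp R).subst (0 : MvPowerSeries σ R) = 1 := by
  rw [PowerSeries.subst_zero_eq_C_constantCoeff, PowerSeries.constantCoeff_exp, map_one,
    map_one]

theorem isUnit_exp_subst {f : MvPowerSeries σ R} (hf : constantCoeff f = 0) :
    IsUnit ((PowerSeries.exp R).subst f) := by
  refine IsUnit.of_mul_eq_one ((PowerSeries.exp R).subst (-f)) ?_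
  rw [← exp_subst_add hf (by simp [hf]), add_neg_cancel, exp_subst_zero]

end Exp

/-! ### The bilinear equations as a residue -/

section Hirota

variable {R : Type*} [CommRing R]

/-- The grading `deg pₖ = deg p'ₖ = k`. -/
def wt : ℕ+ ⊕ ℕ+ → ℕ := Sum.elim (fun k => (k : ℕ)) fun k => (k : ℕ)

theorem hasSubst_X_comp {σ τ : Type*} {f : σ → τ} (hf : Function.Injective f) :
    HasSubst fun k => (X (f k) : MvPowerSeries τ R) where
  const_coeff k := by simp
  coeff_zero d := by
    classical
    refine Set.Subsingleton.finite fun s hs t ht => ?_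
    simp only [coeff_X, Set.mem_ofPred_eq, ne_eq, ite_eq_right_iff, not_forall] at hs ht
    obtain ⟨h1, -⟩ := hs
    obtain ⟨h2, -⟩ := ht
    exact hf ((Finsupp.single_left_inj one_ne_zero).1 (h1.symm.trans h2))

theorem coeff_X_sub_X_of_weight_ne {d : ℕ+ ⊕ ℕ+ →₀ ℕ} {k : ℕ+} (h : Finsupp.weight wt d ≠ k) :
    coeff d (X (.inl k) - X (.inr k) : MvPowerSeries (ℕ+ ⊕ ℕ+) R) = 0 := by
  classical
  rw [map_sub, coeff_X, coeff_X, if_neg, if_neg, sub_zero]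
  · rintro rfl
    exact h (by simp [wt, Finsupp.weight_single])
  · rintro rfl
    exact h (by simp [wt, Finsupp.weight_single])

/-- A series `s` in `v` whose coefficient of `v ^ j` is the part of weight `j` of `f`. -/
def IsWeightExpansion (s : PowerSeries (MvPowerSeries (ℕ+ ⊕ ℕ+) R))
    (f : MvPowerSeries (ℕ+ ⊕ ℕ+) R) : Prop :=
  ∀ j d, coeff d (PowerSeries.coeff j s) = if Finsupp.weight wt d = j then coeff d f else 0

theorem isWeightExpansion_pow {s : PowerSeries (MvPowerSeries (ℕ+ ⊕ ℕ+) R)}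
    {f : MvPowerSeries (ℕ+ ⊕ ℕ+) R} (h : IsWeightExpansion s f) (n : ℕ) :
    IsWeightExpansion (s ^ n) (f ^ n) := by
  classical
  induction n with
  | zero =>
    intro j d
    rw [pow_zero, pow_zero, PowerSeries.coeff_one, coeff_one]
    by_cases hd : d = 0
    · subst hd
      by_cases hj : j = 0
      · simp [hj]
      · simp [hj, Ne.symm hj]
    · split_ifs <;> simp [coeff_one, hd]
  | succ n ih =>
    intro j d
    rw [pow_succ, pow_succ, PowerSeries.coeff_mul, map_sum]
    simp_rw [coeff_mul]
    rw [Finset.sum_comm]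
    have h1 : ∀ p ∈ antidiagonal d, ∑ q ∈ antidiagonal j,
        coeff p.1 (PowerSeries.coeff q.1 (s ^ n)) * coeff p.2 (PowerSeries.coeff q.2 s) =
        if Finsupp.weight wt d = j then coeff p.1 (f ^ n) * coeff p.2 f else 0 := by
      intro p hp
      have hw : Finsupp.weight wt p.1 + Finsupp.weight wt p.2 = Finsupp.weight wt d := by
        rw [← map_add, Finset.HasAntidiagonal.mem_antidiagonal.1 hp]
      simp_rw [ih _ _, h _ _]
      split_ifs with hj
      · rw [Finset.sum_eq_single (Finsupp.weight wt p.1, Finsupp.weight wt p.2)]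
        · simp
        · rintro ⟨a, b⟩ hq hne
          by_cases ha : Finsupp.weight wt p.1 = a
          · rw [if_neg (c := Finsupp.weight wt p.2 = b), mul_zero]
            exact fun hb => hne (by rw [ha, hb])
          · rw [if_neg ha, zero_mul]
        · intro hq
          exact absurd (Finset.HasAntidiagonal.mem_antidiagonal.2 (hw.trans hj)) hq
      · refine Finset.sum_eq_zero fun q hq => ?_
        by_cases ha : Finsupp.weight wt p.1 = q.1
        · rw [if_neg (c := Finsupp.weight wt p.2 = q.2), mul_zero]
          intro hb
          rw [Finset.HasAntidiagonal.mem_antidiagonal] at hq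
          omega
        · rw [if_neg ha, zero_mul]
    rw [Finset.sum_congr rfl h1]
    split_ifs
    · rfl
    · exact Finset.sum_const_zero

/-- The inclusion of the series in `p` into the series in `p, p'`. -/
def inP : MvPowerSeries ℕ+ R → MvPowerSeries (ℕ+ ⊕ ℕ+) R := subst fun k => X (.inl k)

/-- The inclusion of the series in `p'` into the series in `p, p'`. -/
def inP' : MvPowerSeries ℕ+ R → MvPowerSeries (ℕ+ ⊕ ℕ+) R := subst fun k => X (.inr k)

theorem constantCoeff_inP {f : MvPowerSeries ℕ+ R} (hf : constantCoeff f = 0) :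
    constantCoeff (inP f) = 0 :=
  constantCoeff_subst_eq_zero (hasSubst_X_comp Sum.inl_injective) (by simp) hf

theorem constantCoeff_inP' {f : MvPowerSeries ℕ+ R} (hf : constantCoeff f = 0) :
    constantCoeff (inP' f) = 0 :=
  constantCoeff_subst_eq_zero (hasSubst_X_comp Sum.inr_injective) (by simp) hf

variable [Algebra ℚ R]

variable (R) in
/-- The series `∑ₖ (pₖ - p'ₖ) / k`. -/
def kernelLog : MvPowerSeries (ℕ+ ⊕ ℕ+) R :=
  inP (linForm fun k => algebraMap ℚ R (1 / (k : ℕ))) -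
    inP' (linForm fun k => algebraMap ℚ R (1 / (k : ℕ)))

theorem constantCoeff_kernelLog : constantCoeff (kernelLog R) = 0 := by
  rw [kernelLog, map_sub, constantCoeff_inP (constantCoeff_linForm _),
    constantCoeff_inP' (constantCoeff_linForm _), sub_zero]

theorem hasSum_kernelLog [UniformSpace R] [DiscreteUniformity R] :
    HasSum (fun k : ℕ+ => C (algebraMap ℚ R (1 / (k : ℕ))) * (X (.inl k) - X (.inr k)))
      (kernelLog R) := by
  have h1 := hasSum_subst_linForm (fun k : ℕ+ => algebraMap ℚ R (1 / (k : ℕ)))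
    (hasSubst_X_comp (R := R) (Sum.inl_injective (α := ℕ+) (β := ℕ+)))
  have h2 := hasSum_subst_linForm (fun k : ℕ+ => algebraMap ℚ R (1 / (k : ℕ)))
    (hasSubst_X_comp (R := R) (Sum.inr_injective (α := ℕ+) (β := ℕ+)))
  exact (h1.sub h2).congr_fun fun k => mul_sub _ _ _

theorem coeff_ratCast_smul {σ : Type*} (q : ℚ) (f : MvPowerSeries σ R) (d : σ →₀ ℕ) :
    coeff d (q • f) = algebraMap ℚ R q * coeff d f := by
  rw [← algebraMap_smul R q f, coeff_smul]

/-- `h_j(p - p')` is the part of weight `j` of `exp (∑ₖ (pₖ - p'ₖ) / k)`. -/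
theorem coeff_hSchur (d : ℕ+ ⊕ ℕ+ →₀ ℕ) (j : ℕ) :
    coeff d (hSchur (fun k : ℕ+ => (X (.inl k) - X (.inr k) : MvPowerSeries (ℕ+ ⊕ ℕ+) R)) j) =
      if Finsupp.weight wt d = j then coeff d ((PowerSeries.exp R).subst (kernelLog R)) else 0 := by
  let : UniformSpace R := ⊥
  set s : PowerSeries (MvPowerSeries (ℕ+ ⊕ ℕ+) R) := PowerSeries.mk fun k : ℕ =>
    if h : 0 < k then (1 / k : ℚ) • (X (.inl (⟨k, h⟩ : ℕ+)) - X (.inr (⟨k, h⟩ : ℕ+))) else 0 with hs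
  have hs0 : PowerSeries.constantCoeff s = 0 := by
    rw [← PowerSeries.coeff_zero_eq_constantCoeff_apply, hs, PowerSeries.coeff_mk]
    simp
  have hexp : IsWeightExpansion s (kernelLog R) := by
    intro j d
    have hsum : HasSum (fun k : ℕ+ => algebraMap ℚ R (1 / (k : ℕ)) *
        coeff d (X (.inl k) - X (.inr k) : MvPowerSeries (ℕ+ ⊕ ℕ+) R)) (coeff d (kernelLog R)) :=
      ((hasSum_kernelLog (R := R)).map (coeff d)
        (WithPiTopology.continuous_coeff R d)).congr_fun fun k => (coeff_C_mul _ _ _).symm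
    rw [hs, PowerSeries.coeff_mk]
    split_ifs with h0 hj hj
    · subst hj
      have h1 := hsum.unique (hasSum_single (⟨_, h0⟩ : ℕ+) fun (k : ℕ+) hk => by
        rw [coeff_X_sub_X_of_weight_ne, mul_zero]
        exact fun h => hk (PNat.coe_injective h.symm))
      exact (coeff_ratCast_smul _ _ _).trans h1.symm
    · refine (coeff_ratCast_smul _ _ _).trans ?_
      have h1 := coeff_X_sub_X_of_weight_ne (R := R) (k := ⟨j, h0⟩) hj
      exact (congrArg _ h1).trans (mul_zero _)
    · rw [map_zero]
      refine (hsum.unique (hasSum_zero.congr_fun fun k => ?_)).symm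
      rw [coeff_X_sub_X_of_weight_ne, mul_zero]
      have := k.pos
      omega
    · rw [map_zero]
  have hsub := PowerSeries.HasSubst.of_constantCoeff_zero' hs0
  rw [hSchur, PowerSeries.coeff_subst' hsub,
    PowerSeries.coeff_subst (PowerSeries.HasSubst.of_constantCoeff_zero constantCoeff_kernelLog)]
  have hmap := AddMonoidHom.map_finsum ((coeff (R := R) d).toAddMonoidHom)
    (PowerSeries.coeff_subst_finite' hsub (PowerSeries.exp (MvPowerSeries (ℕ+ ⊕ ℕ+) R)) j)
  rw [LinearMap.toAddMonoidHom_coe] at hmap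
  rw [hmap]
  have hterm (n : ℕ) : coeff d (PowerSeries.coeff n (PowerSeries.exp (MvPowerSeries (ℕ+ ⊕ ℕ+) R)) •
      PowerSeries.coeff j (s ^ n)) = if Finsupp.weight wt d = j then
        PowerSeries.coeff n (PowerSeries.exp R) • coeff d (kernelLog R ^ n) else 0 := by
    have halg : algebraMap ℚ (MvPowerSeries (ℕ+ ⊕ ℕ+) R) (1 / n.factorial) =
        C (algebraMap ℚ R (1 / n.factorial)) := by
      rw [IsScalarTower.algebraMap_apply ℚ R (MvPowerSeries (ℕ+ ⊕ ℕ+) R),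
        MvPowerSeries.algebraMap_apply, Algebra.algebraMap_self_apply]
    rw [PowerSeries.coeff_exp, PowerSeries.coeff_exp, halg, smul_eq_mul, coeff_C_mul,
      isWeightExpansion_pow hexp, smul_eq_mul, mul_ite, mul_zero]
  simp_rw [hterm]
  split_ifs
  · rfl
  · exact finsum_zero

/-- Hirota's equations as the vanishing of a single residue: in the rescaled variables the generating
series of the `h_j(p - p') w ^ (-j)` is the exponential of `kernelLog`, of weight zero. -/
theorem isTauFunction_iff (τ : MvPowerSeries ℕ+ R) : IsTauFunction τ ↔
    scaledRes wt (subst (scaledVar fun _ => 0 : ℕ+ ⊕ ℕ+ → MvPowerSeries ((ℕ+ ⊕ ℕ+) ⊕ Unit) R)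
      ((PowerSeries.exp R).subst (kernelLog R) : MvPowerSeries (ℕ+ ⊕ ℕ+) R) *
      subst (scaledVarW wt) (shiftedProduct τ)) = (0 : MvPowerSeries (ℕ+ ⊕ ℕ+) R) := by
  classical
  rw [MvPowerSeries.ext_iff, IsTauFunction]
  refine forall_congr' fun d => ?_
  rw [map_zero, coeff_scaledRes_mul_subst_scaledVarW]
  have h : ∑ᶠ j : ℕ, coeff d (hSchur (fun k : ℕ+ => (X (.inl k) - X (.inr k) :
        MvPowerSeries (ℕ+ ⊕ ℕ+) R)) j * wCoeff (j + 1) (shiftedProduct τ)) =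
      ∑ p ∈ antidiagonal d, coeff (joinExp p.1 (Finsupp.weight wt p.2 + 1)) (shiftedProduct τ) *
        coeff p.2 ((PowerSeries.exp R).subst (kernelLog R) : MvPowerSeries (ℕ+ ⊕ ℕ+) R) := by
    have h1 (j : ℕ) : coeff d (hSchur (fun k : ℕ+ => (X (.inl k) - X (.inr k) :
        MvPowerSeries (ℕ+ ⊕ ℕ+) R)) j * wCoeff (j + 1) (shiftedProduct τ)) =
        ∑ p ∈ antidiagonal d, if Finsupp.weight wt p.2 = j then
          coeff (joinExp p.1 (j + 1)) (shiftedProduct τ) *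
          coeff p.2 ((PowerSeries.exp R).subst (kernelLog R) : MvPowerSeries (ℕ+ ⊕ ℕ+) R) else 0 := by
      rw [mul_comm, coeff_mul]
      refine Finset.sum_congr rfl fun p _ => ?_
      rw [coeff_hSchur, mul_ite, mul_zero]
      rfl
    simp_rw [h1]
    rw [finsum_sum_comm]
    · refine Finset.sum_congr rfl fun p _ => ?_
      rw [finsum_eq_single _ (Finsupp.weight wt p.2)]
      · simp
      · intro j hj
        exact if_neg (Ne.symm hj)
    · intro p _
      refine (Set.finite_singleton (Finsupp.weight wt p.2)).subset fun j hj => ?_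
      by_contra hne
      exact hj (if_neg (Ne.symm hne))
  rw [h]

end Hirota

/-! ### Linear forms with coefficients depending on the additional variable -/

section WForm

variable {R : Type*} [CommRing R] {σ : Type*}

theorem coeff_ofW_mul_X [DecidableEq σ] (g : R⟦X⟧) (s : σ) (d : σ →₀ ℕ) (n : ℕ) :
    coeff (joinExp d n) (ofW σ g * X (.inl s)) =
      if d = Finsupp.single s 1 then PowerSeries.coeff n g else 0 := by
  have h := coeff_ofW_mul_subst_scaledVar (fun _ : σ => 0) g (X s) d n
  rw [subst_X (hasSubst_scaledVar _), scaledVar, pow_zero, mul_one, coeff_X, mul_ite, mul_one,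
    mul_zero, Finsupp.weight_apply, Finsupp.sum] at h
  simpa using h

/-- The linear form `∑ₖ cₖ(w) P_{i k}` whose coefficients are series in `w`. -/
def wLinForm (i : ℕ+ → σ) (c : ℕ+ → R⟦X⟧) : MvPowerSeries (σ ⊕ Unit) R :=
  fun D => ∑ᶠ k, coeff D (ofW σ (c k) * X (.inl (i k)))

theorem coeff_wLinForm (i : ℕ+ → σ) (c : ℕ+ → R⟦X⟧) (D : σ ⊕ Unit →₀ ℕ) :
    coeff D (wLinForm i c) = ∑ᶠ k, coeff D (ofW σ (c k) * X (.inl (i k))) := rfl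

theorem coeff_wLinForm_single {i : ℕ+ → σ} (hi : Function.Injective i) (c : ℕ+ → R⟦X⟧) (k : ℕ+)
    (n : ℕ) :
    coeff (joinExp (Finsupp.single (i k) 1) n) (wLinForm i c) = PowerSeries.coeff n (c k) := by
  classical
  rw [coeff_wLinForm, finsum_eq_single _ k]
  · rw [coeff_ofW_mul_X, if_pos rfl]
  · intro l hl
    rw [coeff_ofW_mul_X, if_neg]
    exact fun h => hl (hi ((Finsupp.single_left_inj one_ne_zero).1 h).symm)

theorem coeff_wLinForm_of_forall_ne (i : ℕ+ → σ) (c : ℕ+ → R⟦X⟧) {d : σ →₀ ℕ}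
    (h : ∀ k, d ≠ Finsupp.single (i k) 1) (n : ℕ) : coeff (joinExp d n) (wLinForm i c) = 0 := by
  classical
  rw [coeff_wLinForm]
  exact finsum_eq_zero_of_forall_eq_zero fun k => by rw [coeff_ofW_mul_X, if_neg (h k)]

theorem constantCoeff_wLinForm (i : ℕ+ → σ) (c : ℕ+ → R⟦X⟧) :
    constantCoeff (wLinForm i c) = 0 := by
  rw [← coeff_zero_eq_constantCoeff_apply, ← Finsupp.single_zero (.inr ()), ← joinExp_zero_left,
    coeff_wLinForm_of_forall_ne]
  exact fun k h => one_ne_zero (Finsupp.single_eq_zero.1 h.symm)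

theorem wLinForm_ext {i : ℕ+ → σ} {f : MvPowerSeries (σ ⊕ Unit) R} {c : ℕ+ → R⟦X⟧}
    (hi : Function.Injective i)
    (h1 : ∀ k n, coeff (joinExp (Finsupp.single (i k) 1) n) f = PowerSeries.coeff n (c k))
    (h2 : ∀ d n, (∀ k, d ≠ Finsupp.single (i k) 1) → coeff (joinExp d n) f = 0) :
    f = wLinForm i c := by
  ext D
  obtain ⟨d, n, rfl⟩ := exists_eq_joinExp D
  by_cases hd : ∃ k, d = Finsupp.single (i k) 1
  · obtain ⟨k, rfl⟩ := hd
    rw [h1, coeff_wLinForm_single hi]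
  · rw [not_exists] at hd
    rw [h2 d n hd, coeff_wLinForm_of_forall_ne i c hd]

theorem wLinForm_add {i : ℕ+ → σ} (hi : Function.Injective i) (c c' : ℕ+ → R⟦X⟧) :
    wLinForm i c + wLinForm i c' = wLinForm i fun k => c k + c' k := by
  refine wLinForm_ext hi (fun k n => ?_) fun d n h => ?_
  · rw [map_add, coeff_wLinForm_single hi, coeff_wLinForm_single hi, map_add]
  · rw [map_add, coeff_wLinForm_of_forall_ne i _ h, coeff_wLinForm_of_forall_ne i _ h, add_zero]

theorem wLinForm_single [DecidableEq ℕ+] {i : ℕ+ → σ} (hi : Function.Injective i) (k : ℕ+)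
    (g : R⟦X⟧) : wLinForm i (fun l => if k = l then g else 0) = ofW σ g * X (.inl (i k)) := by
  classical
  symm
  refine wLinForm_ext hi (fun l n => ?_) fun d n h => ?_
  · rw [coeff_ofW_mul_X]
    by_cases h : k = l
    · rw [if_pos h, h, if_pos rfl]
    · rw [if_neg h, map_zero, if_neg]
      exact fun hs => h (hi ((Finsupp.single_left_inj one_ne_zero).1 hs).symm)
  · rw [coeff_ofW_mul_X, if_neg (h k)]

section Topology

variable [UniformSpace R]

theorem hasSum_wLinForm_of_forall {ι : Type*} {i : ℕ+ → σ} (hi : Function.Injective i)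
    {A : ι → ℕ+ → R⟦X⟧} {c : ℕ+ → R⟦X⟧}
    (h : ∀ k n, HasSum (fun j => PowerSeries.coeff n (A j k)) (PowerSeries.coeff n (c k))) :
    HasSum (fun j => wLinForm i (A j)) (wLinForm i c) := by
  rw [WithPiTopology.hasSum_iff_hasSum_coeff]
  intro D
  obtain ⟨d, n, rfl⟩ := exists_eq_joinExp D
  by_cases hd : ∃ k, d = Finsupp.single (i k) 1
  · obtain ⟨k, rfl⟩ := hd
    simp_rw [coeff_wLinForm_single hi]
    exact h k n
  · rw [not_exists] at hd
    simp_rw [coeff_wLinForm_of_forall_ne i _ hd]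
    exact hasSum_zero

theorem hasSum_wLinForm {i : ℕ+ → σ} (hi : Function.Injective i) (c : ℕ+ → R⟦X⟧) :
    HasSum (fun k => ofW σ (c k) * X (.inl (i k))) (wLinForm i c) := by
  classical
  simp_rw [← wLinForm_single hi]
  refine hasSum_wLinForm_of_forall hi fun k n => ?_
  refine (hasSum_ite_eq k (PowerSeries.coeff n (c k))).congr_fun fun l => ?_
  split_ifs with h
  · rw [h]
  · exact map_zero _

theorem hasSum_ofW {ι : Type*} {A : ι → R⟦X⟧} {g : R⟦X⟧}
    (h : ∀ n, HasSum (fun j => PowerSeries.coeff n (A j)) (PowerSeries.coeff n g)) :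
    HasSum (fun j => ofW σ (A j)) (ofW σ g) := by
  classical
  rw [WithPiTopology.hasSum_iff_hasSum_coeff]
  intro D
  obtain ⟨d, n, rfl⟩ := exists_eq_joinExp D
  simp_rw [coeff_ofW]
  split_ifs
  · exact h n
  · exact hasSum_zero

end Topology

theorem ofW_mul_wLinForm {i : ℕ+ → σ} (hi : Function.Injective i) (g : R⟦X⟧) (c : ℕ+ → R⟦X⟧) :
    ofW σ g * wLinForm i c = wLinForm i fun k => g * c k := by
  let : UniformSpace R := ⊥
  refine ((hasSum_wLinForm hi c).mul_left (ofW σ g)).unique ?_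
  refine (hasSum_wLinForm hi fun k => g * c k).congr_fun fun k => ?_
  rw [ofW_mul, mul_assoc]

theorem ofW_C (r : R) : ofW σ (PowerSeries.C r) = C r := by
  classical
  ext D
  obtain ⟨d, n, rfl⟩ := exists_eq_joinExp D
  rw [coeff_ofW, PowerSeries.coeff_C, coeff_C]
  have h : joinExp d n = 0 ↔ d = 0 ∧ n = 0 := by
    rw [← joinExp_inj, joinExp_zero_left, Finsupp.single_zero]
  simp only [h]
  split_ifs <;> simp_all

/-- A linear form in the variables `w ^ m (i k) P_{i k}`. -/
theorem subst_scaledVar_linForm {i : ℕ+ → σ} (hi : Function.Injective i) (m : σ → ℕ)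
    (c : ℕ+ → R) : subst (scaledVar m) (subst (fun k => X (i k) : ℕ+ → MvPowerSeries σ R)
      (linForm c)) = wLinForm i fun k => PowerSeries.C (c k) * PowerSeries.X ^ m (i k) := by
  let : UniformSpace R := ⊥
  refine (hasSum_subst (hasSum_subst_linForm c (hasSubst_X_comp hi))
    (hasSubst_scaledVar m)).unique ?_
  refine (hasSum_wLinForm hi _).congr_fun fun k => ?_
  rw [subst_mul (hasSubst_scaledVar m), subst_C', subst_X (hasSubst_scaledVar m), scaledVar,
    ofW_mul, ofW_C, ofW_pow, ofW_X]
  ring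

end WForm

/-! ### Shifted variables -/

section Shift

variable {R : Type*} [CommRing R] {σ : Type*}

/-- The shifted variables `pₖ + e wᵏ` after the rescaling `pₖ = wᵏ Pₖ`. -/
def shiftVar (e : R) (i : ℕ+ → σ) (k : ℕ+) : MvPowerSeries (σ ⊕ Unit) R :=
  X (.inr ()) ^ (k : ℕ) * (X (.inl (i k)) + C e)

theorem shiftVar_eq (e : R) (i : ℕ+ → σ) (k : ℕ+) : shiftVar e i k =
    ofW σ (PowerSeries.X ^ (k : ℕ)) * X (.inl (i k)) +
      ofW σ (PowerSeries.C e * PowerSeries.X ^ (k : ℕ)) := by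
  rw [shiftVar, ofW_mul, ofW_C, ofW_pow, ofW_X]
  ring

theorem hasSubst_shiftVar (e : R) {i : ℕ+ → σ} (hi : Function.Injective i) :
    HasSubst (shiftVar e i) where
  const_coeff k := by simp [shiftVar, k.ne_zero]
  coeff_zero D := by
    classical
    obtain ⟨d, n, rfl⟩ := exists_eq_joinExp D
    have h1 : {k | d = Finsupp.single (i k) 1}.Finite := by
      refine Set.Subsingleton.finite fun a ha b hb => hi ?_
      exact (Finsupp.single_left_inj one_ne_zero).1 (ha.symm.trans hb)
    have h2 : {k : ℕ+ | n = k}.Finite :=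
      Set.Subsingleton.finite fun a ha b hb => PNat.coe_injective (ha.symm.trans hb)
    refine (h1.union h2).subset fun k hk => ?_
    by_contra hcon
    rw [Set.mem_union, not_or] at hcon
    apply hk
    simp only [Set.mem_ofPred_eq] at hcon
    rw [shiftVar_eq, map_add, coeff_ofW_mul_X, if_neg hcon.1, coeff_ofW, PowerSeries.coeff_C_mul,
      PowerSeries.coeff_X_pow, if_neg hcon.2]
    simp

theorem subst_scaledVarW_shift {wt : σ → ℕ} (e : R) {i : ℕ+ → σ} (hwt : ∀ k, wt (i k) = k)
    {a : ℕ+ → MvPowerSeries (σ ⊕ Unit) R} (ha : HasSubst a)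
    (hae : ∀ k, a k = X (.inl (i k)) + C e * X (.inr ()) ^ (k : ℕ)) (f : MvPowerSeries ℕ+ R) :
    subst (scaledVarW wt) (subst a f) = subst (shiftVar e i) f := by
  have hW := hasSubst_scaledVarW (R := R) wt
  rw [subst_comp_subst_apply ha hW]
  congr 1
  funext k
  rw [hae, subst_add hW, subst_mul hW, subst_C', subst_pow hW, subst_X hW, subst_X hW, scaledVarW,
    Sum.elim_inl, Sum.elim_inr, scaledVar, hwt, shiftVar]
  ring

/-- The shifted product after the rescaling. -/
theorem subst_scaledVarW_shiftedProduct (τ : MvPowerSeries ℕ+ R) :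
    subst (scaledVarW wt : _ → MvPowerSeries ((ℕ+ ⊕ ℕ+) ⊕ Unit) R) (shiftedProduct τ) =
      subst (shiftVar (-1 : R) Sum.inl) τ * subst (shiftVar (1 : R) Sum.inr) τ := by
  rw [shiftedProduct, subst_mul (hasSubst_scaledVarW wt),
    subst_scaledVarW_shift (-1) (i := Sum.inl) (fun _ => rfl) hasSubst_shift_sub fun k => by
      rw [map_neg, map_one, neg_one_mul, sub_eq_add_neg],
    subst_scaledVarW_shift 1 (i := Sum.inr) (fun _ => rfl) hasSubst_shift_add fun k => by
      rw [map_one, one_mul]]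

theorem constantCoeff_subst_shiftVar (e : R) {i : ℕ+ → σ} (hi : Function.Injective i)
    {f : MvPowerSeries ℕ+ R} (hf : constantCoeff f = 0) :
    constantCoeff (subst (shiftVar e i) f) = 0 :=
  constantCoeff_subst_eq_zero (hasSubst_shiftVar e hi) (fun k => by simp [shiftVar, k.ne_zero]) hf

end Shift

/-! ### The change of variables in the rescaled variables -/

section Dressing

variable {R : Type*} [CommRing R] {σ : Type*}

/-- The substitution `P_b ↦ v(w) ^ (-b) ∑ₖ c^b_k w ^ (k - b) Pₖ`, where `x = z v(z)`: the change of
variables `p_b = ∑ₖ c^b_k qₖ` rewritten for `p_b = x(w) ^ b P_b` and `qₖ = w ^ k Pₖ`. The terms with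
`k < b` vanish because `c^b_k = 0`. -/
def dressedVar (x : R⟦X⟧) (i : ℕ+ → σ) (b : ℕ+) : MvPowerSeries (σ ⊕ Unit) R :=
  wLinForm i fun k => PowerSeries.C (PowerSeries.coeff k (x ^ (b : ℕ))) *
    (PowerSeries.X ^ (k - b : ℕ) * Ring.inverse (shift x) ^ (b : ℕ))

theorem hasSubst_dressedVar {x : R⟦X⟧} (hx : PowerSeries.constantCoeff x = 0) {i : ℕ+ → σ}
    (hi : Function.Injective i) : HasSubst (dressedVar x i) where
  const_coeff b := by
    rw [dressedVar, constantCoeff_wLinForm]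
    exact IsNilpotent.zero
  coeff_zero D := by
    obtain ⟨d, n, rfl⟩ := exists_eq_joinExp D
    by_cases hd : ∃ k, d = Finsupp.single (i k) 1
    · obtain ⟨k, rfl⟩ := hd
      refine (Set.finite_Iic k).subset fun b hb => ?_
      by_contra hlt
      apply hb
      rw [dressedVar, coeff_wLinForm_single hi, coeff_pow_eq_zero hx, map_zero, zero_mul, map_zero]
      rw [Set.mem_Iic, not_le] at hlt
      exact_mod_cast hlt
    · rw [not_exists] at hd
      refine Set.Finite.subset Set.finite_empty fun b hb => hb ?_
      rw [dressedVar, coeff_wLinForm_of_forall_ne i _ hd]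

/-- `w ^ b` times the dressed variable is `v(w) ^ (-b)` times the rescaled change of variables. -/
theorem X_pow_mul_dressedVar {x : R⟦X⟧} (hx : PowerSeries.constantCoeff x = 0) {i : ℕ+ → σ}
    (hi : Function.Injective i) (b : ℕ+) :
    X (.inr ()) ^ (b : ℕ) * dressedVar x i b = ofW σ (Ring.inverse (shift x) ^ (b : ℕ)) *
      wLinForm i fun k => PowerSeries.C (PowerSeries.coeff k (x ^ (b : ℕ))) *
        PowerSeries.X ^ (k : ℕ) := by
  rw [← ofW_X, ← ofW_pow, dressedVar, ofW_mul_wLinForm hi, ofW_mul_wLinForm hi]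
  congr 1
  funext k
  rcases lt_or_ge (k : ℕ) b with h | h
  · rw [coeff_pow_eq_zero hx h, map_zero]
    ring
  · have h1 : (PowerSeries.X : R⟦X⟧) ^ (k : ℕ) =
        PowerSeries.X ^ (b : ℕ) * PowerSeries.X ^ (k - b : ℕ) := by
      rw [← pow_add, Nat.add_sub_cancel' h]
    rw [h1]
    ring

theorem hasSum_ofW_coeff [UniformSpace R] {g : R⟦X⟧} (hg : PowerSeries.constantCoeff g = 0) :
    HasSum (fun k : ℕ+ => ofW σ (PowerSeries.C (PowerSeries.coeff k g) * PowerSeries.X ^ (k : ℕ)))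
      (ofW σ g) := by
  refine hasSum_ofW fun n => ?_
  simp_rw [PowerSeries.coeff_C_mul, PowerSeries.coeff_X_pow]
  rcases Nat.eq_zero_or_pos n with rfl | hn
  · rw [PowerSeries.coeff_zero_eq_constantCoeff_apply, hg]
    refine hasSum_zero.congr_fun fun k => ?_
    rw [if_neg k.ne_zero.symm, mul_zero]
  · refine (hasSum_ite_eq (⟨n, hn⟩ : ℕ+) (PowerSeries.coeff n g)).congr_fun fun k => ?_
    by_cases h : k = ⟨n, hn⟩
    · subst h
      simp
    · rw [if_neg h, if_neg, mul_zero]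
      exact fun h1 => h (PNat.coe_injective h1.symm)

/-- The substitution `dressedVar`, with `w ↦ x(w)`, turns the shift of the variables `p` into the shift
of the variables `q`. -/
theorem subst_shiftVar_linChange {x : R⟦X⟧} (hx : PowerSeries.constantCoeff x = 0)
    (hu : IsUnit (PowerSeries.coeff 1 x)) (e : R) {i : ℕ+ → σ} (hi : Function.Injective i)
    {T : σ → MvPowerSeries (σ ⊕ Unit) R} (hT : HasSubst T) (hTi : ∀ b, T (i b) = dressedVar x i b)
    (f : MvPowerSeries ℕ+ R) :
    subst (Sum.elim T fun _ => ofW σ x) (subst (shiftVar e i) f) =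
      subst (shiftVar e i) (subst (linChange x) f) := by
  have hΘ : HasSubst (Sum.elim T fun _ : Unit => ofW σ x) :=
    hasSubst_sumElim_const hT (by rw [constantCoeff_ofW hx]; exact IsNilpotent.zero)
  rw [subst_comp_subst_apply (hasSubst_shiftVar e hi) hΘ,
    subst_comp_subst_apply (hasSubst_linChange hx) (hasSubst_shiftVar e hi)]
  congr 1
  funext b
  let : UniformSpace R := ⊥
  rw [shiftVar, subst_mul hΘ, subst_add hΘ, subst_pow hΘ, subst_C', subst_X hΘ, subst_X hΘ,
    Sum.elim_inl, Sum.elim_inr, hTi]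
  have h1 : ofW σ x ^ (b : ℕ) * dressedVar x i b =
      wLinForm i fun k => PowerSeries.C (PowerSeries.coeff k (x ^ (b : ℕ))) *
        PowerSeries.X ^ (k : ℕ) := by
    have hx' : ofW σ x = ofW σ (shift x) * X (.inr ()) := by
      rw [← ofW_X, ← ofW_mul, mul_comm, X_mul_shift hx]
    rw [hx', mul_pow, mul_assoc, X_pow_mul_dressedVar hx hi, ← mul_assoc, ofW_pow, ← mul_pow,
      ← ofW_mul, Ring.mul_inverse_cancel _ (isUnit_shift hu)]
    rw [← map_one (PowerSeries.C (R := R)), ofW_C, map_one, one_pow, one_mul]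
  rw [mul_add, h1, mul_comm _ (C e), ← ofW_pow]
  refine HasSum.unique ?_ (hasSum_subst_linForm _ (hasSubst_shiftVar e hi))
  refine ((hasSum_wLinForm hi _).add ((hasSum_ofW_coeff (σ := σ) (g := x ^ (b : ℕ))
    (by rw [map_pow, hx, zero_pow b.ne_zero])).mul_left (C e))).congr_fun fun k => ?_
  rw [shiftVar, ofW_mul, ofW_C, ofW_pow, ofW_X]
  ring

end Dressing

/-! ### The exponents in the residue -/

section Kernel

variable {R : Type*} [CommRing R] [Algebra ℚ R] {σ : Type*}

/-- The series `∑ₖ (∑_l L_{kl} w ^ l) w ^ k Pₖ` over `k, l ≥ 1`, where `L_{kl}` are the coefficients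
of the logarithm of `(x(w) - x(z)) / (w - z)`. -/
def crossTerm (x : R⟦X⟧) (i : ℕ+ → σ) : MvPowerSeries (σ ⊕ Unit) R :=
  wLinForm i fun k => PowerSeries.X ^ (k : ℕ) * PowerSeries.mk (offAxisLogCoeff x k)

/-- The effect of the substitution `dressedVar` on `∑ₖ Pₖ / k`, the rescaled form of
`∑_b p_b x(w) ^ (-b) / b`. -/
theorem subst_dressedVar_linForm {x : R⟦X⟧} (hx : PowerSeries.constantCoeff x = 0)
    (hu : IsUnit (PowerSeries.coeff 1 x)) {i : ℕ+ → σ} (hi : Function.Injective i) :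
    subst (dressedVar x i) (linForm fun k => algebraMap ℚ R (1 / (k : ℕ))) +
        wLinForm i (fun k => PowerSeries.C (logCoeff x k 0) * PowerSeries.X ^ (k : ℕ)) +
        crossTerm x i =
      wLinForm i fun k => PowerSeries.C (algebraMap ℚ R (1 / (k : ℕ))) := by
  let : UniformSpace R := ⊥
  have h : subst (dressedVar x i) (linForm fun k => algebraMap ℚ R (1 / (k : ℕ))) =
      wLinForm i fun k => PowerSeries.C (algebraMap ℚ R (1 / (k : ℕ))) -
        PowerSeries.X ^ (k : ℕ) * PowerSeries.mk (logCoeff x k) := by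
    refine (hasSum_subst_linForm _ (hasSubst_dressedVar hx hi)).unique ?_
    simp_rw [dressedVar, ← ofW_C, ofW_mul_wLinForm hi]
    refine hasSum_wLinForm_of_forall hi fun k n => ?_
    have h1 := sum_coeff_pow_smul hx hu k.ne_zero
    have hsmul (q : ℚ) (f : R⟦X⟧) : q • f = PowerSeries.C (algebraMap ℚ R q) * f := by
      rw [← algebraMap_smul R q f, PowerSeries.smul_eq_C_mul]
    simp_rw [hsmul, mul_one] at h1
    rw [← h1, map_sum]
    have h2 : HasSum (fun b : ℕ => PowerSeries.coeff n (PowerSeries.C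
        (algebraMap ℚ R (1 / (b + 1 : ℕ))) * (PowerSeries.C (PowerSeries.coeff k (x ^ (b + 1))) *
        (PowerSeries.X ^ (k - (b + 1) : ℕ) * Ring.inverse (shift x) ^ (b + 1)))))
        (∑ b ∈ Finset.range k, PowerSeries.coeff n (PowerSeries.C
        (algebraMap ℚ R (1 / (b + 1 : ℕ))) * (PowerSeries.C (PowerSeries.coeff k (x ^ (b + 1))) *
        (PowerSeries.X ^ (k - (b + 1) : ℕ) * Ring.inverse (shift x) ^ (b + 1))))) := by
      refine hasSum_sum_of_ne_finset_zero fun b hb => ?_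
      rw [Finset.mem_range, not_lt] at hb
      rw [coeff_pow_eq_zero hx (by omega), map_zero, zero_mul, mul_zero, map_zero]
    refine (Equiv.pnatEquivNat.symm.hasSum_iff).1 (h2.congr_fun fun b => ?_)
    simp [Equiv.pnatEquivNat]
  rw [h, crossTerm, wLinForm_add hi, wLinForm_add hi]
  congr 1
  funext k
  have h1 : PowerSeries.mk (logCoeff x k) =
      PowerSeries.C (logCoeff x k 0) + PowerSeries.mk (offAxisLogCoeff x k) := by
    ext n
    rw [map_add, PowerSeries.coeff_mk, PowerSeries.coeff_mk, PowerSeries.coeff_C, offAxisLogCoeff]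
    by_cases hn : n = 0
    · simp [hn]
    · simp [hn]
  rw [h1]
  ring

variable (x : R⟦X⟧)

/-- The quadratic form `1/2 ∑_{k, l ≥ 1} L_{kl} q_k q_l`, where `L_{kl}` are the coefficients of the
logarithm of `(x(w) - x(z)) / (w - z)`. -/
def logQuadForm : MvPowerSeries ℕ+ R :=
  quadForm fun k l => algebraMap ℚ R (1 / 2) * offAxisLogCoeff x k l

theorem hasSum_coeff_diagLog [UniformSpace R] (n : ℕ) :
    HasSum (fun p : ℕ+ × ℕ+ => PowerSeries.coeff n
      (PowerSeries.C (algebraMap ℚ R (1 / 2) * offAxisLogCoeff x p.1 p.2) *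
        PowerSeries.X ^ (p.1 + p.2 : ℕ)))
      (PowerSeries.coeff n (PowerSeries.C (algebraMap ℚ R (1 / 2)) * diagLog x)) := by
  simp_rw [PowerSeries.coeff_C_mul, PowerSeries.coeff_X_pow, diagLog, PowerSeries.coeff_mk,
    Finset.mul_sum]
  have h : HasSum (fun p : ℕ × ℕ => algebraMap ℚ R (1 / 2) * offAxisLogCoeff x p.1 p.2 *
      if n = p.1 + p.2 then 1 else 0)
      (∑ p ∈ antidiagonal n, algebraMap ℚ R (1 / 2) * offAxisLogCoeff x p.1 p.2 *
        if n = p.1 + p.2 then 1 else 0) := by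
    refine hasSum_sum_of_ne_finset_zero fun p hp => ?_
    rw [if_neg, mul_zero]
    exact fun h => hp (Finset.HasAntidiagonal.mem_antidiagonal.2 h.symm)
  rw [Finset.sum_congr rfl fun p hp => by
    rw [← mul_one (_ * _), ← if_pos (c := n = p.1 + p.2) (t := (1 : R)) (e := 0)
      (Finset.HasAntidiagonal.mem_antidiagonal.1 hp).symm]]
  have hinj : Function.Injective fun p : ℕ+ × ℕ+ => ((p.1 : ℕ), (p.2 : ℕ)) :=
    PNat.coe_injective.prodMap PNat.coe_injective
  refine (hinj.hasSum_iff ?_).2 h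
  rintro ⟨k, l⟩ hp
  rw [offAxisLogCoeff, if_neg, mul_zero, zero_mul]
  rintro ⟨hk, hl⟩
  exact hp ⟨(⟨k, Nat.pos_of_ne_zero hk⟩, ⟨l, Nat.pos_of_ne_zero hl⟩), rfl⟩

theorem hasSum_crossTerm [UniformSpace R] {i : ℕ+ → σ} (hi : Function.Injective i) :
    HasSum (fun p : ℕ+ × ℕ+ => ofW σ (PowerSeries.C (algebraMap ℚ R (1 / 2) *
      offAxisLogCoeff x p.1 p.2) * PowerSeries.X ^ (p.1 + p.2 : ℕ)) * X (.inl (i p.1)))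
      (C (algebraMap ℚ R (1 / 2)) * crossTerm x i) := by
  classical
  rw [crossTerm, ← ofW_C, ofW_mul_wLinForm hi]
  simp_rw [← wLinForm_single hi]
  refine hasSum_wLinForm_of_forall hi fun k n => ?_
  rw [PowerSeries.coeff_C_mul, PowerSeries.coeff_X_pow_mul', PowerSeries.coeff_mk]
  by_cases hn : (k : ℕ) < n
  · obtain ⟨l, rfl⟩ : ∃ l : ℕ+, n = k + l :=
      ⟨Nat.toPNat (n - k) (Nat.sub_pos_of_lt hn), (Nat.add_sub_cancel' hn.le).symm⟩
    rw [if_pos hn.le, Nat.add_sub_cancel_left]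
    refine (hasSum_ite_eq (k, l) _).congr_fun fun p => ?_
    by_cases hp : p = (k, l)
    · rw [hp, if_pos rfl, if_pos rfl, PowerSeries.coeff_C_mul, PowerSeries.coeff_X_pow_self, mul_one]
    · rw [if_neg hp]
      split_ifs with h
      · rw [PowerSeries.coeff_C_mul, PowerSeries.coeff_X_pow, if_neg, mul_zero]
        rw [h]
        exact fun h1 => hp (Prod.ext h (PNat.coe_injective (Nat.add_left_cancel h1).symm))
      · exact map_zero _
  · have h0 : (if (k : ℕ) ≤ n then offAxisLogCoeff x k (n - k) else 0) = 0 := by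
      split_ifs with h
      · rw [Nat.sub_eq_zero_of_le (not_lt.1 hn), offAxisLogCoeff, if_neg (by simp)]
      · rfl
    rw [h0, mul_zero]
    refine hasSum_zero.congr_fun fun p => ?_
    split_ifs with h
    · subst h
      rw [PowerSeries.coeff_C_mul, PowerSeries.coeff_X_pow, if_neg, mul_zero]
      have := p.2.pos
      omega
    · exact map_zero _

/-- The effect of the shift `qₖ ↦ qₖ + e wᵏ`, `e = ± 1`, on the quadratic form. -/
theorem subst_shiftVar_logQuadForm {x : R⟦X⟧} (hu : IsUnit (PowerSeries.coeff 1 x)) {e : R}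
    (he : e * e = 1) {m : σ → ℕ} {i : ℕ+ → σ} (hi : Function.Injective i) (hm : ∀ k, m (i k) = k) :
    subst (shiftVar e i) (logQuadForm x) =
      subst (scaledVar m) (subst (fun k => X (i k) : ℕ+ → MvPowerSeries σ R) (logQuadForm x)) +
        C e * crossTerm x i + C (algebraMap ℚ R (1 / 2)) * ofW σ (diagLog x) := by
  let : UniformSpace R := ⊥
  have h1 := hasSum_subst (hasSum_subst_quadForm (fun k l => algebraMap ℚ R (1 / 2) *
    offAxisLogCoeff x k l) (hasSubst_X_comp (R := R) hi)) (hasSubst_scaledVar m)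
  have h2 := (hasSum_crossTerm x hi).mul_left (C e)
  have h3 := (Equiv.prodComm ℕ+ ℕ+).hasSum_iff.2 h2
  have h4 := hasSum_ofW (σ := σ) (hasSum_coeff_diagLog x)
  have h5 : subst (scaledVar m) (subst (fun k => X (i k) : ℕ+ → MvPowerSeries σ R)
      (logQuadForm x)) + C e * crossTerm x i + C (algebraMap ℚ R (1 / 2)) * ofW σ (diagLog x) =
      subst (scaledVar m) (subst (fun k => X (i k) : ℕ+ → MvPowerSeries σ R) (logQuadForm x)) +
        (C e * (C (algebraMap ℚ R (1 / 2)) * crossTerm x i) +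
          C e * (C (algebraMap ℚ R (1 / 2)) * crossTerm x i)) +
        ofW σ (PowerSeries.C (algebraMap ℚ R (1 / 2)) * diagLog x) := by
    have hC : (C (algebraMap ℚ R (1 / 2)) + C (algebraMap ℚ R (1 / 2)) :
        MvPowerSeries (σ ⊕ Unit) R) = 1 := by
      rw [← map_add, ← map_add, add_halves, map_one, map_one]
    rw [ofW_mul, ofW_C]
    linear_combination (-C e * crossTerm x i) * hC
  rw [h5]
  refine (hasSum_subst_quadForm _ (hasSubst_shiftVar e hi)).unique ?_
  refine ((h1.add (h2.add h3)).add h4).congr_fun fun p => ?_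
  have hS := hasSubst_scaledVar (R := R) m
  have hee : (C e * C e : MvPowerSeries (σ ⊕ Unit) R) = 1 := by rw [← map_mul, he, map_one]
  simp only [Function.comp_apply, Equiv.prodComm_apply, Prod.fst_swap, Prod.snd_swap]
  rw [subst_mul hS, subst_C', subst_mul hS, subst_X hS, subst_X hS, scaledVar, scaledVar, hm, hm,
    ofW_mul, ofW_mul, ofW_C, ofW_C, ofW_pow, ofW_pow, ofW_X, offAxisLogCoeff_comm hu p.2 p.1,
    shiftVar, shiftVar]
  linear_combination (C (algebraMap ℚ R (1 / 2) * offAxisLogCoeff x p.1 p.2) *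
    X (.inr ()) ^ (p.1 : ℕ) * X (.inr ()) ^ (p.2 : ℕ)) * hee

end Kernel

/-! ### Comparison of the residues -/

section Main

variable {R : Type*} [CommRing R]

/-- The linear change of variables on both families `p` and `p'`. -/
def doubleLinChange (x : R⟦X⟧) : ℕ+ ⊕ ℕ+ → MvPowerSeries (ℕ+ ⊕ ℕ+) R :=
  Sum.elim (fun b => inP (linChange x b)) fun b => inP' (linChange x b)

theorem hasSubst_sumElim {α β υ : Type*} {a : α → MvPowerSeries υ R} {b : β → MvPowerSeries υ R}
    (ha : HasSubst a) (hb : HasSubst b) : HasSubst (Sum.elim a b) where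
  const_coeff := by
    rintro (s | s)
    · exact ha.const_coeff s
    · exact hb.const_coeff s
  coeff_zero d := by
    refine (((ha.coeff_zero d).image Sum.inl).union ((hb.coeff_zero d).image Sum.inr)).subset ?_
    rintro (s | s) hs
    · exact Or.inl ⟨s, hs, rfl⟩
    · exact Or.inr ⟨s, hs, rfl⟩

theorem hasSubst_subst {α β υ : Type*} {a : α → MvPowerSeries β R} {b : β → MvPowerSeries υ R}
    (ha : HasSubst a) (hb : HasSubst b) : HasSubst fun s => subst b (a s) := by
  have h := ha.comp hb
  rwa [coe_substAlgHom] at h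

theorem hasSubst_doubleLinChange {x : R⟦X⟧} (hx : PowerSeries.constantCoeff x = 0) :
    HasSubst (doubleLinChange x) :=
  hasSubst_sumElim (hasSubst_subst (hasSubst_linChange hx) (hasSubst_X_comp Sum.inl_injective))
    (hasSubst_subst (hasSubst_linChange hx) (hasSubst_X_comp Sum.inr_injective))

theorem subst_doubleLinChange_subst {x : R⟦X⟧} (hx : PowerSeries.constantCoeff x = 0)
    {y : R⟦X⟧} (hy : PowerSeries.constantCoeff y = 0) (h : y.subst x = PowerSeries.X)
    (f : MvPowerSeries (ℕ+ ⊕ ℕ+) R) :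
    subst (doubleLinChange x) (subst (doubleLinChange y) f) = f := by
  have hℓ := hasSubst_doubleLinChange hx
  have key {i : ℕ+ → ℕ+ ⊕ ℕ+} (hi : Function.Injective i)
      (hxi : ∀ b, doubleLinChange x (i b) = subst (fun k => X (i k)) (linChange x b)) (b : ℕ+) :
      subst (doubleLinChange x) (subst (fun k => X (i k) : ℕ+ → MvPowerSeries (ℕ+ ⊕ ℕ+) R)
        (linChange y b)) = X (i b) := by
    rw [subst_comp_subst_apply (hasSubst_X_comp hi) hℓ]
    simp_rw [subst_X hℓ, hxi]
    rw [← subst_comp_subst_apply (hasSubst_linChange hx) (hasSubst_X_comp hi),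
      subst_linChange_linChange hx hy, h, linChange_X, subst_X (hasSubst_X_comp hi)]
  rw [subst_comp_subst_apply (hasSubst_doubleLinChange hy) hℓ]
  have hX : (fun s => subst (doubleLinChange x) (doubleLinChange y s)) = X := by
    funext s
    rcases s with b | b
    · exact key Sum.inl_injective (fun _ => rfl) b
    · exact key Sum.inr_injective (fun _ => rfl) b
  rw [hX]
  exact congrFun subst_self f

/-- The dressed variables of both families. -/
def doubleDressedVar (x : R⟦X⟧) : ℕ+ ⊕ ℕ+ → MvPowerSeries ((ℕ+ ⊕ ℕ+) ⊕ Unit) R :=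
  Sum.elim (dressedVar x Sum.inl) (dressedVar x Sum.inr)

theorem hasSubst_doubleDressedVar {x : R⟦X⟧} (hx : PowerSeries.constantCoeff x = 0) :
    HasSubst (doubleDressedVar x) :=
  hasSubst_sumElim (hasSubst_dressedVar hx Sum.inl_injective)
    (hasSubst_dressedVar hx Sum.inr_injective)

theorem X_pow_mul_doubleDressedVar {x : R⟦X⟧} (hx : PowerSeries.constantCoeff x = 0)
    (s : ℕ+ ⊕ ℕ+) : X (.inr ()) ^ wt s * doubleDressedVar x s =
      ofW _ (Ring.inverse (shift x) ^ wt s) * subst (scaledVar wt) (doubleLinChange x s) := by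
  rcases s with b | b
  · refine (X_pow_mul_dressedVar hx Sum.inl_injective b).trans (congrArg _ ?_)
    exact (subst_scaledVar_linForm Sum.inl_injective wt _).symm
  · refine (X_pow_mul_dressedVar hx Sum.inr_injective b).trans (congrArg _ ?_)
    exact (subst_scaledVar_linForm Sum.inr_injective wt _).symm

variable [Algebra ℚ R]

/-- The logarithm of the factor by which the residues before and after the transformation differ. -/
def prefactorLog (x : R⟦X⟧) : MvPowerSeries (ℕ+ ⊕ ℕ+) R :=
  inP (logQuadForm x) + inP' (logQuadForm x) + inP (linForm fun k => logCoeff x k 0) -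
    inP' (linForm fun k => logCoeff x k 0)

theorem constantCoeff_logQuadForm (x : R⟦X⟧) : constantCoeff (logQuadForm x) = 0 :=
  constantCoeff_quadForm _

theorem constantCoeff_prefactorLog (x : R⟦X⟧) : constantCoeff (prefactorLog x) = 0 := by
  rw [prefactorLog, map_sub, map_add, map_add, constantCoeff_inP (constantCoeff_logQuadForm x),
    constantCoeff_inP' (constantCoeff_logQuadForm x), constantCoeff_inP (constantCoeff_linForm _),
    constantCoeff_inP' (constantCoeff_linForm _)]
  simp

/-- The comparison of the exponents in the two residues. -/
theorem exponent_eq {x : R⟦X⟧} (hx : PowerSeries.constantCoeff x = 0)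
    (hu : IsUnit (PowerSeries.coeff 1 x)) :
    subst (scaledVar (fun _ => 0) : _ → MvPowerSeries ((ℕ+ ⊕ ℕ+) ⊕ Unit) R) (kernelLog R) +
        (subst (shiftVar (-1 : R) Sum.inl) (logQuadForm x) +
          subst (shiftVar (1 : R) Sum.inr) (logQuadForm x)) =
      subst (doubleDressedVar x) (kernelLog R) + subst (scaledVar wt) (prefactorLog x) +
        ofW _ (diagLog x) := by
  have hS0 := hasSubst_scaledVar (R := R) (fun _ : ℕ+ ⊕ ℕ+ => 0)
  have hS := hasSubst_scaledVar (R := R) wt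
  have hT := hasSubst_doubleDressedVar hx
  have hl := hasSubst_X_comp (R := R) (Sum.inl_injective (α := ℕ+) (β := ℕ+))
  have hr := hasSubst_X_comp (R := R) (Sum.inr_injective (α := ℕ+) (β := ℕ+))
  set c : ℕ+ → R := fun k => algebraMap ℚ R (1 / (k : ℕ)) with hc
  have h1 : subst (doubleDressedVar x) (inP (linForm c)) =
      subst (dressedVar x Sum.inl) (linForm c) := by
    rw [inP, subst_comp_subst_apply hl hT]
    simp_rw [subst_X hT]
    rfl
  have h2 : subst (doubleDressedVar x) (inP' (linForm c)) =
      subst (dressedVar x Sum.inr) (linForm c) := by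
    rw [inP', subst_comp_subst_apply hr hT]
    simp_rw [subst_X hT]
    rfl
  have h3 := subst_dressedVar_linForm hx hu (Sum.inl_injective (α := ℕ+) (β := ℕ+))
  have h4 := subst_dressedVar_linForm hx hu (Sum.inr_injective (α := ℕ+) (β := ℕ+))
  have h5 := subst_shiftVar_logQuadForm hu (e := -1) (by ring) (m := wt)
    (Sum.inl_injective (α := ℕ+) (β := ℕ+)) fun _ => rfl
  have h6 := subst_shiftVar_logQuadForm hu (e := 1) (by ring) (m := wt)
    (Sum.inr_injective (α := ℕ+) (β := ℕ+)) fun _ => rfl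
  have h7 := subst_scaledVar_linForm (Sum.inl_injective (α := ℕ+) (β := ℕ+)) (fun _ => 0) c
  have h8 := subst_scaledVar_linForm (Sum.inr_injective (α := ℕ+) (β := ℕ+)) (fun _ => 0) c
  have h9 := subst_scaledVar_linForm (Sum.inl_injective (α := ℕ+) (β := ℕ+)) wt
    fun k => logCoeff x k 0
  have h10 := subst_scaledVar_linForm (Sum.inr_injective (α := ℕ+) (β := ℕ+)) wt
    fun k => logCoeff x k 0
  simp_rw [pow_zero, mul_one] at h7 h8
  have hC : (C (algebraMap ℚ R (1 / 2)) + C (algebraMap ℚ R (1 / 2)) :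
      MvPowerSeries ((ℕ+ ⊕ ℕ+) ⊕ Unit) R) = 1 := by
    rw [← map_add, ← map_add, add_halves, map_one, map_one]
  have hsub {α β : Type} {a : α → MvPowerSeries β R} (ha : HasSubst a) (f g : MvPowerSeries α R) :
      subst a (f - g) = subst a f - subst a g := by
    rw [← coe_substAlgHom ha, map_sub]
  rw [map_neg, map_one] at h5
  rw [map_one] at h6
  rw [prefactorLog, kernelLog, hsub hS0, hsub hT, hsub hS, subst_add hS, subst_add hS, h1, h2]
  simp only [inP, inP']
  rw [h5, h6, h7, h8, h9, h10]
  simp only [wt, Sum.elim_inl, Sum.elim_inr]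
  linear_combination ofW _ (diagLog x) * hC - h3 + h4

/-- The residues of a series and of its transform agree up to a linear change of variables and an
invertible factor. -/
theorem isTauFunction_subst_mul_exp {x : R⟦X⟧} (hx : PowerSeries.constantCoeff x = 0)
    (hu : IsUnit (PowerSeries.coeff 1 x)) (τ : MvPowerSeries ℕ+ R) :
    IsTauFunction (subst (linChange x) τ * (PowerSeries.exp R).subst (logQuadForm x)) ↔
      IsTauFunction τ := by
  have hS0 := hasSubst_scaledVar (R := R) (fun _ : ℕ+ ⊕ ℕ+ => 0)
  have hS := hasSubst_scaledVar (R := R) wt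
  have hT := hasSubst_doubleDressedVar hx
  have hinl := Sum.inl_injective (α := ℕ+) (β := ℕ+)
  have hinr := Sum.inr_injective (α := ℕ+) (β := ℕ+)
  have hsl := hasSubst_shiftVar (-1 : R) hinl
  have hsr := hasSubst_shiftVar (1 : R) hinr
  have hΘ : HasSubst (Sum.elim (doubleDressedVar x) fun _ : Unit => ofW (ℕ+ ⊕ ℕ+) x) :=
    hasSubst_sumElim_const hT (by rw [constantCoeff_ofW hx]; exact IsNilpotent.zero)
  have hk := constantCoeff_kernelLog (R := R)
  have hq := constantCoeff_logQuadForm x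
  have hp := constantCoeff_prefactorLog x
  set Gp := subst (scaledVar fun _ => 0 : ℕ+ ⊕ ℕ+ → MvPowerSeries ((ℕ+ ⊕ ℕ+) ⊕ Unit) R)
      ((PowerSeries.exp R).subst (kernelLog R) : MvPowerSeries (ℕ+ ⊕ ℕ+) R) *
      subst (scaledVarW wt) (shiftedProduct τ) with hGp
  set τ' := subst (linChange x) τ * (PowerSeries.exp R).subst (logQuadForm x) with hτ'
  set Gq := subst (scaledVar fun _ => 0 : ℕ+ ⊕ ℕ+ → MvPowerSeries ((ℕ+ ⊕ ℕ+) ⊕ Unit) R)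
      ((PowerSeries.exp R).subst (kernelLog R) : MvPowerSeries (ℕ+ ⊕ ℕ+) R) *
      subst (scaledVarW wt) (shiftedProduct τ') with hGq
  -- the invertible factor, free of `w`, by which the residues differ
  set U : MvPowerSeries (ℕ+ ⊕ ℕ+) R :=
    C (PowerSeries.coeff 1 x) * (PowerSeries.exp R).subst (prefactorLog x) with hU
  have hUu : IsUnit U := (hu.map C).mul (isUnit_exp_subst hp)
  have hexpT : subst (Sum.elim (doubleDressedVar x) fun _ : Unit => ofW (ℕ+ ⊕ ℕ+) x)
      (subst (scaledVar fun _ => 0 : ℕ+ ⊕ ℕ+ → MvPowerSeries ((ℕ+ ⊕ ℕ+) ⊕ Unit) R)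
        ((PowerSeries.exp R).subst (kernelLog R) : MvPowerSeries (ℕ+ ⊕ ℕ+) R)) =
      (PowerSeries.exp R).subst (subst (doubleDressedVar x) (kernelLog R)) := by
    rw [subst_comp_subst_apply hS0 hΘ, ← exp_subst_subst hT hk]
    congr 1
    funext s
    rw [scaledVar, pow_zero, mul_one, subst_X hΘ, Sum.elim_inl]
  have hG : Gq = ofW (ℕ+ ⊕ ℕ+) (PowerSeries.derivative R x * Ring.inverse (shift x) ^ 2) *
      subst (Sum.elim (doubleDressedVar x) fun _ : Unit => ofW (ℕ+ ⊕ ℕ+) x) Gp *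
        subst (scaledVar wt : _ → MvPowerSeries ((ℕ+ ⊕ ℕ+) ⊕ Unit) R) U := by
    have hexp := congrArg (fun f : MvPowerSeries ((ℕ+ ⊕ ℕ+) ⊕ Unit) R =>
      (PowerSeries.exp R).subst f) (exponent_eq hx hu)
    have hl := constantCoeff_subst_shiftVar (-1 : R) hinl hq
    have hr := constantCoeff_subst_shiftVar (1 : R) hinr hq
    have hd := constantCoeff_ofW (σ := ℕ+ ⊕ ℕ+) (constantCoeff_diagLog x)
    have hexpd : (PowerSeries.exp R).subst (ofW (ℕ+ ⊕ ℕ+) (diagLog x)) =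
        C (PowerSeries.coeff 1 x) *
          ofW (ℕ+ ⊕ ℕ+) (PowerSeries.derivative R x * Ring.inverse (shift x) ^ 2) := by
      rw [← ofW_C, ← ofW_mul, ← exp_subst_diagLog hu, ofW, ofW, PowerSeries.subst_comp_subst_apply
        (PowerSeries.HasSubst.of_constantCoeff_zero' (constantCoeff_diagLog x))
        (PowerSeries.HasSubst.X _)]
    have hk0 := constantCoeff_subst_scaledVar (fun _ => 0) hk
    have hpw := constantCoeff_subst_scaledVar wt hp
    have hkT : constantCoeff (subst (doubleDressedVar x) (kernelLog R)) = 0 := by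
      refine constantCoeff_subst_eq_zero hT (fun s => ?_) hk
      rcases s with b | b <;> exact constantCoeff_wLinForm _ _
    rw [exp_subst_add hk0 (by rw [map_add, hl, hr, add_zero]), exp_subst_add hl hr,
      exp_subst_add (by rw [map_add, hkT, hpw, add_zero]) hd, exp_subst_add hkT hpw, hexpd] at hexp
    rw [hGq, hτ', subst_scaledVarW_shiftedProduct, hGp, subst_mul hΘ, hexpT,
      subst_scaledVarW_shiftedProduct, subst_mul hΘ,
      subst_shiftVar_linChange hx hu _ hinl hT fun _ => rfl,
      subst_shiftVar_linChange hx hu _ hinr hT fun _ => rfl, subst_mul hsl, subst_mul hsr,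
      exp_subst_subst hS0 hk, exp_subst_subst hsl hq, exp_subst_subst hsr hq, hU, subst_mul hS,
      subst_C', exp_subst_subst hS hp]
    linear_combination (subst (shiftVar (-1 : R) Sum.inl) (subst (linChange x) τ) *
      subst (shiftVar (1 : R) Sum.inr) (subst (linChange x) τ)) * hexp
  have hres : scaledRes wt Gq = U * subst (doubleLinChange x) (scaledRes wt Gp) := by
    rw [hG, scaledRes_subst_mul, scaledRes_subst wt hx hu (hasSubst_doubleLinChange hx) hT
      (X_pow_mul_doubleDressedVar hx)]
  rw [isTauFunction_iff, isTauFunction_iff, ← hGp, ← hGq, hres, hUu.mul_right_eq_zero]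
  have hℓ := hasSubst_doubleLinChange hx
  have hy := PowerSeries.constantCoeff_substInvOfIsUnit x hu
  refine ⟨fun h => ?_, fun h => by rw [h, ← coe_substAlgHom hℓ, map_zero]⟩
  have h1 := subst_doubleLinChange_subst hy hx
    (PowerSeries.subst_substInvOfIsUnit_right x hx hu) (scaledRes wt Gp)
  rw [← h1, h, ← coe_substAlgHom (hasSubst_doubleLinChange hy), map_zero]

end Main

/-! ### Automorphisms of the hierarchy -/

section Automorphism

variable {R : Type*} [CommRing R]

theorem sum_Iic_product_Iic (f : ℕ → ℕ → R) (k l : ℕ+) {n : ℕ} (hk : (k : ℕ) ≤ n)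
    (hl : (l : ℕ) ≤ n) (hf : ∀ i j, (k : ℕ) < i ∨ (l : ℕ) < j → f i j = 0) :
    ∑ p ∈ Finset.Iic k ×ˢ Finset.Iic l, f p.1 p.2 =
      ∑ i ∈ Finset.range n, ∑ j ∈ Finset.range n, f (i + 1) (j + 1) := by
  rw [← Finset.sum_product']
  symm
  refine Finset.sum_bij_ne_zero (fun p _ _ => (Nat.succPNat p.1, Nat.succPNat p.2)) ?_ ?_ ?_ ?_
  · intro p hp hne
    rw [Finset.mem_product, Finset.mem_Iic, Finset.mem_Iic, ← PNat.coe_le_coe, ← PNat.coe_le_coe,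
      Nat.succPNat_coe, Nat.succPNat_coe]
    by_contra hcon
    rw [not_and_or, not_le, not_le] at hcon
    exact hne (hf _ _ hcon)
  · rintro p - - q - - h
    exact Prod.ext (Nat.succPNat_injective (congrArg Prod.fst h))
      (Nat.succPNat_injective (congrArg Prod.snd h))
  · rintro ⟨i, j⟩ hp hne
    rw [Finset.mem_product, Finset.mem_Iic, Finset.mem_Iic, ← PNat.coe_le_coe, ← PNat.coe_le_coe]
      at hp
    have hi := i.pos
    have hj := j.pos
    refine ⟨(i.natPred, j.natPred), ?_, ?_, ?_⟩
    · rw [Finset.mem_product, Finset.mem_range, Finset.mem_range]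
      have := PNat.natPred_add_one i
      have := PNat.natPred_add_one j
      dsimp only at hp ⊢
      omega
    · simpa only [PNat.natPred_add_one] using hne
    · rw [PNat.succPNat_natPred, PNat.succPNat_natPred]
  · intro p _ _
    rfl

variable [Algebra ℚ R]

/-- Since `Q` and the linear change of variables preserve the constant term, the transformation
multiplies the normalized exponential by that of the quadratic form. -/
theorem expNormalized_transform {x : R⟦X⟧} (hx : PowerSeries.constantCoeff x = 0)
    {Q : MvPowerSeries ℕ+ R} (hQ : subst (linChange x) Q = logQuadForm x)
    (Φ : MvPowerSeries ℕ+ R) : expNormalized (transform x Q Φ) =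
      subst (linChange x) (expNormalized Φ) * (PowerSeries.exp R).subst (logQuadForm x) := by
  have hs := hasSubst_linChange hx
  have hq := constantCoeff_logQuadForm x
  set φ := Φ - C (constantCoeff Φ) with hφ
  have hφ0 : constantCoeff φ = 0 := by simp [hφ]
  have hsφ : constantCoeff (subst (linChange x) φ) = 0 :=
    constantCoeff_subst_eq_zero hs (fun b => constantCoeff_linForm _) hφ0
  have hΦ : transform x Q Φ = subst (linChange x) φ + logQuadForm x + C (constantCoeff Φ) := by
    have h1 : Φ = φ + C (constantCoeff Φ) := by rw [hφ, sub_add_cancel]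
    rw [transform, subst_add hs, hQ]
    nth_rewrite 1 [h1]
    rw [subst_add hs, subst_C']
    ring
  have hc : constantCoeff (transform x Q Φ) = constantCoeff Φ := by
    rw [hΦ, map_add, map_add, hsφ, hq, constantCoeff_C, zero_add, zero_add]
  rw [expNormalized, hc, hΦ, add_sub_cancel_right, exp_subst_add hsφ hq, expNormalized, ← hφ,
    exp_subst_subst hs hφ0]

/-- A quadratic form that becomes `1/2 ∑_{k, l ≥ 1} L_{kl} q_k q_l` after the change of variables
gives an automorphism. -/
theorem isAutomorphism_transform {x : R⟦X⟧} (hx : PowerSeries.constantCoeff x = 0)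
    (hu : IsUnit (PowerSeries.coeff 1 x)) {Q : MvPowerSeries ℕ+ R}
    (hQ : subst (linChange x) Q = logQuadForm x) : IsAutomorphism (transform x Q) := by
  refine ⟨bijective_transform hx hu Q, fun Φ => ?_⟩
  rw [IsSolution, IsSolution, expNormalized_transform hx hQ, isTauFunction_subst_mul_exp hx hu]

theorem exists_isAutomorphism_transform {x : R⟦X⟧} (hx : PowerSeries.constantCoeff x = 0)
    (hu : IsUnit (PowerSeries.coeff 1 x)) :
    ∃ a : ℕ+ → ℕ+ → R, IsAutomorphism (transform x (quadForm a)) := by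
  have hy := PowerSeries.constantCoeff_substInvOfIsUnit x hu
  have h := subst_linChange_quadForm hy fun k l => algebraMap ℚ R (1 / 2) * offAxisLogCoeff x k l
  exact ⟨_, isAutomorphism_transform hx hu ((congrArg _ h.symm).trans
    (subst_linChange_subst_linChange hx hy (PowerSeries.subst_substInvOfIsUnit_left x hx hu) _))⟩

/-- For the series `xSeries β`, the form `-H_{0,2}` becomes `1/2 ∑_{k, l ≥ 1} L_{kl} q_k q_l`. -/
theorem subst_linChange_neg_H02 (β : R) :
    subst (linChange (xSeries β)) (-H02 β) = logQuadForm (xSeries β) := by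
  have hx := constantCoeff_xSeries β
  rw [H02, neg_quadForm, subst_linChange_quadForm hx, logQuadForm]
  congr 1
  funext k l
  have h := two_mul_sum_treeQuadCoeff β (le_max_left (k : ℕ) l) (le_max_right (k : ℕ) l)
  rw [← sum_Iic_product_Iic (fun i j => treeQuadCoeff β i j *
    (PowerSeries.coeff k (xSeries β ^ i) * PowerSeries.coeff l (xSeries β ^ j))) k l
    (le_max_left _ _) (le_max_right _ _)] at h
  · have h2 : algebraMap ℚ R (1 / 2) * 2 = 1 := by
      rw [← map_ofNat (algebraMap ℚ R) 2, ← map_mul]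
      norm_num
    simp only [neg_mul, Finset.sum_neg_distrib]
    have h3 : offAxisLogCoeff (xSeries β) k l = -(2 * _) := (neg_eq_iff_eq_neg.1 h.symm)
    rw [h3]
    refine Eq.trans ?_ (mul_neg _ _).symm
    rw [← mul_assoc, h2, one_mul]
    rfl
  · rintro i j (h | h)
    · rw [coeff_pow_eq_zero hx h, zero_mul, mul_zero]
    · rw [coeff_pow_eq_zero hx h, mul_zero, mul_zero]

end Automorphism

end ManyVariables

end KP

end

theorem theorem4 {R : Type*} [CommRing R] [Algebra ℚ R] :
    (∀ x : PowerSeries R, PowerSeries.constantCoeff x = 0 → IsUnit (PowerSeries.coeff 1 x) →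
      ∃ a : ℕ+ → ℕ+ → R, KP.IsAutomorphism (KP.transform x (KP.quadForm a))) ∧
    ∀ β : R, KP.IsAutomorphism (KP.transform (KP.xSeries β) (-KP.H02 β)) := by
  refine ⟨fun x hx hu => KP.exists_isAutomorphism_transform hx hu, fun β => ?_⟩
  refine KP.isAutomorphism_transform (KP.constantCoeff_xSeries β) ?_ (KP.subst_linChange_neg_H02 β)
  rw [KP.coeff_one_xSeries]
  exact isUnit_one
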